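/- **Setting.** Let $\mathbb X,\mathbb Y$ be finite-dimensional real normed spaces, $\mathcal X\subseteq\mathbb X$, $\mathcal Y\subseteq\mathbb Y$ nonempty closed convex sets with $\mathcal Y$ bounded, and $r:\mathbb X\to\mathbb R\cup\{+\infty\}$, $g:\mathbb Y\to\mathbb R\cup\{+\infty\}$ closed convex proper functions that are finite and Lipschitz on $\mathcal X$ and $\mathcal Y$, respectively. Consider $$\min_{x\in\mathcal X} q(x),\qquad q=f+r,\qquad f(x)=\max_{y\in\mathcal Y}\Phi(x,y)-g(y),$$ where $\Phi$ is jointly continuous on $\mathcal X\times\mathcal Y$, $\Phi(x,\cdot)$ is concave on $\mathcal Y$ for every $x\in\mathcal X$, $\Phi(\cdot,y)$ is differentiable on an open set containing $\mathcal X$ for all $y\in\mathcal Y$, $\Phi(x,\cdot)$ is differentiable on an open set containing $\mathcal Y$ for all $x\in\mathcal X$, and for all $x,x'\in\mathcal X$, $y,y'\in\mathcal Y$ $$\|\nabla_x\Phi(x,y)-\nabla_x\Phi(x',y)\|_*\le L_{xx}\|x-x'\|,\quad \|\nabla_x\Phi(x,y)-\nabla_x\Phi(x,y')\|_*\le \overline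 L_{xy}\|y-y'\|,$$ $$\|\nabla_y\Phi(x,y)-\nabla_y\Phi(x',y)\|_*\le L_{yx}\|x-x'\|,\quad \|\nabla_y\Phi(x,y)-\nabla_y\Phi(x,y')\|_*\le L_{yy}\|y-y'\|,$$ $$-\tfrac{\gamma}{2}\|x'-x\|^2\le \Phi(x',y)-\Phi(x,y)-\langle\nabla_x\Phi(x,y),x'-x\rangle ,\qquad 0<\gamma\le L_{xx}.$$ A distance generating function (DGF) on a set $\mathcal U$ is a function $\omega$ with values in $\mathbb R\cup\{+\infty\}$ that is essentially smooth (continuously differentiable on $\mathrm{int}\,\mathrm{dom}\,\omega\neq\emptyset$, with gradient norms tending to $+\infty$ at the boundary of $\mathrm{dom}\,\omega$) and finite, continuous and $1$-strongly convex on $\mathcal U$. Let $\omega_{\mathcal X},\omega_{\mathcal Y}$ be DGFs on $\mathcal X,\mathcal Y$; let $\omega_{\mathcal X}$ also be twice differentiable on an open set containing $\mathcal X$, with $\nabla\omega_{\mathcal X}$ being $\beta_{\mathcal X}$-Lipschitz on $\mathcal X$, $1\le\beta_{\mathcal X}<\infty$. Write $\mathcal X^o=\mathcal X\cap\mathrm{int}\,\mathrm{dom}\,\omega_{\mathcal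 X}$, $D(x',x)=\omega_{\mathcal X}(x')-\omega_{\mathcal X}(x)-\langle\nabla\omega_{\mathcal X}(x),x'-x\rangle$, $\Omega_{\mathcal Y}=\sup_{y\in\mathcal Y}|\omega_{\mathcal Y}(y)|$, $\lambda=1/(2\gamma)$, $\mathrm{prox}(q,x,\lambda)=\arg\min_{x'\in\mathcal X} q(x')+\lambda^{-1}D(x',x)$, and, for $\rho>0$, $$Q_\rho^\lambda(x';x)=\max_{y\in\mathcal Y}\{\Phi(x',y)-g(y)-\rho\,\omega_{\mathcal Y}(y)\}+r(x')+\lambda^{-1}D(x',x),\qquad q_\rho^\lambda(x)=\inf_{x'\in\mathcal X}Q_\rho^\lambda(x';x).$$ **Oracles.** The function $\Phi$ is accessible only through a primal and a dual stochastic oracle. Each call at a point $(x,y)\in\mathcal X\times\mathcal Y$ uses a fresh independent sample and returns a random vector with mean $\nabla_x\Phi(x,y)$ and variance $\mathbb E\|\cdot-\nabla_x\Phi(x,y)\|_*^2\le\sigma_x^2$ (primal oracle), respectively with mean $\nabla_y\Phi(x,y)$ and variance $\mathbb E\|\cdot-\nabla_y\Phi(x,y)\|_*^2\le\sigma_y^2$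 (dual oracle). **Algorithm (stochastic primal dual smoothing).** Given $\eta>0$, $K\ge1$, $\rho=\eta/(4\Omega_{\mathcal Y})$ and $x_1\in\mathcal X^o$: for $k=1,\dots,K$ find a random point $x_{k+1}\in\mathcal X^o$ with $$\mathbb E[Q_\rho^\lambda(x_{k+1};x_k)\mid x_k]\le q_\rho^\lambda(x_k)+\eta\quad\text{a.s.};$$ output $x_{\rm out}=x_i$, where $i$ is uniform on $\{1,\dots,K\}$ and independent of everything else. (If $\Omega_{\mathcal Y}=0$, then $\mathcal Y$ is a single point at which $\omega_{\mathcal Y}$ vanishes and the choice of $\rho$ is immaterial.) **Statement.** Fix the known data $\mathcal X,\mathcal Y,r,g,\omega_{\mathcal X},\omega_{\mathcal Y}$, the constants $\gamma,\beta_{\mathcal X},L_{xx},\overline L_{xy},L_{yx},L_{yy},\sigma_x,\sigma_y$, a starting point $x_1\in\mathcal X^o$ and $\Delta>0$. There is a constant $C$, depending on these only, such that for every $\varepsilon>0$ there are stochastic first-order methods for the subproblems (deterministic measurable rules that depend on the known data, on $\varepsilon$ and on $k$, start from $x_k$, choose adaptively at which points of $\mathcal X\times\mathcal Y$ to call which oracle,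 use $\Phi$ only through the answers, make a fixed number of calls, and return a point of $\mathcal X^o$) for which the following holds for every $\Phi$ as above with $q^*=\inf_{\mathcal X}q>-\infty$ and $q(x_1)-q^*\le\Delta$, and all stochastic oracles for it as above. Run with $$\eta=\frac{\varepsilon^2\lambda}{24\beta_{\mathcal X}^2},\qquad K=\Big\lceil\frac{16\beta_{\mathcal X}^2\Delta}{\lambda\varepsilon^2}\Big\rceil,$$ these methods produce points $x_{k+1}\in\mathcal X^o$ that satisfy the criterion of the algorithm in every step $k=1,\dots,K$; $\mathrm{prox}(q,x,\lambda)$ exists and is unique for every $x\in\mathcal X^o$; the output $x_{\rm out}\in\mathcal X^o$ is $\varepsilon$-near-stationary in expectation, $$\mathbb E\big[\|x_{\rm out}-\mathrm{prox}(q,x_{\rm out},\lambda)\|\big]\le\varepsilon\lambda/\beta_{\mathcal X};$$ and the total number of primal stochastic oracle calls and the total number of dual stochastic oracle calls are each at most $C\varepsilon^{-6}$. -/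

import Mathlib

open MeasureTheory ProbabilityTheory Filter Topology Set

universe u v w w'

noncomputable section

namespace PDSmoothing

/-! ### Extended-valued functions, distance generating functions -/

section Convex

variable {E : Type*} [NormedAddCommGroup E] [NormedSpace ℝ E]

/-- Effective domain of an extended real valued function. -/
def effDom (φ : E → EReal) : Set E := {x | φ x ≠ ⊤}

/-- The real-valued version of an extended real valued function (meaningful on its domain). -/
def re (φ : E → EReal) (x : E) : ℝ := (φ x).toReal

/-- Closed, convex and proper functions with values in `ℝ ∪ {+∞}`. -/
structure IsCCP (φ : E → EReal) : Prop where
  ne_bot : ∀ x, φ x ≠ ⊥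
  proper : (effDom φ).Nonempty
  closed : LowerSemicontinuous φ
  convex : Convex ℝ {p : E × ℝ | φ p.1 ≤ (p.2 : EReal)}

/-- `ω : E → ℝ ∪ {+∞}` is a distance generating function on `U`: it is essentially smooth, and it is
(finite,) continuous and `1`-strongly convex on `U`. -/
structure IsDGF (ω : E → EReal) (U : Set E) : Prop where
  ne_bot : ∀ x, ω x ≠ ⊥
  interior_nonempty : (interior (effDom ω)).Nonempty
  differentiableOn : DifferentiableOn ℝ (re ω) (interior (effDom ω))
  continuousOn_grad : ContinuousOn (fderiv ℝ (re ω)) (interior (effDom ω))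
  steep : ∀ u ∈ frontier (effDom ω),
    Tendsto (fun v => ‖fderiv ℝ (re ω) v‖) (𝓝[interior (effDom ω)] u) atTop
  subset_dom : U ⊆ effDom ω
  continuousOn : ContinuousOn (re ω) U
  strongConvexOn : StrongConvexOn U 1 (re ω)

/-- `U° = U ∩ int dom ω`. -/
def core (ω : E → EReal) (U : Set E) : Set E := U ∩ interior (effDom ω)

/-- The Bregman divergence `D_ω(x', x)`. -/
def bregman (ω : E → EReal) (x' x : E) : ℝ :=
  re ω x' - re ω x - fderiv ℝ (re ω) x (x' - x)

end Convex

/-! ### The problem `min_{x ∈ X} max_{y ∈ Y} Φ(x, y) - g(y) + r(x)` -/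

/-- The data of the problem that is available to an algorithm: everything except the coupling
function `Φ` and the law of its stochastic gradients. -/
structure Problem (𝕏 : Type u) (𝕐 : Type v) where
  X : Set 𝕏
  Y : Set 𝕐
  r : 𝕏 → EReal
  g : 𝕐 → EReal
  ωX : 𝕏 → EReal
  ωY : 𝕐 → EReal
  /-- weak convexity modulus of `Φ(·, y)` -/
  γ : ℝ
  /-- Lipschitz constant of `∇ωX` -/
  β : ℝ
  Lxx : ℝ
  Lxy : ℝ
  Lyx : ℝ
  Lyy : ℝ
  σx : ℝ
  σy : ℝ

variable {𝕏 : Type u} [NormedAddCommGroup 𝕏] [NormedSpace ℝ 𝕏]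
variable {𝕐 : Type v} [NormedAddCommGroup 𝕐] [NormedSpace ℝ 𝕐]

/-- Standing assumptions on the known data. -/
structure Problem.Admissible (P : Problem 𝕏 𝕐) : Prop where
  X_nonempty : P.X.Nonempty
  X_closed : IsClosed P.X
  X_convex : Convex ℝ P.X
  Y_nonempty : P.Y.Nonempty
  Y_closed : IsClosed P.Y
  Y_convex : Convex ℝ P.Y
  Y_bounded : Bornology.IsBounded P.Y
  r_ccp : IsCCP P.r
  r_finite : P.X ⊆ effDom P.r
  r_lipschitz : ∃ M, LipschitzOnWith M (re P.r) P.X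
  g_ccp : IsCCP P.g
  g_finite : P.Y ⊆ effDom P.g
  g_lipschitz : ∃ M, LipschitzOnWith M (re P.g) P.Y
  dgf_X : IsDGF P.ωX P.X
  /-- `ωX` is twice differentiable on an open set containing `X`. -/
  ωX_twice : ∃ X', IsOpen X' ∧ P.X ⊆ X' ∧ X' ⊆ effDom P.ωX ∧
    DifferentiableOn ℝ (re P.ωX) X' ∧ DifferentiableOn ℝ (fderiv ℝ (re P.ωX)) X'
  ωX_lipschitz : ∀ x ∈ P.X, ∀ x' ∈ P.X,
    ‖fderiv ℝ (re P.ωX) x - fderiv ℝ (re P.ωX) x'‖ ≤ P.β * ‖x - x'‖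
  one_le_β : 1 ≤ P.β
  dgf_Y : IsDGF P.ωY P.Y
  γ_pos : 0 < P.γ
  γ_le : P.γ ≤ P.Lxx
  Lxy_nonneg : 0 ≤ P.Lxy
  Lyx_nonneg : 0 ≤ P.Lyx
  Lyy_nonneg : 0 ≤ P.Lyy
  σx_nonneg : 0 ≤ P.σx
  σy_nonneg : 0 ≤ P.σy

/-- `∇_x Φ(x, y)`. -/
def gradX (Φ : 𝕏 → 𝕐 → ℝ) (x : 𝕏) (y : 𝕐) : StrongDual ℝ 𝕏 := fderiv ℝ (fun u => Φ u y) x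

/-- `∇_y Φ(x, y)`. -/
def gradY (Φ : 𝕏 → 𝕐 → ℝ) (x : 𝕏) (y : 𝕐) : StrongDual ℝ 𝕐 := fderiv ℝ (fun v => Φ x v) y

/-- The assumptions on the coupling function: smooth and weakly convex in `x`, jointly continuous,
concave and smooth in `y`. Only the (finite) values of `Φ` near `X × Y` matter. -/
structure Problem.Coupling (P : Problem 𝕏 𝕐) (Φ : 𝕏 → 𝕐 → ℝ) : Prop where
  diff_x : ∃ X', IsOpen X' ∧ P.X ⊆ X' ∧ ∀ y ∈ P.Y, DifferentiableOn ℝ (fun x => Φ x y) X'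
  lip_xx : ∀ x ∈ P.X, ∀ x' ∈ P.X, ∀ y ∈ P.Y,
    ‖gradX Φ x y - gradX Φ x' y‖ ≤ P.Lxx * ‖x - x'‖
  lip_xy : ∀ x ∈ P.X, ∀ y ∈ P.Y, ∀ y' ∈ P.Y,
    ‖gradX Φ x y - gradX Φ x y'‖ ≤ P.Lxy * ‖y - y'‖
  cont : ContinuousOn (fun z : 𝕏 × 𝕐 => Φ z.1 z.2) (P.X ×ˢ P.Y)
  weakly_convex : ∀ x ∈ P.X, ∀ x' ∈ P.X, ∀ y ∈ P.Y,
    -(P.γ / 2) * ‖x' - x‖ ^ 2 ≤ Φ x' y - Φ x y - gradX Φ x y (x' - x)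
  concave : ∀ x ∈ P.X, ConcaveOn ℝ P.Y (Φ x)
  diff_y : ∃ Y', IsOpen Y' ∧ P.Y ⊆ Y' ∧ ∀ x ∈ P.X, DifferentiableOn ℝ (Φ x) Y'
  lip_yx : ∀ x ∈ P.X, ∀ x' ∈ P.X, ∀ y ∈ P.Y,
    ‖gradY Φ x y - gradY Φ x' y‖ ≤ P.Lyx * ‖x - x'‖
  lip_yy : ∀ x ∈ P.X, ∀ y ∈ P.Y, ∀ y' ∈ P.Y,
    ‖gradY Φ x y - gradY Φ x y'‖ ≤ P.Lyy * ‖y - y'‖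

/-- `X° = X ∩ int dom ωX`. -/
def Problem.Xo (P : Problem 𝕏 𝕐) : Set 𝕏 := core P.ωX P.X

/-- `f(x) = max_{y ∈ Y} Φ(x, y) - g(y)`. -/
def Problem.f (P : Problem 𝕏 𝕐) (Φ : 𝕏 → 𝕐 → ℝ) (x : 𝕏) : ℝ :=
  sSup ((fun y => Φ x y - re P.g y) '' P.Y)

/-- `q = f + r`. -/
def Problem.q (P : Problem 𝕏 𝕐) (Φ : 𝕏 → 𝕐 → ℝ) (x : 𝕏) : ℝ := P.f Φ x + re P.r x

/-- `f_ρ(x) = max_{y ∈ Y} Φ(x, y) - g(y) - ρ ωY(y)`. -/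
def Problem.fSm (P : Problem 𝕏 𝕐) (Φ : 𝕏 → 𝕐 → ℝ) (ρ : ℝ) (x : 𝕏) : ℝ :=
  sSup ((fun y => Φ x y - re P.g y - ρ * re P.ωY y) '' P.Y)

/-- `q_ρ = f_ρ + r`. -/
def Problem.qSm (P : Problem 𝕏 𝕐) (Φ : 𝕏 → 𝕐 → ℝ) (ρ : ℝ) (x : 𝕏) : ℝ :=
  P.fSm Φ ρ x + re P.r x

/-- `h(x') + l⁻¹ D_{ωX}(x', x)`: this is `Q^l(x'; x)` for `h = q`, and `Q_ρ^l(x'; x)` for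
`h = q_ρ`. -/
def Problem.proxObj (P : Problem 𝕏 𝕐) (h : 𝕏 → ℝ) (l : ℝ) (x' x : 𝕏) : ℝ :=
  h x' + l⁻¹ * bregman P.ωX x' x

/-- The Bregman–Moreau envelope `inf_{x' ∈ X} h(x') + l⁻¹ D_{ωX}(x', x)`. -/
def Problem.envelope (P : Problem 𝕏 𝕐) (h : 𝕏 → ℝ) (l : ℝ) (x : 𝕏) : ℝ :=
  sInf ((fun x' => P.proxObj h l x' x) '' P.X)

/-- `p` minimizes `h(x') + l⁻¹ D_{ωX}(x', x)` over `x' ∈ X`. -/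
def Problem.IsProx (P : Problem 𝕏 𝕐) (h : 𝕏 → ℝ) (l : ℝ) (x p : 𝕏) : Prop :=
  p ∈ P.X ∧ IsMinOn (fun x' => P.proxObj h l x' x) P.X p

/-- `prox(h, x, l)`, the minimizer of `h(x') + l⁻¹ D_{ωX}(x', x)` over `x' ∈ X`. -/
def Problem.prox (P : Problem 𝕏 𝕐) (h : 𝕏 → ℝ) (x : 𝕏) (l : ℝ) : 𝕏 :=
  Classical.epsilon fun p => P.IsProx h l x p

/-- `Ω_Y(ωY) = sup_{y ∈ Y} |ωY(y)|`. -/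
def Problem.Omega (P : Problem 𝕏 𝕐) : ℝ := sSup ((fun y => |re P.ωY y|) '' P.Y)

/-- The primal smoothing parameter `λ = 1 / (2γ)`. -/
def Problem.lam (P : Problem 𝕏 𝕐) : ℝ := 1 / (2 * P.γ)

/-- The dual smoothing parameter `ρ = η / (4 Ω_Y(ωY))`. (If `Ω_Y(ωY) = 0`, then `Y` is a point at
which `ωY` vanishes, so that `f_ρ = f` for every `ρ`.) -/
def Problem.rho (P : Problem 𝕏 𝕐) (η : ℝ) : ℝ := η / (4 * P.Omega)

/-- The accuracy parameter `η = ε² λ / (24 β²)`. -/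
def Problem.eta (P : Problem 𝕏 𝕐) (ε : ℝ) : ℝ := ε ^ 2 * P.lam / (24 * P.β ^ 2)

/-- The number of iterations `K = ⌈16 β² Δ / (λ ε²)⌉`. -/
def Problem.numIter (P : Problem 𝕏 𝕐) (Δ ε : ℝ) : ℕ :=
  ⌈16 * P.β ^ 2 * Δ / (P.lam * ε ^ 2)⌉₊

/-! ### Stochastic first-order oracles and methods -/

/-- A call to an oracle: `inl (x, y)` calls the primal oracle at `(x, y)`, and `inr (x, y)` calls
the dual oracle at `(x, y)`. -/
abbrev Query (𝕏 : Type u) (𝕐 : Type v) : Type (max u v) := (𝕏 × 𝕐) ⊕ (𝕏 × 𝕐)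

/-- The point at which an oracle is called. -/
def Query.point : Query 𝕏 𝕐 → 𝕏 × 𝕐 := Sum.elim id id

/-- The answer of an oracle: a stochastic gradient in `x` (primal) or in `y` (dual). -/
abbrev Answer (𝕏 : Type u) (𝕐 : Type v) [NormedAddCommGroup 𝕏] [NormedSpace ℝ 𝕏]
    [NormedAddCommGroup 𝕐] [NormedSpace ℝ 𝕐] : Type (max u v) :=
  StrongDual ℝ 𝕏 ⊕ StrongDual ℝ 𝕐

/-- A pair of stochastic oracles. A call at `(x, y)` draws a fresh sample `s : Ξ` and
returns `primal (x, y) s` (an estimate of `∇_x Φ(x, y)`), respectively `dual (x, y) s`. -/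
structure Oracle (𝕏 : Type u) (𝕐 : Type v) [NormedAddCommGroup 𝕏] [NormedSpace ℝ 𝕏]
    [NormedAddCommGroup 𝕐] [NormedSpace ℝ 𝕐] (Ξ : Type w) where
  primal : 𝕏 × 𝕐 → Ξ → StrongDual ℝ 𝕏
  dual : 𝕏 × 𝕐 → Ξ → StrongDual ℝ 𝕐

/-- The answer to a call. -/
def Oracle.answer {Ξ : Type w} (O : Oracle 𝕏 𝕐 Ξ) : Query 𝕏 𝕐 → Ξ → Answer 𝕏 𝕐
  | Sum.inl z, s => Sum.inl (O.primal z s)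
  | Sum.inr z, s => Sum.inr (O.dual z s)

/-- The oracles are unbiased for `∇_x Φ`, `∇_y Φ` on `X × Y`, with variances at most `σx²`,
`σy²`, when samples are drawn from the law `μ`. -/
structure Oracle.Valid [MeasurableSpace 𝕏] [MeasurableSpace 𝕐] {Ξ : Type w} [MeasurableSpace Ξ]
    (O : Oracle 𝕏 𝕐 Ξ) (P : Problem 𝕏 𝕐) (Φ : 𝕏 → 𝕐 → ℝ) (μ : Measure Ξ) : Prop where
  measurable_primal : Measurable fun p : (𝕏 × 𝕐) × Ξ => O.primal p.1 p.2
  measurable_dual : Measurable fun p : (𝕏 × 𝕐) × Ξ => O.dual p.1 p.2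
  integrable_primal : ∀ x ∈ P.X, ∀ y ∈ P.Y, Integrable (O.primal (x, y)) μ
  integrable_dual : ∀ x ∈ P.X, ∀ y ∈ P.Y, Integrable (O.dual (x, y)) μ
  mean_primal : ∀ x ∈ P.X, ∀ y ∈ P.Y, ∫ s, O.primal (x, y) s ∂μ = gradX Φ x y
  mean_dual : ∀ x ∈ P.X, ∀ y ∈ P.Y, ∫ s, O.dual (x, y) s ∂μ = gradY Φ x y
  variance_primal : ∀ x ∈ P.X, ∀ y ∈ P.Y,
    Integrable (fun s => ‖O.primal (x, y) s - gradX Φ x y‖ ^ 2) μ ∧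
      ∫ s, ‖O.primal (x, y) s - gradX Φ x y‖ ^ 2 ∂μ ≤ P.σx ^ 2
  variance_dual : ∀ x ∈ P.X, ∀ y ∈ P.Y,
    Integrable (fun s => ‖O.dual (x, y) s - gradY Φ x y‖ ^ 2) μ ∧
      ∫ s, ‖O.dual (x, y) s - gradY Φ x y‖ ^ 2 ∂μ ≤ P.σy ^ 2

/-- A stochastic first-order method for one saddle-point subproblem. It starts from the current
point, makes `calls` calls to the oracles at points of `X × Y`, chosen adaptively, and outputs a
point of `X°`. The state can store everything seen so far; the method can depend on the known
data `P`, but learns about `Φ` through the answers of the oracles only. -/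
structure Method [MeasurableSpace 𝕏] [MeasurableSpace 𝕐] (P : Problem 𝕏 𝕐) where
  State : Type (max u v)
  [measState : MeasurableSpace State]
  calls : ℕ
  init : 𝕏 → State
  query : ℕ → State → Query 𝕏 𝕐
  update : ℕ → State → Answer 𝕏 𝕐 → State
  output : State → 𝕏
  measurable_init : Measurable init
  measurable_query : ∀ t, Measurable (query t)
  measurable_update : ∀ t, Measurable fun p : State × Answer 𝕏 𝕐 => update t p.1 p.2
  measurable_output : Measurable output
  query_mem : ∀ t s, (query t s).point ∈ P.X ×ˢ P.Y
  output_mem : ∀ s, output s ∈ P.Xo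

section Run

variable [MeasurableSpace 𝕏] [MeasurableSpace 𝕐] {P : Problem 𝕏 𝕐} {Ξ : Type w}

/-- The state after `t` calls, when started at `x` with samples `s 0, s 1, …`. -/
def Method.state (A : Method P) (O : Oracle 𝕏 𝕐 Ξ) (x : 𝕏) (s : ℕ → Ξ) : ℕ → A.State
  | 0 => A.init x
  | t + 1 => A.update t (A.state O x s t) (O.answer (A.query t (A.state O x s t)) (s t))

/-- The output of the method. -/
def Method.result (A : Method P) (O : Oracle 𝕏 𝕐 Ξ) (x : 𝕏) (s : ℕ → Ξ) : 𝕏 :=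
  A.output (A.state O x s A.calls)

/-- The number of primal oracle calls made. -/
def Method.primalCalls (A : Method P) (O : Oracle 𝕏 𝕐 Ξ) (x : 𝕏) (s : ℕ → Ξ) : ℕ :=
  ((Finset.range A.calls).filter fun t => (A.query t (A.state O x s t)).isLeft = true).card

/-- The number of dual oracle calls made. -/
def Method.dualCalls (A : Method P) (O : Oracle 𝕏 𝕐 Ξ) (x : 𝕏) (s : ℕ → Ξ) : ℕ :=
  ((Finset.range A.calls).filter fun t => (A.query t (A.state O x s t)).isRight = true).card

/-- The iterates of the stochastic primal dual smoothing framework, counted from zero: `x₁` is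
the starting point, and step `k` applies the method `A k` to the current iterate, with the samples
`ξ (k, 0), ξ (k, 1), …`. -/
def iterate (A : ℕ → Method P) (O : Oracle 𝕏 𝕐 Ξ) (x₁ : 𝕏) (ξ : ℕ × ℕ → Ξ) : ℕ → 𝕏
  | 0 => x₁
  | k + 1 => (A k).result O (iterate A O x₁ ξ k) fun t => ξ (k, t)

/-- Total number of primal oracle calls in the first `K` steps. -/
def totalPrimalCalls (A : ℕ → Method P) (O : Oracle 𝕏 𝕐 Ξ) (x₁ : 𝕏) (ξ : ℕ × ℕ → Ξ) (K : ℕ) : ℕ :=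
  ∑ k ∈ Finset.range K, (A k).primalCalls O (iterate A O x₁ ξ k) fun t => ξ (k, t)

/-- Total number of dual oracle calls in the first `K` steps. -/
def totalDualCalls (A : ℕ → Method P) (O : Oracle 𝕏 𝕐 Ξ) (x₁ : 𝕏) (ξ : ℕ × ℕ → Ξ) (K : ℕ) : ℕ :=
  ∑ k ∈ Finset.range K, (A k).dualCalls O (iterate A O x₁ ξ k) fun t => ξ (k, t)

/-- The inexactness criterion of step `k` of the framework with accuracy `η`:
`𝔼[Q_ρ^λ(x_{k+1}; x_k) | x_k] ≤ q_ρ^λ(x_k) + η` almost surely, with `λ = 1/(2γ)` and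
`ρ = η / (4 Ω_Y(ωY))`, for random points `xk`, `xk1`. -/
def StepCriterion {Ω : Type w'} [MeasurableSpace Ω] (P : Problem 𝕏 𝕐) (Φ : 𝕏 → 𝕐 → ℝ) (η : ℝ)
    (ν : Measure Ω) (xk xk1 : Ω → 𝕏) : Prop :=
  Measurable xk ∧ Measurable xk1 ∧
  Integrable (fun o => P.proxObj (P.qSm Φ (P.rho η)) P.lam (xk1 o) (xk o)) ν ∧
  ν[fun o => P.proxObj (P.qSm Φ (P.rho η)) P.lam (xk1 o) (xk o) |
      MeasurableSpace.comap xk inferInstance]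
    ≤ᵐ[ν] fun o => P.envelope (P.qSm Φ (P.rho η)) P.lam (xk o) + η

end Run

end PDSmoothing

end

set_option linter.unusedSectionVars false

noncomputable section

namespace PDSmoothing

/-! ### Convexity with a general modulus -/

section ModulusConvex

variable {E : Type*} [NormedAddCommGroup E] [NormedSpace ℝ E]

/-! The outer loop is an inexact proximal point method. A maximum of `γ`-weakly convex functions is
`γ`-weakly convex, and `λ⁻¹ D(·, x) = 2γ D(·, x)` is `2γ`-strongly convex, so the prox objective is
`γ`-strongly convex and grows by `γ/2 ‖u - p‖²` away from its minimizer `p` (`isProx_growth`). Dual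
smoothing changes `q` by at most `η/4` on `X`. Comparing the prox point with `x_k` itself shows that
the smoothed envelope lies below `q(x_k) - γ/2 ‖x_k - prox‖² + η/4`. With the criterion and `D ≥ 0`
this yields an expected decrease of `q` by `γ/2 E‖x_k - prox‖²`, up to `3η/2` (`sum_sq_dist_le`).
Telescoping over `K` steps and averaging over the uniform index, the mean squared displacement is at
most half of `(ελ/β)²`, which gives the claim (`average_dist_le`).

Each subproblem is convex-concave and is solved by stochastic proximal descent-ascent, with a
Euclidean norm as regularizer and the dual step before the primal one. Averaging about `η⁻²` rounds
with steps proportional to `η` makes the expected primal gap `O(η)` (`gap_step`, `average_gap`,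
`expected_gap`). As `K` is of order `ε⁻²` and `η` of order `ε²`, the total is of order `ε⁻⁶`. The
dual point that realizes the gap depends on the noise, so the dual noise tested against it is not
centered. A ghost sequence that follows the noise splits this term into a centered part and a part
with a pathwise regret bound.

The constant must not depend on `Φ`, although `X` may be unbounded and the oracles give no function
values. What is known in advance is only that `x_k` and its smoothed prox point stay in balls around
`x₁` whose radii grow like `(8β)^k` (`isProx_mem_ball`). Each run therefore starts with a
contraction phase of constant step size. The subproblem is strongly convex in `x`, and an arbitrary
dual iterate costs only a bounded error because `Y` is bounded, so `m(k+1)` rounds reduce the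
exponentially large squared distance to a constant (`expected_contraction`). Over all steps these
rounds cost `O(K²)`, hence `O(ε⁻⁴)`, which is absorbed when `ε` is bounded. For larger `ε` there is
at most one step, and returning `x₁` meets the criterion (`qSm_le_envelope_add`).

On the probabilistic side, `x_k` depends on earlier blocks of samples only. The accuracy of a run
from every fixed start point thus becomes the conditional criterion by integrating out an
independent block (`stepCriterion_of_accuracy`). Minimizers depend continuously on linear
perturbations, which makes the methods measurable. -/

/-- `f` is convex on `S` with modulus `B`, a function of the difference of two points. -/
def ModulusConvexOn (S : Set E) (B : E → ℝ) (f : E → ℝ) : Prop :=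
  Convex ℝ S ∧ ∀ x ∈ S, ∀ y ∈ S, ∀ a b : ℝ, 0 ≤ a → 0 ≤ b → a + b = 1 →
    f (a • x + b • y) ≤ a * f x + b * f y - a * b * B (x - y)

namespace ModulusConvexOn

variable {S T : Set E} {B B' : E → ℝ} {f f' : E → ℝ}

theorem congr_right (h : ModulusConvexOn S B f) (hf : f = f') : ModulusConvexOn S B f' := hf ▸ h

theorem mono_set (h : ModulusConvexOn S B f) (hT : Convex ℝ T) (hTS : T ⊆ S) :
    ModulusConvexOn T B f :=
  ⟨hT, fun x hx y hy => h.2 x (hTS hx) y (hTS hy)⟩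

theorem mono (h : ModulusConvexOn S B f) (hB : ∀ d, B' d ≤ B d) : ModulusConvexOn S B' f := by
  refine ⟨h.1, fun x hx y hy a b ha hb hab => (h.2 x hx y hy a b ha hb hab).trans ?_⟩
  have := mul_le_mul_of_nonneg_left (hB (x - y)) (mul_nonneg ha hb)
  linarith

theorem add (h : ModulusConvexOn S B f) (h' : ModulusConvexOn S B' f') :
    ModulusConvexOn S (fun d => B d + B' d) (fun x => f x + f' x) := by
  refine ⟨h.1, fun x hx y hy a b ha hb hab => ?_⟩
  have h1 := h.2 x hx y hy a b ha hb hab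
  have h2 := h'.2 x hx y hy a b ha hb hab
  dsimp only
  nlinarith

theorem const_mul (h : ModulusConvexOn S B f) {c : ℝ} (hc : 0 ≤ c) :
    ModulusConvexOn S (fun d => c * B d) (fun x => c * f x) := by
  refine ⟨h.1, fun x hx y hy a b ha hb hab => ?_⟩
  have h1 := mul_le_mul_of_nonneg_left (h.2 x hx y hy a b ha hb hab) hc
  dsimp only
  linarith

theorem add_affine (h : ModulusConvexOn S B f) (l : StrongDual ℝ E) (c : ℝ) :
    ModulusConvexOn S B (fun x => f x + (l x + c)) := by
  refine ⟨h.1, fun x hx y hy a b ha hb hab => ?_⟩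
  have h1 := h.2 x hx y hy a b ha hb hab
  simp only [map_add, map_smul, smul_eq_mul]
  have : c = a * c + b * c := by rw [← add_mul, hab, one_mul]
  linarith

theorem of_convexOn (h : ConvexOn ℝ S f) : ModulusConvexOn S (fun _ => 0) f :=
  ⟨h.1, fun x hx y hy a b ha hb hab => by
    simpa using h.2 hx hy ha hb hab⟩

theorem convexOn (h : ModulusConvexOn S B f) (hB : ∀ d, 0 ≤ B d) : ConvexOn ℝ S f :=
  ⟨h.1, fun x hx y hy a b ha hb hab => by
    have := h.2 x hx y hy a b ha hb hab
    have h2 := mul_nonneg (mul_nonneg ha hb) (hB (x - y))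
    simp only [smul_eq_mul]
    linarith⟩

theorem of_strongConvexOn {m : ℝ} (h : StrongConvexOn S m f) :
    ModulusConvexOn S (fun d => m / 2 * ‖d‖ ^ 2) f :=
  ⟨h.1, fun _ hx _ hy _ _ ha hb hab => h.2 hx hy ha hb hab⟩

/-- At a minimizer a modulus convex function grows at least like its modulus. -/
theorem add_modulus_le (h : ModulusConvexOn S B f) {p u : E} (hp : p ∈ S) (hmin : IsMinOn f S p)
    (hu : u ∈ S) : f p + B (u - p) ≤ f u := by
  -- Minimality is tested at a point of the segment from `p` to `u`; after division by `a`, the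
  -- bound follows as `a → 0`.
  have key : ∀ a : ℝ, a ∈ Ioo (0 : ℝ) 1 → (1 - a) * B (u - p) ≤ f u - f p := by
    intro a ha
    have h1 := h.2 u hu p hp a (1 - a) ha.1.le (by linarith [ha.2]) (by ring)
    have h2 : f p ≤ f (a • u + (1 - a) • p) :=
      hmin (h.1 hu hp ha.1.le (by linarith [ha.2]) (by ring))
    have h3 : a * ((1 - a) * B (u - p)) ≤ a * (f u - f p) := by nlinarith
    exact le_of_mul_le_mul_left h3 ha.1
  have hlim : Tendsto (fun a : ℝ => (1 - a) * B (u - p)) (𝓝[>] 0) (𝓝 ((1 - 0) * B (u - p))) :=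
    Tendsto.mono_left (Continuous.tendsto (by fun_prop) 0) nhdsWithin_le_nhds
  have := le_of_tendsto hlim (Filter.eventually_of_mem (Ioo_mem_nhdsGT one_pos) key)
  linarith

/-- First order lower bound of a modulus convex function. -/
theorem add_fderiv_le (h : ModulusConvexOn S B f) {p u : E} (hp : p ∈ S) (hu : u ∈ S)
    {l : StrongDual ℝ E} (hl : HasFDerivAt f l p) : f p + l (u - p) + B (u - p) ≤ f u := by
  have key : ∀ a : ℝ, a ∈ Ioo (0 : ℝ) 1 →
      a⁻¹ • (f (p + a • (u - p)) - f p) + (1 - a) * B (u - p) ≤ f u - f p := by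
    intro a ha
    have h1 := h.2 u hu p hp a (1 - a) ha.1.le (by linarith [ha.2]) (by ring)
    have h2 : a • u + (1 - a) • p = p + a • (u - p) := by module
    rw [h2] at h1
    have h3 : f (p + a • (u - p)) - f p ≤ a * (f u - f p - (1 - a) * B (u - p)) := by linarith
    have h4 : a⁻¹ * (f (p + a • (u - p)) - f p) ≤ f u - f p - (1 - a) * B (u - p) := by
      rw [inv_mul_le_iff₀ ha.1]; exact h3
    rw [smul_eq_mul]; linarith
  have hd := (hl.hasLineDerivAt (u - p)).tendsto_slope_zero_right
  have hlim : Tendsto (fun a : ℝ => (1 - a) * B (u - p)) (𝓝[>] 0) (𝓝 ((1 - 0) * B (u - p))) :=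
    Tendsto.mono_left (Continuous.tendsto (by fun_prop) 0) nhdsWithin_le_nhds
  have := le_of_tendsto (hd.add hlim) (Filter.eventually_of_mem (Ioo_mem_nhdsGT one_pos) key)
  linarith

/-- A function with a quadratic first order lower bound is (weakly) convex. -/
theorem of_first_order {c : ℝ} (hS : Convex ℝ S) (l : E → StrongDual ℝ E)
    (h : ∀ x ∈ S, ∀ y ∈ S, c * ‖y - x‖ ^ 2 ≤ f y - f x - l x (y - x)) :
    ModulusConvexOn S (fun d => c * ‖d‖ ^ 2) f := by
  refine ⟨hS, fun x hx y hy a b ha hb hab => ?_⟩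
  obtain rfl : b = 1 - a := by linarith
  have hz := hS hx hy ha hb hab
  have h1 := mul_le_mul_of_nonneg_left (h _ hz x hx) ha
  have h2 := mul_le_mul_of_nonneg_left (h _ hz y hy) hb
  have e1 : x - (a • x + (1 - a) • y) = (1 - a) • (x - y) := by module
  have e2 : y - (a • x + (1 - a) • y) = (-a) • (x - y) := by module
  rw [e1, norm_smul, map_smul, Real.norm_eq_abs, mul_pow, sq_abs, smul_eq_mul] at h1
  rw [e2, norm_smul, map_smul, Real.norm_eq_abs, mul_pow, sq_abs, smul_eq_mul] at h2
  nlinarith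

theorem sSup_image {F : Type*} {Y : Set F} (hY : Y.Nonempty) {φ : E → F → ℝ} (hS : Convex ℝ S)
    (hφ : ∀ y ∈ Y, ModulusConvexOn S B (fun x => φ x y)) (hbdd : ∀ x ∈ S, BddAbove (φ x '' Y)) :
    ModulusConvexOn S B (fun x => sSup (φ x '' Y)) := by
  refine ⟨hS, fun x hx y hy a b ha hb hab => csSup_le (hY.image _) ?_⟩
  rintro _ ⟨v, hv, rfl⟩
  have h1 := (hφ v hv).2 x hx y hy a b ha hb hab
  have h2 := mul_le_mul_of_nonneg_left (le_csSup (hbdd x hx) (mem_image_of_mem (φ x) hv)) ha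
  have h3 := mul_le_mul_of_nonneg_left (le_csSup (hbdd y hy) (mem_image_of_mem (φ y) hv)) hb
  dsimp only at h1
  linarith

/-- For an inner product norm the convexity inequality is an identity. A general norm has no such
modulus, hence the auxiliary Euclidean structure in all proximal steps. -/
theorem half_sq_norm {H : Type*} [NormedAddCommGroup H] [InnerProductSpace ℝ H] (e : E →L[ℝ] H)
    (hS : Convex ℝ S) :
    ModulusConvexOn S (fun d => 1 / 2 * ‖e d‖ ^ 2) (fun x => 1 / 2 * ‖e x‖ ^ 2) := by
  refine ⟨hS, fun x hx y hy a b ha hb hab => le_of_eq ?_⟩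
  simp only [map_add, map_sub, map_smul]
  rw [norm_add_sq_real, norm_sub_sq_real, norm_smul, norm_smul, inner_smul_left, inner_smul_right,
    mul_pow, mul_pow, Real.norm_eq_abs, Real.norm_eq_abs, sq_abs, sq_abs]
  obtain rfl : b = 1 - a := by linarith
  simp only [RCLike.conj_to_real]
  ring

/-- The minimizer of a strongly convex function on a compact convex set depends continuously on
linear perturbations. -/
theorem exists_continuous_argmin (h : ModulusConvexOn S B f) (hS : IsCompact S) (hne : S.Nonempty)
    (hf : ContinuousOn f S) (hB : ∀ d, 1 / 2 * ‖d‖ ^ 2 ≤ B d) :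
    ∃ p : StrongDual ℝ E → E, Continuous p ∧ ∀ l, p l ∈ S ∧
      ∀ u ∈ S, f (p l) + l (p l) + B (u - p l) ≤ f u + l u := by
  have hex : ∀ l : StrongDual ℝ E, ∃ p ∈ S, ∀ u ∈ S, f p + l p + B (u - p) ≤ f u + l u := by
    intro l
    obtain ⟨p, hp, hmin⟩ := hS.exists_isMinOn hne (hf.add l.continuous.continuousOn)
    refine ⟨p, hp, fun u hu => ?_⟩
    have := (h.add_affine l 0).add_modulus_le (p := p) (u := u) hp
      (fun v hv => by simpa using hmin hv) hu
    simpa using this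
  choose p hpS hp using hex
  refine ⟨p, ?_, fun l => ⟨hpS l, hp l⟩⟩
  -- The growth inequalities of two perturbed problems, each tested at the other minimizer, add up
  -- to `‖p l - p l'‖² ≤ (l - l')(p l' - p l)`.
  have hlip : LipschitzWith 1 p := by
    refine LipschitzWith.of_dist_le_mul fun l l' => ?_
    rw [NNReal.coe_one, one_mul, dist_eq_norm, dist_eq_norm]
    have h1 := hp l _ (hpS l')
    have h2 := hp l' _ (hpS l)
    have h3 := hB (p l' - p l)
    have h4 := hB (p l - p l')
    rw [norm_sub_rev] at h3
    have h5 : (l - l') (p l' - p l) ≤ ‖l - l'‖ * ‖p l - p l'‖ := by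
      rw [norm_sub_rev (p l)]
      exact (le_abs_self _).trans ((l - l').le_opNorm _)
    have h6 : (l - l') (p l' - p l) = l (p l') - l (p l) - l' (p l') + l' (p l) := by
      simp only [sub_apply, map_sub]; ring
    have h7 : ‖p l - p l'‖ * ‖p l - p l'‖ ≤ ‖l - l'‖ * ‖p l - p l'‖ := by nlinarith
    rcases (norm_nonneg (p l - p l')).eq_or_lt with h0 | h0
    · rw [← h0]; exact norm_nonneg _
    · exact le_of_mul_le_mul_right h7 h0
  exact hlip.continuous

end ModulusConvexOn

/-- A mean value estimate on a convex set inside an open set of differentiability. -/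
theorem abs_sub_fderiv_le {S U : Set E} {f : E → ℝ} (hU : IsOpen U) (hSU : S ⊆ U)
    (hf : DifferentiableOn ℝ f U) (hS : Convex ℝ S) {L : ℝ} {p u : E} (hp : p ∈ S) (hu : u ∈ S)
    (hL : ∀ x ∈ S, ‖fderiv ℝ f x - fderiv ℝ f p‖ ≤ L * ‖x - p‖) (hL0 : 0 ≤ L) :
    |f u - f p - fderiv ℝ f p (u - p)| ≤ L * ‖u - p‖ ^ 2 := by
  have hseg : segment ℝ p u ⊆ S := hS.segment_subset hp hu
  have h := Convex.norm_image_sub_le_of_norm_hasFDerivWithin_le' (f := f) (f' := fderiv ℝ f)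
    (s := segment ℝ p u) (C := L * ‖u - p‖) (φ := fderiv ℝ f p) (x := p) (y := u)
    (fun x hx => ((hf.differentiableAt (hU.mem_nhds (hSU (hseg hx)))).hasFDerivAt).hasFDerivWithinAt)
    (fun x hx => (hL x (hseg hx)).trans (mul_le_mul_of_nonneg_left
      (norm_sub_le_of_mem_segment hx) hL0)) (convex_segment _ _)
    (left_mem_segment _ _ _) (right_mem_segment _ _ _)
  rw [Real.norm_eq_abs] at h
  linarith [sq ‖u - p‖]

/-- A Euclidean structure whose norm dominates the given norm. -/
theorem exists_euclidean [FiniteDimensional ℝ E] :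
    ∃ (e : E →L[ℝ] EuclideanSpace ℝ (Fin (Module.finrank ℝ E))) (κ : ℝ),
      0 < κ ∧ (∀ d, ‖d‖ ≤ ‖e d‖) ∧ ∀ d, ‖e d‖ ≤ κ * ‖d‖ := by
  set T : E ≃L[ℝ] EuclideanSpace ℝ (Fin (Module.finrank ℝ E)) := toEuclidean
  -- Scaling by more than `‖T⁻¹‖` makes the Euclidean norm dominate the given one.
  set c : ℝ := ‖(T.symm : EuclideanSpace ℝ (Fin (Module.finrank ℝ E)) →L[ℝ] E)‖ + 1
  have hc : 0 < c := by positivity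
  refine ⟨c • (T : E →L[ℝ] EuclideanSpace ℝ (Fin (Module.finrank ℝ E))), c * ‖(T : E →L[ℝ] EuclideanSpace ℝ (Fin (Module.finrank ℝ E)))‖ + 1,
    by positivity, fun d => ?_, fun d => ?_⟩
  · have h1 := (T.symm : EuclideanSpace ℝ (Fin (Module.finrank ℝ E)) →L[ℝ] E).le_opNorm (T d)
    simp only [ContinuousLinearEquiv.coe_coe, ContinuousLinearEquiv.symm_apply_apply] at h1
    have h2 : ‖(c • (T : E →L[ℝ] EuclideanSpace ℝ (Fin (Module.finrank ℝ E)))) d‖ = c * ‖T d‖ := by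
      rw [smul_apply, norm_smul, Real.norm_of_nonneg hc.le]; rfl
    rw [h2]
    refine h1.trans (mul_le_mul_of_nonneg_right ?_ (norm_nonneg _))
    simp [c]
  · have h1 := (T : E →L[ℝ] EuclideanSpace ℝ (Fin (Module.finrank ℝ E))).le_opNorm d
    rw [smul_apply, norm_smul, Real.norm_of_nonneg hc.le]
    nlinarith [norm_nonneg d, mul_le_mul_of_nonneg_left h1 hc.le]

theorem exists_bound_norm_sub {E : Type*} [SeminormedAddCommGroup E] {S : Set E} (hS : Bornology.IsBounded S) :
    ∃ D : ℝ, 0 ≤ D ∧ ∀ x ∈ S, ∀ y ∈ S, ‖x - y‖ ≤ D :=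
  ⟨Metric.diam S, Metric.diam_nonneg, fun x hx y hy => by
    rw [← dist_eq_norm]; exact Metric.dist_le_diam_of_mem hS hx hy⟩

end ModulusConvex

/-! ### The smoothed objective and its proximal points -/

theorem IsCCP.convexOn_re {E : Type*} [NormedAddCommGroup E] [NormedSpace ℝ E] {φ : E → EReal}
    (h : IsCCP φ) {S : Set E} (hS : Convex ℝ S) (hdom : S ⊆ effDom φ) : ConvexOn ℝ S (re φ) := by
  have hcoe : ∀ x ∈ S, ((re φ x : ℝ) : EReal) = φ x := fun x hx =>
    EReal.coe_toReal (hdom hx) (h.ne_bot x)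
  refine ⟨hS, fun x hx y hy a b ha hb hab => ?_⟩
  have hz := hS hx hy ha hb hab
  have h1 := h.convex (x := (x, re φ x)) (hcoe x hx).ge (y := (y, re φ y)) (hcoe y hy).ge ha hb hab
  have h2 : φ (a • x + b • y) ≤ ((a • re φ x + b • re φ y : ℝ) : EReal) := h1
  rw [← hcoe _ hz] at h2
  exact_mod_cast h2

section Problem

variable {𝕏 : Type u} {𝕐 : Type v}
variable {P : Problem 𝕏 𝕐} {Φ : 𝕏 → 𝕐 → ℝ} {θ : 𝕐 → ℝ}

/-- `max_{y ∈ Y} Φ(x, y) - θ(y)`. -/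
def Problem.maxVal (P : Problem 𝕏 𝕐) (Φ : 𝕏 → 𝕐 → ℝ) (θ : 𝕐 → ℝ) (x : 𝕏) : ℝ :=
  sSup ((fun y => Φ x y - θ y) '' P.Y)

/-- The primal objective with dual penalty `θ`. -/
def Problem.obj (P : Problem 𝕏 𝕐) (Φ : 𝕏 → 𝕐 → ℝ) (θ : 𝕐 → ℝ) (x : 𝕏) : ℝ :=
  P.maxVal Φ θ x + re P.r x

/-- The dual penalty `g + ρ ωY`. -/
def Problem.penalty (P : Problem 𝕏 𝕐) (ρ : ℝ) (y : 𝕐) : ℝ := re P.g y + ρ * re P.ωY y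

theorem Problem.q_eq_obj : P.q Φ = P.obj Φ (re P.g) := rfl

theorem Problem.qSm_eq_obj (ρ : ℝ) : P.qSm Φ ρ = P.obj Φ (P.penalty ρ) := by
  funext x
  simp only [Problem.qSm, Problem.fSm, Problem.obj, Problem.maxVal, Problem.penalty, sub_sub]

theorem Problem.inv_lam (P : Problem 𝕏 𝕐) : P.lam⁻¹ = 2 * P.γ := by
  simp [Problem.lam]

variable [NormedAddCommGroup 𝕏] [NormedSpace ℝ 𝕏] [NormedAddCommGroup 𝕐] [NormedSpace ℝ 𝕐]

namespace Problem.Admissible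

theorem lam_pos (hP : P.Admissible) : 0 < P.lam := by
  have := hP.γ_pos
  unfold Problem.lam; positivity

theorem β_pos (hP : P.Admissible) : 0 < P.β := zero_lt_one.trans_le hP.one_le_β

/-- The open set on which `ωX` is twice differentiable lies in its domain. Hence `X° = X`, and
points of `X` never meet the boundary of `dom ωX`. -/
theorem X_subset_interior (hP : P.Admissible) : P.X ⊆ interior (effDom P.ωX) := by
  obtain ⟨X', ho, hX, hd, -⟩ := hP.ωX_twice
  exact hX.trans (interior_maximal hd ho)

theorem Xo_eq (hP : P.Admissible) : P.Xo = P.X :=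
  inter_eq_left.2 hP.X_subset_interior

theorem hasFDerivAt_ωX (hP : P.Admissible) {x : 𝕏} (hx : x ∈ P.X) :
    HasFDerivAt (re P.ωX) (fderiv ℝ (re P.ωX) x) x :=
  (hP.dgf_X.differentiableOn.differentiableAt
    (isOpen_interior.mem_nhds (hP.X_subset_interior hx))).hasFDerivAt

theorem le_bregman (hP : P.Admissible) {x x' : 𝕏} (hx : x ∈ P.X) (hx' : x' ∈ P.X) :
    1 / 2 * ‖x' - x‖ ^ 2 ≤ bregman P.ωX x' x := by
  have := (ModulusConvexOn.of_strongConvexOn hP.dgf_X.strongConvexOn).add_fderiv_le hx hx'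
    (hP.hasFDerivAt_ωX hx)
  unfold bregman
  linarith

theorem bregman_le (hP : P.Admissible) {x x' : 𝕏} (hx : x ∈ P.X) (hx' : x' ∈ P.X) :
    bregman P.ωX x' x ≤ P.β * ‖x' - x‖ ^ 2 :=
  (le_abs_self _).trans (abs_sub_fderiv_le isOpen_interior hP.X_subset_interior
    hP.dgf_X.differentiableOn hP.X_convex hx hx' (fun z hz => hP.ωX_lipschitz z hz x hx)
    hP.β_pos.le)

theorem continuousOn_fderiv_ωX (hP : P.Admissible) : ContinuousOn (fderiv ℝ (re P.ωX)) P.X :=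
  hP.dgf_X.continuousOn_grad.mono hP.X_subset_interior

theorem continuousOn_bregman (hP : P.Admissible) :
    ContinuousOn (fun z : 𝕏 × 𝕏 => bregman P.ωX z.1 z.2) (P.X ×ˢ P.X) := by
  have h1 : ContinuousOn (fun z : 𝕏 × 𝕏 => re P.ωX z.1) (P.X ×ˢ P.X) :=
    hP.dgf_X.continuousOn.comp continuousOn_fst fun z hz => hz.1
  have h2 : ContinuousOn (fun z : 𝕏 × 𝕏 => re P.ωX z.2) (P.X ×ˢ P.X) :=
    hP.dgf_X.continuousOn.comp continuousOn_snd fun z hz => hz.2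
  have h3 : ContinuousOn (fun z : 𝕏 × 𝕏 => fderiv ℝ (re P.ωX) z.2) (P.X ×ˢ P.X) :=
    hP.continuousOn_fderiv_ωX.comp continuousOn_snd fun z hz => hz.2
  exact (h1.sub h2).sub (h3.clm_apply (continuousOn_fst.sub continuousOn_snd))

theorem convexOn_r (hP : P.Admissible) : ConvexOn ℝ P.X (re P.r) :=
  hP.r_ccp.convexOn_re hP.X_convex hP.r_finite

theorem continuousOn_r (hP : P.Admissible) : ContinuousOn (re P.r) P.X := by
  obtain ⟨M, hM⟩ := hP.r_lipschitz
  exact hM.continuousOn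

theorem convexOn_g (hP : P.Admissible) : ConvexOn ℝ P.Y (re P.g) :=
  hP.g_ccp.convexOn_re hP.Y_convex hP.g_finite

theorem continuousOn_g (hP : P.Admissible) : ContinuousOn (re P.g) P.Y := by
  obtain ⟨M, hM⟩ := hP.g_lipschitz
  exact hM.continuousOn

theorem convexOn_penalty (hP : P.Admissible) {ρ : ℝ} (hρ : 0 ≤ ρ) :
    ConvexOn ℝ P.Y (P.penalty ρ) := by
  have h := (ModulusConvexOn.of_convexOn hP.convexOn_g).add
    ((ModulusConvexOn.of_strongConvexOn hP.dgf_Y.strongConvexOn).const_mul hρ)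
  exact h.convexOn fun d => by positivity

theorem continuousOn_penalty (hP : P.Admissible) (ρ : ℝ) : ContinuousOn (P.penalty ρ) P.Y :=
  hP.continuousOn_g.add (continuousOn_const.mul hP.dgf_Y.continuousOn)

theorem isCompact_Y [FiniteDimensional ℝ 𝕐] (hP : P.Admissible) : IsCompact P.Y :=
  Metric.isCompact_of_isClosed_isBounded hP.Y_closed hP.Y_bounded

theorem abs_ωY_le [FiniteDimensional ℝ 𝕐] (hP : P.Admissible) {y : 𝕐} (hy : y ∈ P.Y) :
    |re P.ωY y| ≤ P.Omega :=
  le_csSup (hP.isCompact_Y.bddAbove_image hP.dgf_Y.continuousOn.abs) (mem_image_of_mem _ hy)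

theorem Omega_nonneg [FiniteDimensional ℝ 𝕐] (hP : P.Admissible) : 0 ≤ P.Omega := by
  obtain ⟨y, hy⟩ := hP.Y_nonempty
  exact (abs_nonneg _).trans (hP.abs_ωY_le hy)

theorem rho_nonneg [FiniteDimensional ℝ 𝕐] (hP : P.Admissible) {η : ℝ} (hη : 0 ≤ η) :
    0 ≤ P.rho η :=
  div_nonneg hη (by linarith [hP.Omega_nonneg])

theorem rho_mul_abs_le [FiniteDimensional ℝ 𝕐] (hP : P.Admissible) {η : ℝ} (hη : 0 ≤ η) {y : 𝕐}
    (hy : y ∈ P.Y) : |P.rho η * re P.ωY y| ≤ η / 4 := by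
  rw [abs_mul, abs_of_nonneg (hP.rho_nonneg hη)]
  refine (mul_le_mul_of_nonneg_left (hP.abs_ωY_le hy) (hP.rho_nonneg hη)).trans ?_
  unfold Problem.rho
  rcases hP.Omega_nonneg.eq_or_lt with h | h
  -- If `Ω_Y = 0`, division by zero sets `ρ = 0`, and the bound is trivial.
  · rw [← h]; simp; linarith
  · exact le_of_eq (by field_simp)

end Problem.Admissible

/-! ### Regularity of the coupling, and existence, uniqueness and growth at proximal points -/

namespace Problem.Coupling

theorem Lxx_nonneg (hP : P.Admissible) : 0 ≤ P.Lxx := hP.γ_pos.le.trans hP.γ_le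

theorem weaklyConvex (hP : P.Admissible) (hΦ : P.Coupling Φ) {y : 𝕐} (hy : y ∈ P.Y) :
    ModulusConvexOn P.X (fun d => -(P.γ / 2) * ‖d‖ ^ 2) (fun x => Φ x y) :=
  ModulusConvexOn.of_first_order hP.X_convex (fun x => gradX Φ x y) fun x hx x' hx' =>
    hΦ.weakly_convex x hx x' hx' y hy

theorem abs_sub_gradX_le (hP : P.Admissible) (hΦ : P.Coupling Φ) {x x' : 𝕏} {y : 𝕐}
    (hx : x ∈ P.X) (hx' : x' ∈ P.X) (hy : y ∈ P.Y) :
    |Φ x' y - Φ x y - gradX Φ x y (x' - x)| ≤ P.Lxx * ‖x' - x‖ ^ 2 := by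
  obtain ⟨X', ho, hX, hd⟩ := hΦ.diff_x
  exact abs_sub_fderiv_le ho hX (hd y hy) hP.X_convex hx hx'
    (fun z hz => hΦ.lip_xx z hz x hx y hy) (Lxx_nonneg hP)

theorem abs_sub_gradY_le (hP : P.Admissible) (hΦ : P.Coupling Φ) {x : 𝕏} {y y' : 𝕐}
    (hx : x ∈ P.X) (hy : y ∈ P.Y) (hy' : y' ∈ P.Y) :
    |Φ x y' - Φ x y - gradY Φ x y (y' - y)| ≤ P.Lyy * ‖y' - y‖ ^ 2 := by
  obtain ⟨Y', ho, hY, hd⟩ := hΦ.diff_y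
  exact abs_sub_fderiv_le ho hY (hd x hx) hP.Y_convex hy hy'
    (fun z hz => hΦ.lip_yy x hx z hz y hy) hP.Lyy_nonneg

theorem le_add_gradY (hΦ : P.Coupling Φ) {x : 𝕏} {y y' : 𝕐}
    (hx : x ∈ P.X) (hy : y ∈ P.Y) (hy' : y' ∈ P.Y) :
    Φ x y' ≤ Φ x y + gradY Φ x y (y' - y) := by
  obtain ⟨Y', ho, hY, hd⟩ := hΦ.diff_y
  have h := (ModulusConvexOn.of_convexOn (hΦ.concave x hx).neg).add_fderiv_le hy hy'
    ((hd x hx).differentiableAt (ho.mem_nhds (hY hy))).hasFDerivAt.neg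
  simp only [Pi.neg_apply, neg_apply, add_zero] at h
  have : gradY Φ x y (y' - y) = fderiv ℝ (Φ x) y (y' - y) := rfl
  linarith

/-- The gradient in `x` of `Φ(·, v) - Φ(·, y)` is bounded by `Lxy ‖v - y‖` on `X`, and the mean
value inequality applies. This lets a dual point be exchanged at a price proportional to the primal
movement. -/
theorem cross_le (hP : P.Admissible) (hΦ : P.Coupling Φ) {x u : 𝕏} {y v : 𝕐}
    (hx : x ∈ P.X) (hu : u ∈ P.X) (hy : y ∈ P.Y) (hv : v ∈ P.Y) :
    (Φ u v - Φ u y) - (Φ x v - Φ x y) ≤ P.Lxy * ‖v - y‖ * ‖u - x‖ := by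
  obtain ⟨X', ho, hX, hd⟩ := hΦ.diff_x
  have hdiff : ∀ z ∈ P.X, ∀ w ∈ P.Y, HasFDerivAt (fun x => Φ x w) (gradX Φ z w) z :=
    fun z hz w hw => ((hd w hw).differentiableAt (ho.mem_nhds (hX hz))).hasFDerivAt
  have h := hP.X_convex.norm_image_sub_le_of_norm_hasFDerivWithin_le (𝕜 := ℝ)
    (f := fun z => Φ z v - Φ z y) (f' := fun z => gradX Φ z v - gradX Φ z y)
    (C := P.Lxy * ‖v - y‖)
    (fun z hz => ((hdiff z hz v hv).sub (hdiff z hz y hy)).hasFDerivWithinAt)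
    (fun z hz => hΦ.lip_xy z hz v hv y hy) hx hu
  exact (le_abs_self _).trans h

theorem continuousOn_sub (hΦ : P.Coupling Φ) (hθ : ContinuousOn θ P.Y) {x : 𝕏} (hx : x ∈ P.X) :
    ContinuousOn (fun y => Φ x y - θ y) P.Y :=
  (hΦ.cont.comp (f := fun y => (x, y)) (by fun_prop) fun _ hy => ⟨hx, hy⟩).sub hθ

theorem maxVal_le (hP : P.Admissible) {x : 𝕏} {c : ℝ} (h : ∀ y ∈ P.Y, Φ x y - θ y ≤ c) :
    P.maxVal Φ θ x ≤ c := by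
  refine csSup_le (hP.Y_nonempty.image _) ?_
  rintro _ ⟨y, hy, rfl⟩
  exact h y hy

/-- The composite part of the subproblem is strongly convex. -/
theorem modulusConvexOn_composite (hP : P.Admissible) (x : 𝕏) :
    ModulusConvexOn P.X (fun d => P.γ * ‖d‖ ^ 2)
      (fun u => re P.r u + 2 * P.γ * bregman P.ωX u x) := by
  have h1 := ((ModulusConvexOn.of_strongConvexOn hP.dgf_X.strongConvexOn).add_affine
    (-fderiv ℝ (re P.ωX) x) (fderiv ℝ (re P.ωX) x x - re P.ωX x)).const_mul
    (by linarith [hP.γ_pos] : 0 ≤ 2 * P.γ)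
  have h2 := (ModulusConvexOn.of_convexOn hP.convexOn_r).add h1
  refine (h2.mono (B' := fun d => P.γ * ‖d‖ ^ 2) fun d => le_of_eq (by ring)).congr_right ?_
  funext u
  simp only [bregman, map_sub, neg_apply]
  ring

variable [FiniteDimensional ℝ 𝕐]

theorem bddAbove (hP : P.Admissible) (hΦ : P.Coupling Φ) (hθ : ContinuousOn θ P.Y) {x : 𝕏}
    (hx : x ∈ P.X) : BddAbove ((fun y => Φ x y - θ y) '' P.Y) :=
  hP.isCompact_Y.bddAbove_image (hΦ.continuousOn_sub hθ hx)

theorem le_maxVal (hP : P.Admissible) (hΦ : P.Coupling Φ) (hθ : ContinuousOn θ P.Y) {x : 𝕏}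
    {y : 𝕐} (hx : x ∈ P.X) (hy : y ∈ P.Y) : Φ x y - θ y ≤ P.maxVal Φ θ x :=
  le_csSup (bddAbove hP hΦ hθ hx) (mem_image_of_mem (fun y => Φ x y - θ y) hy)

/-- The gradients `∇_x Φ(x, y)` are bounded uniformly in `y`, since they are Lipschitz in `y` on the
bounded set `Y`. So `Φ(·, y)` varies near `x` with a modulus independent of `y`, which the maximum
inherits. -/
theorem continuousOn_maxVal (hP : P.Admissible) (hΦ : P.Coupling Φ) (hθ : ContinuousOn θ P.Y) :
    ContinuousOn (P.maxVal Φ θ) P.X := by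
  intro x hx
  obtain ⟨y₀, hy₀⟩ := hP.Y_nonempty
  obtain ⟨D, hD0, hD⟩ := exists_bound_norm_sub hP.Y_bounded
  set G := ‖gradX Φ x y₀‖ + P.Lxy * D
  have hG : ∀ y ∈ P.Y, ‖gradX Φ x y‖ ≤ G := fun y hy => by
    have h1 := norm_le_norm_add_norm_sub (gradX Φ x y₀) (gradX Φ x y)
    have h2 := hΦ.lip_xy x hx y₀ hy₀ y hy
    have h3 := mul_le_mul_of_nonneg_left (hD y₀ hy₀ y hy) hP.Lxy_nonneg
    linarith
  have hb : ∀ x' ∈ P.X, ∀ y ∈ P.Y, |Φ x' y - Φ x y| ≤ G * ‖x' - x‖ + P.Lxx * ‖x' - x‖ ^ 2 := by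
    intro x' hx' y hy
    have h1 := abs_sub_gradX_le hP hΦ hx hx' hy
    have h2 := (gradX Φ x y).le_opNorm (x' - x)
    have h3 := mul_le_mul_of_nonneg_right (hG y hy) (norm_nonneg (x' - x))
    rw [Real.norm_eq_abs] at h2
    have h4 := abs_add_le (Φ x' y - Φ x y - gradX Φ x y (x' - x)) (gradX Φ x y (x' - x))
    rw [sub_add_cancel] at h4
    linarith
  have hF : ∀ x' ∈ P.X, |P.maxVal Φ θ x' - P.maxVal Φ θ x| ≤
      G * ‖x' - x‖ + P.Lxx * ‖x' - x‖ ^ 2 := by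
    intro x' hx'
    rw [abs_sub_le_iff]
    constructor
    · rw [sub_le_iff_le_add]
      refine maxVal_le hP fun y hy => ?_
      have h1 := le_maxVal hP hΦ hθ hx hy
      have h2 := le_of_abs_le (hb x' hx' y hy)
      linarith
    · rw [sub_le_iff_le_add]
      refine maxVal_le hP fun y hy => ?_
      have h1 := le_maxVal hP hΦ hθ hx' hy
      have h2 := neg_le_of_abs_le (hb x' hx' y hy)
      linarith
  rw [ContinuousWithinAt, tendsto_iff_norm_sub_tendsto_zero]
  have hlim : Tendsto (fun x' => G * ‖x' - x‖ + P.Lxx * ‖x' - x‖ ^ 2) (𝓝[P.X] x) (𝓝 0) := by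
    have : Continuous (fun x' => G * ‖x' - x‖ + P.Lxx * ‖x' - x‖ ^ 2) := by fun_prop
    have h := (this.tendsto x).mono_left (nhdsWithin_le_nhds (s := P.X))
    simpa using h
  exact squeeze_zero' (Eventually.of_forall fun _ => norm_nonneg _)
    (eventually_nhdsWithin_of_forall hF) hlim

theorem continuousOn_obj (hP : P.Admissible) (hΦ : P.Coupling Φ) (hθ : ContinuousOn θ P.Y) :
    ContinuousOn (P.obj Φ θ) P.X :=
  (continuousOn_maxVal hP hΦ hθ).add hP.continuousOn_r

theorem continuousOn_proxObj (hP : P.Admissible) (hΦ : P.Coupling Φ) (hθ : ContinuousOn θ P.Y) :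
    ContinuousOn (fun z : 𝕏 × 𝕏 => P.proxObj (P.obj Φ θ) P.lam z.1 z.2) (P.X ×ˢ P.X) :=
  ((continuousOn_obj hP hΦ hθ).comp continuousOn_fst fun _ hz => hz.1).add
    (continuousOn_const.mul hP.continuousOn_bregman)

/-- The moduli add up to `-γ/2 + γ = γ/2`: the choice `λ = 1/(2γ)` pays for the weak convexity and
leaves as much again. -/
theorem modulusConvexOn_proxObj (hP : P.Admissible) (hΦ : P.Coupling Φ) (hθ : ContinuousOn θ P.Y)
    (x : 𝕏) :
    ModulusConvexOn P.X (fun d => P.γ / 2 * ‖d‖ ^ 2)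
      (fun u => P.proxObj (P.obj Φ θ) P.lam u x) := by
  have h1 : ModulusConvexOn P.X (fun d => -(P.γ / 2) * ‖d‖ ^ 2) (P.maxVal Φ θ) := by
    refine ModulusConvexOn.sSup_image (φ := fun x y => Φ x y - θ y) hP.Y_nonempty hP.X_convex
      (fun y hy => ?_) fun x hx => bddAbove hP hΦ hθ hx
    have := (weaklyConvex hP hΦ hy).add_affine 0 (-θ y)
    simpa [sub_eq_add_neg] using this
  refine ((h1.add (modulusConvexOn_composite hP x)).mono
    (B' := fun d => P.γ / 2 * ‖d‖ ^ 2) fun d => le_of_eq (by ring)).congr_right ?_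
  funext u
  simp only [Problem.proxObj, Problem.obj, P.inv_lam]
  ring

theorem isProx_growth (hP : P.Admissible) (hΦ : P.Coupling Φ) (hθ : ContinuousOn θ P.Y)
    {x p u : 𝕏} (hp : P.IsProx (P.obj Φ θ) P.lam x p) (hu : u ∈ P.X) :
    P.proxObj (P.obj Φ θ) P.lam p x + P.γ / 2 * ‖u - p‖ ^ 2 ≤ P.proxObj (P.obj Φ θ) P.lam u x :=
  (modulusConvexOn_proxObj hP hΦ hθ x).add_modulus_le hp.1 hp.2 hu

theorem isProx_unique (hP : P.Admissible) (hΦ : P.Coupling Φ) (hθ : ContinuousOn θ P.Y)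
    {x p p' : 𝕏} (hp : P.IsProx (P.obj Φ θ) P.lam x p) (hp' : P.IsProx (P.obj Φ θ) P.lam x p') :
    p' = p := by
  have h1 := isProx_growth hP hΦ hθ hp hp'.1
  have h2 : P.proxObj (P.obj Φ θ) P.lam p' x ≤ P.proxObj (P.obj Φ θ) P.lam p x := hp'.2 hp.1
  have h3 : ‖p' - p‖ ^ 2 ≤ 0 := by
    have := hP.γ_pos
    by_contra! h
    nlinarith
  have h4 : ‖p' - p‖ = 0 := by nlinarith [norm_nonneg (p' - p)]
  exact sub_eq_zero.1 (norm_eq_zero.1 h4)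

/-- On `X` the prox objective is at least a constant plus `γ‖u - x‖²`, hence coercive; this replaces
compactness of `X`. -/
theorem exists_isProx [FiniteDimensional ℝ 𝕏] (hP : P.Admissible) (hΦ : P.Coupling Φ)
    (hθ : ContinuousOn θ P.Y) (hbdd : BddBelow (P.obj Φ θ '' P.X)) {x : 𝕏} (hx : x ∈ P.X) :
    ∃ p, P.IsProx (P.obj Φ θ) P.lam x p := by
  obtain ⟨m, hm⟩ := hbdd
  have hγ := hP.γ_pos
  have hcont : ContinuousOn (fun u => P.proxObj (P.obj Φ θ) P.lam u x) P.X :=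
    (continuousOn_proxObj hP hΦ hθ).comp (f := fun u => (u, x)) (by fun_prop) fun u hu => ⟨hu, hx⟩
  obtain ⟨p, hp, hmin⟩ := hcont.exists_isMinOn' hP.X_closed hx (by
    have h1 : Tendsto (fun u => P.γ * ‖u - x‖ ^ 2 + m) (cocompact 𝕏) atTop := by
      have h2 : Tendsto (fun u : 𝕏 => ‖u - x‖) (cocompact 𝕏) atTop := by
        simpa only [dist_eq_norm] using tendsto_dist_right_cocompact_atTop x
      exact tendsto_atTop_add_const_right _ _
        (((tendsto_pow_atTop two_ne_zero).comp h2).const_mul_atTop hγ)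
    filter_upwards [(h1.eventually_ge_atTop (P.proxObj (P.obj Φ θ) P.lam x x)).filter_mono
      inf_le_left, mem_inf_of_right (mem_principal_self P.X)] with u hu huX
    refine hu.trans ?_
    have h3 := hm (mem_image_of_mem _ huX)
    have h4 := hP.le_bregman hx huX
    simp only [Problem.proxObj, P.inv_lam]
    nlinarith)
  exact ⟨p, hp, hmin⟩

/-- With `ρ = η/(4Ω_Y)` the penalty `ρ ωY` moves every payoff by at most `η/4`, and so also the
maximum. -/
theorem abs_qSm_sub_q_le (hP : P.Admissible) (hΦ : P.Coupling Φ) {η : ℝ} (hη : 0 ≤ η) {x : 𝕏}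
    (hx : x ∈ P.X) : |P.obj Φ (P.penalty (P.rho η)) x - P.obj Φ (re P.g) x| ≤ η / 4 := by
  unfold Problem.obj
  rw [add_sub_add_right_eq_sub, abs_sub_le_iff]
  constructor
  · rw [sub_le_iff_le_add]
    refine maxVal_le hP fun y hy => ?_
    have h1 := le_maxVal hP hΦ hP.continuousOn_g hx hy
    have h2 := neg_le_of_abs_le (hP.rho_mul_abs_le hη hy)
    unfold Problem.penalty
    linarith
  · rw [sub_le_iff_le_add]
    refine maxVal_le hP fun y hy => ?_
    have h1 := le_maxVal hP hΦ (hP.continuousOn_penalty (P.rho η)) hx hy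
    have h2 := le_of_abs_le (hP.rho_mul_abs_le hη hy)
    have h3 : P.penalty (P.rho η) y = re P.g y + P.rho η * re P.ωY y := rfl
    linarith

end Problem.Coupling

end Problem

/-! ### Euclidean proximal steps -/

/-- Expanding `½‖e(u - x)‖²` leaves `½‖e u‖²`, a linear term in `u` and a constant. So the center
`x` and the functional `l` enter as a single linear perturbation of a fixed strongly convex problem,
whose minimizer is continuous in it. -/
theorem ModulusConvexOn.exists_prox {E : Type*} [NormedAddCommGroup E] [NormedSpace ℝ E]
    {H : Type*} [NormedAddCommGroup H] [InnerProductSpace ℝ H] {S : Set E} {B f : E → ℝ}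
    (h : ModulusConvexOn S B f) (hS : IsCompact S) (hne : S.Nonempty) (hf : ContinuousOn f S)
    (hB : ∀ d, 0 ≤ B d) (e : E →L[ℝ] H) (he : ∀ d, ‖d‖ ≤ ‖e d‖) :
    ∃ p : E × StrongDual ℝ E → E, Continuous p ∧ ∀ x l, p (x, l) ∈ S ∧
      ∀ u ∈ S, f (p (x, l)) + l (p (x, l)) + 1 / 2 * ‖e (p (x, l) - x)‖ ^ 2 +
        B (u - p (x, l)) + 1 / 2 * ‖e (u - p (x, l))‖ ^ 2 ≤
          f u + l u + 1 / 2 * ‖e (u - x)‖ ^ 2 := by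
  obtain ⟨p, hpc, hp⟩ := (h.add (ModulusConvexOn.half_sq_norm e h.1)).exists_continuous_argmin hS hne
    (hf.add (by fun_prop)) fun d => by
      have := pow_le_pow_left₀ (norm_nonneg d) (he d) 2
      linarith [hB d]
  refine ⟨fun z => p (z.2 - (innerSL ℝ (e z.1)).comp e), hpc.comp ?_, fun x l => ⟨(hp _).1, ?_⟩⟩
  · exact continuous_snd.sub (((innerSL ℝ).continuous.comp
      (e.continuous.comp continuous_fst)).clm_comp continuous_const)
  · intro u hu
    have key := (hp (l - (innerSL ℝ (e x)).comp e)).2 u hu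
    set q := p (l - (innerSL ℝ (e x)).comp e)
    have expand : ∀ w : E, ‖e (w - x)‖ ^ 2 = ‖e w‖ ^ 2 - 2 * inner ℝ (e x) (e w) + ‖e x‖ ^ 2 := by
      intro w
      rw [map_sub, norm_sub_sq_real, real_inner_comm]
    have ev : ∀ w : E, (l - (innerSL ℝ (e x)).comp e) w = l w - inner ℝ (e x) (e w) := fun w => rfl
    rw [ev, ev] at key
    dsimp only
    rw [expand, expand]
    linarith

/-! ### One-step inequalities for the dual, primal and ghost updates -/

section Steps

variable {𝕏 : Type u} [NormedAddCommGroup 𝕏] [NormedSpace ℝ 𝕏]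
variable {𝕐 : Type v} [NormedAddCommGroup 𝕐] [NormedSpace ℝ 𝕐]
variable {H : Type*} [NormedAddCommGroup H] [InnerProductSpace ℝ H]
variable {H' : Type*} [NormedAddCommGroup H'] [InnerProductSpace ℝ H']
variable {P : Problem 𝕏 𝕐} {Φ : 𝕏 → 𝕐 → ℝ} {θ : 𝕐 → ℝ}

theorem mul_mul_le_sq_add {a b c : ℝ} (hc : 0 < c) : a * b ≤ c * a ^ 2 + (4 * c)⁻¹ * b ^ 2 := by
  have h : c * a ^ 2 + (4 * c)⁻¹ * b ^ 2 - a * b = (4 * c)⁻¹ * (2 * c * a - b) ^ 2 := by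
    field_simp; ring
  have : 0 ≤ (4 * c)⁻¹ * (2 * c * a - b) ^ 2 := by positivity
  linarith

theorem apply_le_norm_mul {E : Type*} [NormedAddCommGroup E] [NormedSpace ℝ E]
    (l : StrongDual ℝ E) (d : E) : l d ≤ ‖l‖ * ‖d‖ :=
  (le_abs_self _).trans (l.le_opNorm d)

/-- The composite part of the subproblem at `x₀`. -/
def Problem.composite (P : Problem 𝕏 𝕐) (x₀ u : 𝕏) : ℝ :=
  re P.r u + 2 * P.γ * bregman P.ωX u x₀

/-- The saddle function of the subproblem at `x₀`. -/
def Problem.saddle (P : Problem 𝕏 𝕐) (Φ : 𝕏 → 𝕐 → ℝ) (θ : 𝕐 → ℝ) (x₀ x : 𝕏) (y : 𝕐) : ℝ :=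
  Φ x y - θ y + P.composite x₀ x

theorem Problem.proxObj_eq {𝕐 : Type v} {P : Problem 𝕏 𝕐} {Φ : 𝕏 → 𝕐 → ℝ} {θ : 𝕐 → ℝ}
    (x₀ x : 𝕏) :
    P.proxObj (P.obj Φ θ) P.lam x x₀ = P.maxVal Φ θ x + P.composite x₀ x := by
  simp only [Problem.proxObj, Problem.obj, Problem.composite, P.inv_lam]
  ring

theorem Problem.Coupling.saddle_le_proxObj [FiniteDimensional ℝ 𝕐] (hP : P.Admissible)
    (hΦ : P.Coupling Φ) (hθ : ContinuousOn θ P.Y) (x₀ : 𝕏) {x : 𝕏} {y : 𝕐} (hx : x ∈ P.X)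
    (hy : y ∈ P.Y) : P.saddle Φ θ x₀ x y ≤ P.proxObj (P.obj Φ θ) P.lam x x₀ := by
  rw [Problem.proxObj_eq]
  exact add_le_add_left (hΦ.le_maxVal hP hθ hx hy) _

theorem Problem.Coupling.convexOn_saddle (hP : P.Admissible) (hΦ : P.Coupling Φ) (x₀ : 𝕏) {y : 𝕐}
    (hy : y ∈ P.Y) : ConvexOn ℝ P.X (fun x => P.saddle Φ θ x₀ x y) := by
  have h := ((hΦ.weaklyConvex hP hy).add_affine 0 (-θ y)).add (modulusConvexOn_composite hP x₀)
  refine ModulusConvexOn.convexOn (h.congr_right ?_) fun d => ?_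
  · funext x
    simp [Problem.saddle, Problem.composite, sub_eq_add_neg]
  · have := hP.γ_pos
    have h2 : 0 ≤ P.γ / 2 * ‖d‖ ^ 2 := by positivity
    linarith

theorem Problem.Coupling.concaveOn_saddle (hΦ : P.Coupling Φ) (hθ : ConvexOn ℝ P.Y θ) (x₀ : 𝕏)
    {x : 𝕏} (hx : x ∈ P.X) : ConcaveOn ℝ P.Y (fun y => P.saddle Φ θ x₀ x y) :=
  ((hΦ.concave x hx).sub hθ).add_const _

/-- The prox inequality leaves `½‖e(y' - y)‖²` to spend: a quarter of `‖y' - y‖²` pays for the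
smoothness error, as `τ Lyy ≤ 1/4`, and a quarter for the correlation of the noise with the
movement. -/
theorem dual_step (hP : P.Admissible) (hΦ : P.Coupling Φ) {e : 𝕐 →L[ℝ] H'}
    (he : ∀ d, ‖d‖ ≤ ‖e d‖) {x : 𝕏} {y y' v : 𝕐} (hx : x ∈ P.X) (hy : y ∈ P.Y) (hy' : y' ∈ P.Y)
    (hv : v ∈ P.Y) {a : StrongDual ℝ 𝕐} {τ : ℝ} (hτ : 0 ≤ τ) (hL : τ * P.Lyy ≤ 1 / 4)
    (h3 : τ * θ y' - τ * a y' + 1 / 2 * ‖e (y' - y)‖ ^ 2 + 1 / 2 * ‖e (v - y')‖ ^ 2 ≤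
      τ * θ v - τ * a v + 1 / 2 * ‖e (v - y)‖ ^ 2) :
    τ * ((Φ x v - θ v) - (Φ x y' - θ y')) + 1 / 2 * ‖e (v - y')‖ ^ 2 ≤
      1 / 2 * ‖e (v - y)‖ ^ 2 + τ * (a - gradY Φ x y) (y - v) + τ ^ 2 * ‖a - gradY Φ x y‖ ^ 2 := by
  have h1 := hΦ.le_add_gradY hx hy hv
  have h2 := neg_le_of_abs_le (hΦ.abs_sub_gradY_le hP hx hy hy')
  have h4 := apply_le_norm_mul (a - gradY Φ x y) (y' - y)
  have h5 : τ * ‖a - gradY Φ x y‖ * ‖y' - y‖ ≤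
      1 * (τ * ‖a - gradY Φ x y‖) ^ 2 + (4 * 1)⁻¹ * ‖y' - y‖ ^ 2 := mul_mul_le_sq_add one_pos
  have h6 := pow_le_pow_left₀ (norm_nonneg (y' - y)) (he (y' - y)) 2
  have h7 := mul_le_mul_of_nonneg_right hL (sq_nonneg ‖y' - y‖)
  have h8 := mul_le_mul_of_nonneg_left h4 hτ
  have h9 := mul_le_mul_of_nonneg_left h1 hτ
  have h10 := mul_le_mul_of_nonneg_left h2 hτ
  simp only [sub_apply, map_sub] at h3 h6 h8 h9 h10 ⊢
  linarith

/-- Of the available `½‖x' - x‖²`, smoothness takes a quarter and the noise an eighth. The remaining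
eighth is kept to absorb the cross term of `gap_step`. Weak convexity at `u` costs `τγ/2 ‖u - x‖²`,
half of the coefficient that the composite part gives back at `x'`. -/
theorem primal_step (hP : P.Admissible) (hΦ : P.Coupling Φ) {e : 𝕏 →L[ℝ] H}
    (he : ∀ d, ‖d‖ ≤ ‖e d‖) {x x' u x₀ : 𝕏} {y : 𝕐} (hx : x ∈ P.X) (hx' : x' ∈ P.X) (hu : u ∈ P.X)
    (hy : y ∈ P.Y) {b : StrongDual ℝ 𝕏} {τ : ℝ} (hτ : 0 ≤ τ) (hL : τ * P.Lxx ≤ 1 / 4)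
    (h3 : τ * P.composite x₀ x' + τ * b x' + 1 / 2 * ‖e (x' - x)‖ ^ 2 + τ * (P.γ * ‖u - x'‖ ^ 2) +
      1 / 2 * ‖e (u - x')‖ ^ 2 ≤ τ * P.composite x₀ u + τ * b u + 1 / 2 * ‖e (u - x)‖ ^ 2) :
    τ * ((Φ x' y + P.composite x₀ x') - (Φ u y + P.composite x₀ u)) + 1 / 2 * ‖e (u - x')‖ ^ 2 +
        τ * P.γ * ‖u - x'‖ ^ 2 ≤
      1 / 2 * ‖e (u - x)‖ ^ 2 + τ * P.γ / 2 * ‖u - x‖ ^ 2 + τ * (b - gradX Φ x y) (u - x) +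
        2 * τ ^ 2 * ‖b - gradX Φ x y‖ ^ 2 - 1 / 8 * ‖x' - x‖ ^ 2 := by
  have h1 := hΦ.weakly_convex x hx u hu y hy
  have h2 := le_of_abs_le (hΦ.abs_sub_gradX_le hP hx hx' hy)
  have h4 := apply_le_norm_mul (b - gradX Φ x y) (x - x')
  have h5 : τ * ‖b - gradX Φ x y‖ * ‖x - x'‖ ≤
      2 * (τ * ‖b - gradX Φ x y‖) ^ 2 + (4 * 2)⁻¹ * ‖x - x'‖ ^ 2 := mul_mul_le_sq_add two_pos
  have h6 := pow_le_pow_left₀ (norm_nonneg (x' - x)) (he (x' - x)) 2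
  have h7 := mul_le_mul_of_nonneg_right hL (sq_nonneg ‖x' - x‖)
  have h8 := mul_le_mul_of_nonneg_left h4 hτ
  have h9 := mul_le_mul_of_nonneg_left h1 hτ
  have h10 := mul_le_mul_of_nonneg_left h2 hτ
  rw [norm_sub_rev x x'] at h5 h8
  simp only [sub_apply, map_sub] at h3 h6 h8 h9 h10 ⊢
  linarith

/-- One step of the contraction phase. -/
theorem contraction_step [FiniteDimensional ℝ 𝕐] (hP : P.Admissible) (hΦ : P.Coupling Φ)
    (hθ : ContinuousOn θ P.Y) {e : 𝕏 →L[ℝ] H}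
    (he : ∀ d, ‖d‖ ≤ ‖e d‖) {D : ℝ} (hD : ∀ y ∈ P.Y, ∀ y' ∈ P.Y, ‖y - y'‖ ≤ D)
    {x x' u x₀ : 𝕏} {y : 𝕐} (hx : x ∈ P.X) (hx' : x' ∈ P.X)
    (hu : P.IsProx (P.obj Φ θ) P.lam x₀ u)
    (hy : y ∈ P.Y) {b : StrongDual ℝ 𝕏} {τ : ℝ} (hτ : 0 ≤ τ) (hL : τ * P.Lxx ≤ 1 / 4)
    (h3 : τ * P.composite x₀ x' + τ * b x' + 1 / 2 * ‖e (x' - x)‖ ^ 2 + τ * (P.γ * ‖u - x'‖ ^ 2) +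
      1 / 2 * ‖e (u - x')‖ ^ 2 ≤ τ * P.composite x₀ u + τ * b u + 1 / 2 * ‖e (u - x)‖ ^ 2) :
    1 / 2 * ‖e (u - x')‖ ^ 2 + τ * P.γ * ‖u - x'‖ ^ 2 ≤
      1 / 2 * ‖e (u - x)‖ ^ 2 + τ * P.γ / 2 * ‖u - x‖ ^ 2 + τ * (b - gradX Φ x y) (u - x) +
        2 * τ ^ 2 * ‖b - gradX Φ x y‖ ^ 2 + τ * ((P.Lxy * D) ^ 2 / (2 * P.γ)) := by
  have hγ := hP.γ_pos
  have h1 := primal_step hP hΦ he hx hx' hu.1 hy hτ hL h3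
  have h2 := hΦ.isProx_growth hP hθ hu hx'
  rw [Problem.proxObj_eq, Problem.proxObj_eq] at h2
  -- Here `y` is any point of `Y`. Replacing the maximizing dual point by `y` costs at most `Lxy D
  -- ‖x' - u‖`, which the quadratic growth at `u` absorbs up to the constant `(Lxy D)²/(2γ)`.
  have h4 : (P.maxVal Φ θ x' - Φ x' y) - (P.maxVal Φ θ u - Φ u y) ≤ P.Lxy * D * ‖x' - u‖ := by
    have : P.maxVal Φ θ x' ≤ P.maxVal Φ θ u - Φ u y + Φ x' y + P.Lxy * D * ‖x' - u‖ := by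
      refine Problem.Coupling.maxVal_le hP fun v hv => ?_
      have h5 := hΦ.cross_le hP hu.1 hx' hy hv
      have h6 := hΦ.le_maxVal hP hθ hu.1 hv
      have h7 := mul_le_mul_of_nonneg_right (mul_le_mul_of_nonneg_left (hD v hv y hy) hP.Lxy_nonneg)
        (norm_nonneg (x' - u))
      linarith
    linarith
  have h5 : P.Lxy * D * ‖x' - u‖ ≤ (2 * P.γ)⁻¹ * (P.Lxy * D) ^ 2 +
      (4 * (2 * P.γ)⁻¹)⁻¹ * ‖x' - u‖ ^ 2 := mul_mul_le_sq_add (by positivity)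
  have h6 : (4 * (2 * P.γ)⁻¹)⁻¹ = P.γ / 2 := by field_simp; norm_num
  rw [h6] at h5
  have h7 : -((P.Lxy * D) ^ 2 / (2 * P.γ)) ≤
      (Φ x' y + P.composite x₀ x') - (Φ u y + P.composite x₀ u) := by
    rw [div_eq_inv_mul]; linarith
  have h8 := mul_le_mul_of_nonneg_left h7 hτ
  have h9 := sq_nonneg ‖x' - x‖
  linarith

/-- Online regret bound for the linear losses `ζ`: it holds for every realization and every
comparison point `v`, so `v` may depend on the noise. -/
theorem ghost_step {e : 𝕐 →L[ℝ] H'} (he : ∀ d, ‖d‖ ≤ ‖e d‖) {y y' v : 𝕐} {ζ : StrongDual ℝ 𝕐}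
    {τ : ℝ} (hτ : 0 ≤ τ)
    (h3 : τ * ζ y' + 1 / 2 * ‖e (y' - y)‖ ^ 2 + 1 / 2 * ‖e (v - y')‖ ^ 2 ≤
      τ * ζ v + 1 / 2 * ‖e (v - y)‖ ^ 2) :
    τ * ζ (y - v) + 1 / 2 * ‖e (v - y')‖ ^ 2 ≤
      1 / 2 * ‖e (v - y)‖ ^ 2 + 1 / 2 * τ ^ 2 * ‖ζ‖ ^ 2 := by
  have h4 := mul_le_mul_of_nonneg_left (apply_le_norm_mul ζ (y - y')) hτ
  have h5 : τ * ‖ζ‖ * ‖y - y'‖ ≤ (1 / 2) * (τ * ‖ζ‖) ^ 2 + (4 * (1 / 2))⁻¹ * ‖y - y'‖ ^ 2 :=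
    mul_mul_le_sq_add (by norm_num)
  have h6 := pow_le_pow_left₀ (norm_nonneg (y' - y)) (he (y' - y)) 2
  rw [norm_sub_rev y y'] at h4 h5
  simp only [map_sub] at h3 h4 h6 ⊢
  linarith

/-- One step of the averaging phase. -/
theorem gap_step (hP : P.Admissible) (hΦ : P.Coupling Φ) {e : 𝕏 →L[ℝ] H}
    (he : ∀ d, ‖d‖ ≤ ‖e d‖) {e' : 𝕐 →L[ℝ] H'} (he' : ∀ d, ‖d‖ ≤ ‖e' d‖)
    {D : ℝ} (hD : ∀ y ∈ P.Y, ∀ y' ∈ P.Y, ‖y - y'‖ ≤ D)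
    {x x' u x₀ : 𝕏} {y y' v z z' : 𝕐} (hx : x ∈ P.X) (hx' : x' ∈ P.X) (hu : u ∈ P.X)
    (hy : y ∈ P.Y) (hy' : y' ∈ P.Y) (hv : v ∈ P.Y)
    {a : StrongDual ℝ 𝕐} {b : StrongDual ℝ 𝕏} {τ : ℝ} (hτ : 0 ≤ τ) (hL : τ * P.Lxx ≤ 1 / 4)
    (hL' : τ * P.Lyy ≤ 1 / 4)
    (h1 : τ * θ y' - τ * a y' + 1 / 2 * ‖e' (y' - y)‖ ^ 2 + 1 / 2 * ‖e' (v - y')‖ ^ 2 ≤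
      τ * θ v - τ * a v + 1 / 2 * ‖e' (v - y)‖ ^ 2)
    (h2 : τ * P.composite x₀ x' + τ * b x' + 1 / 2 * ‖e (x' - x)‖ ^ 2 + τ * (P.γ * ‖u - x'‖ ^ 2) +
      1 / 2 * ‖e (u - x')‖ ^ 2 ≤ τ * P.composite x₀ u + τ * b u + 1 / 2 * ‖e (u - x)‖ ^ 2)
    (h3 : τ * (a - gradY Φ x y) z' + 1 / 2 * ‖e' (z' - z)‖ ^ 2 + 1 / 2 * ‖e' (v - z')‖ ^ 2 ≤
      τ * (a - gradY Φ x y) v + 1 / 2 * ‖e' (v - z)‖ ^ 2) :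
    τ * (P.saddle Φ θ x₀ x' v - P.saddle Φ θ x₀ u y') +
        (1 / 2 * ‖e (u - x')‖ ^ 2 + τ * P.γ / 2 * ‖u - x'‖ ^ 2 + 1 / 2 * ‖e' (v - y')‖ ^ 2 +
          1 / 2 * ‖e' (v - z')‖ ^ 2) ≤
      1 / 2 * ‖e (u - x)‖ ^ 2 + τ * P.γ / 2 * ‖u - x‖ ^ 2 + 1 / 2 * ‖e' (v - y)‖ ^ 2 +
          1 / 2 * ‖e' (v - z)‖ ^ 2 +
        (τ * (b - gradX Φ x y') (u - x) + τ * (a - gradY Φ x y) (y - z) +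
          τ ^ 2 * (3 / 2 * ‖a - gradY Φ x y‖ ^ 2 + 2 * ‖b - gradX Φ x y'‖ ^ 2 +
            2 * (P.Lxy * D) ^ 2)) := by
  have hγ := hP.γ_pos
  have k1 := dual_step hP hΦ he' hx hy hy' hv hτ hL' h1
  have k2 := primal_step hP hΦ he hx hx' hu hy' hτ hL h2
  have k3 := ghost_step he' hτ h3
  have k4 := hΦ.cross_le hP hx hx' hy' hv
  have k5 := mul_le_mul_of_nonneg_right (mul_le_mul_of_nonneg_left (hD v hv y' hy') hP.Lxy_nonneg)
    (norm_nonneg (x' - x))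
  have k6 := mul_le_mul_of_nonneg_left (k4.trans k5) hτ
  have k7 : τ * (P.Lxy * D) * ‖x' - x‖ ≤ 2 * (τ * (P.Lxy * D)) ^ 2 +
      (4 * 2)⁻¹ * ‖x' - x‖ ^ 2 := mul_mul_le_sq_add two_pos
  have k8 : 0 ≤ τ * P.γ / 2 * ‖u - x'‖ ^ 2 := by positivity
  -- The ghost point `z` separates a part of the noise whose test vector is known before the sample
  -- from a part controlled pathwise by `ghost_step`.
  have k9 : (a - gradY Φ x y) (y - v) = (a - gradY Φ x y) (y - z) + (a - gradY Φ x y) (z - v) := by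
    rw [← map_add, sub_add_sub_cancel]
  rw [k9] at k1
  unfold Problem.saddle
  linarith

/-- The gap of averaged iterates, in terms of the telescoping potential. -/
theorem average_gap [FiniteDimensional ℝ 𝕐] (hP : P.Admissible) (hΦ : P.Coupling Φ)
    (hθ : ContinuousOn θ P.Y) (hθc : ConvexOn ℝ P.Y θ) {N : ℕ} (hN : 0 < N) {x₀ u : 𝕏}
    (hu : u ∈ P.X) {x : ℕ → 𝕏} {y : ℕ → 𝕐} (hx : ∀ t, x t ∈ P.X) (hy : ∀ t, y t ∈ P.Y)
    {τ : ℝ} (hτ : 0 < τ) {V : 𝕐 → ℕ → ℝ} {n : ℕ → ℝ} {V₀ : ℝ} (hV : ∀ v ∈ P.Y, ∀ t, 0 ≤ V v t)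
    (hV₀ : ∀ v ∈ P.Y, V v 0 ≤ V₀)
    (hstep : ∀ v ∈ P.Y, ∀ t < N, τ * (P.saddle Φ θ x₀ (x t) v - P.saddle Φ θ x₀ u (y t)) +
      V v (t + 1) ≤ V v t + n t) :
    τ * N * (P.proxObj (P.obj Φ θ) P.lam (∑ t ∈ Finset.range N, (N : ℝ)⁻¹ • x t) x₀ -
      P.proxObj (P.obj Φ θ) P.lam u x₀) ≤ V₀ + ∑ t ∈ Finset.range N, n t := by
  have hN' : (0 : ℝ) < N := by exact_mod_cast hN
  have hw : ∑ t ∈ Finset.range N, (N : ℝ)⁻¹ = 1 := by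
    rw [Finset.sum_const, Finset.card_range, nsmul_eq_mul, mul_inv_cancel₀ hN'.ne']
  have hxb : ∑ t ∈ Finset.range N, (N : ℝ)⁻¹ • x t ∈ P.X :=
    hP.X_convex.sum_mem (fun _ _ => by positivity) hw fun t _ => hx t
  have hyb : ∑ t ∈ Finset.range N, (N : ℝ)⁻¹ • y t ∈ P.Y :=
    hP.Y_convex.sum_mem (fun _ _ => by positivity) hw fun t _ => hy t
  -- Jensen in `y` at the fixed `u`. The average of the dual iterates occurs only in the analysis
  -- and is never computed.
  have h1 : ∑ t ∈ Finset.range N, (N : ℝ)⁻¹ * P.saddle Φ θ x₀ u (y t) ≤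
      P.proxObj (P.obj Φ θ) P.lam u x₀ :=
    ((hΦ.concaveOn_saddle hθc x₀ hu).le_map_sum (fun _ _ => by positivity) hw
      fun t _ => hy t).trans (hΦ.saddle_le_proxObj hP hθ x₀ hu hyb)
  rw [← Finset.mul_sum] at h1
  have tel : ∀ v ∈ P.Y, ∀ m ≤ N, τ * (∑ t ∈ Finset.range m, P.saddle Φ θ x₀ (x t) v -
      ∑ t ∈ Finset.range m, P.saddle Φ θ x₀ u (y t)) + V v m ≤
        V v 0 + ∑ t ∈ Finset.range m, n t := by
    intro v hv m
    induction m with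
    | zero => intro _; simp
    | succ m ih =>
      intro hm
      have a1 := ih (by omega)
      have a2 := hstep v hv m (by omega)
      rw [Finset.sum_range_succ, Finset.sum_range_succ, Finset.sum_range_succ]
      linarith
  have h2 : P.proxObj (P.obj Φ θ) P.lam (∑ t ∈ Finset.range N, (N : ℝ)⁻¹ • x t) x₀ ≤
      P.proxObj (P.obj Φ θ) P.lam u x₀ + (τ * N)⁻¹ * (V₀ + ∑ t ∈ Finset.range N, n t) := by
    rw [Problem.proxObj_eq, ← le_sub_iff_add_le]
    -- The bound is proved for each `v` before the maximum is taken; Jensen in `x` then treats the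
    -- averaged primal point.
    refine Problem.Coupling.maxVal_le hP fun v hv => ?_
    have b1 := (hΦ.convexOn_saddle (θ := θ) hP x₀ hv).map_sum_le (fun _ _ => by positivity) hw
      fun t _ => hx t
    simp only [smul_eq_mul] at b1
    rw [← Finset.mul_sum] at b1
    have b2 := tel v hv N le_rfl
    have b3 : τ * (∑ t ∈ Finset.range N, P.saddle Φ θ x₀ (x t) v -
        ∑ t ∈ Finset.range N, P.saddle Φ θ x₀ u (y t)) ≤ V₀ + ∑ t ∈ Finset.range N, n t := by
      linarith [hV v hv N, hV₀ v hv]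
    have b4 := mul_le_mul_of_nonneg_left b3 (by positivity : 0 ≤ (τ * N)⁻¹)
    have b5 : (τ * N)⁻¹ * (τ * (∑ t ∈ Finset.range N, P.saddle Φ θ x₀ (x t) v -
        ∑ t ∈ Finset.range N, P.saddle Φ θ x₀ u (y t))) =
        (N : ℝ)⁻¹ * ∑ t ∈ Finset.range N, P.saddle Φ θ x₀ (x t) v -
          (N : ℝ)⁻¹ * ∑ t ∈ Finset.range N, P.saddle Φ θ x₀ u (y t) := by
      field_simp
    rw [b5] at b4
    unfold Problem.saddle at b1 b4 h1
    linarith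
  calc _ ≤ τ * N * ((τ * N)⁻¹ * (V₀ + ∑ t ∈ Finset.range N, n t)) :=
        mul_le_mul_of_nonneg_left (by linarith) (by positivity)
    _ = _ := by field_simp

end Steps

/-! ### Independence and noise -/

section Probability

variable {Ω : Type*} [MeasurableSpace Ω] {ν : Measure Ω}

theorem indepFun_of_measurable_iSup {ι : Type*} {Ξ : Type*} [MeasurableSpace Ξ] {ξ : ι → Ω → Ξ}
    (hξ : ∀ i, Measurable (ξ i)) (hind : iIndepFun ξ ν) {S T : Set ι} (hST : Disjoint S T)
    {α β : Type*} [MeasurableSpace α] [MeasurableSpace β] {f : Ω → α} {g : Ω → β}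
    (hf : Measurable[⨆ i ∈ S, MeasurableSpace.comap (ξ i) inferInstance] f)
    (hg : Measurable[⨆ i ∈ T, MeasurableSpace.comap (ξ i) inferInstance] g) : IndepFun f g ν := by
  rw [IndepFun_iff_Indep]
  exact indep_of_indep_of_le_left (indep_of_indep_of_le_right
    (indep_iSup_of_disjoint (fun i => (hξ i).comap_le) hind.iIndep hST) hg.comap_le) hf.comap_le

theorem measurable_iSup_comap {Ω ι : Type*} {Ξ : Type*} [MeasurableSpace Ξ] {ξ : ι → Ω → Ξ}
    {S : Set ι} {i : ι} (hi : i ∈ S) :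
    Measurable[⨆ i ∈ S, MeasurableSpace.comap (ξ i) inferInstance] (ξ i) :=
  Measurable.mono (comap_measurable (ξ i))
    (le_biSup (fun i => MeasurableSpace.comap (ξ i) inferInstance) hi) le_rfl

variable [IsProbabilityMeasure ν]

/-- Integration of a function of two independent random variables. -/
theorem integral_of_indepFun {α Ξ : Type*} [MeasurableSpace α] [MeasurableSpace Ξ]
    {μ : Measure Ξ} [IsProbabilityMeasure μ] {Z : Ω → α} {s : Ω → Ξ} (hZ : Measurable Z)
    (hs : Measurable s) (hind : IndepFun Z s ν) (hμ : ν.map s = μ) {J : α → Ξ → ℝ}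
    (hJ : Measurable (Function.uncurry J)) (hint : ∀ o, Integrable (J (Z o)) μ) {C : ℝ}
    (hC : ∀ o, ∫ t, |J (Z o) t| ∂μ ≤ C) :
    Integrable (fun o => J (Z o) (s o)) ν ∧
      ∫ o, J (Z o) (s o) ∂ν = ∫ o, ∫ t, J (Z o) t ∂μ ∂ν := by
  have hmap : ν.map (fun o => (Z o, s o)) = (ν.map Z).prod μ := by
    rw [(indepFun_iff_map_prod_eq_prod_map_map hZ.aemeasurable hs.aemeasurable).1 hind, hμ]
  have : IsProbabilityMeasure (ν.map Z) := Measure.isProbabilityMeasure_map hZ.aemeasurable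
  have hJi : Integrable (Function.uncurry J) ((ν.map Z).prod μ) := by
    rw [integrable_prod_iff hJ.aestronglyMeasurable]
    constructor
    -- Integrability of the sections is known only at the values of `Z`, which is enough almost
    -- everywhere for the law of `Z`.
    · exact (ae_map_iff hZ.aemeasurable (_root_.measurableSet_integrable (f := J) (μ := μ)
        hJ.stronglyMeasurable)).2 (Eventually.of_forall hint)
    · have hm : StronglyMeasurable fun z => ∫ t, ‖Function.uncurry J (z, t)‖ ∂μ :=
        hJ.norm.stronglyMeasurable.integral_prod_right
      rw [integrable_map_measure hm.aestronglyMeasurable hZ.aemeasurable]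
      refine Integrable.of_bound (hm.comp_measurable hZ).aestronglyMeasurable C
        (Eventually.of_forall fun o => ?_)
      simp only [Function.comp_apply]
      rw [Real.norm_of_nonneg (integral_nonneg fun _ => norm_nonneg _)]
      exact hC o
  have hpair : AEMeasurable (fun o => (Z o, s o)) ν := (hZ.prodMk hs).aemeasurable
  constructor
  · rw [← hmap, integrable_map_measure hJ.aestronglyMeasurable hpair] at hJi
    exact hJi
  · have h1 : ∫ o, J (Z o) (s o) ∂ν = ∫ p, Function.uncurry J p ∂(ν.map fun o => (Z o, s o)) :=
      (integral_map hpair hJ.aestronglyMeasurable).symm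
    rw [h1, hmap, integral_prod _ hJi]
    exact integral_map hZ.aemeasurable
      (hJ.stronglyMeasurable.integral_prod_right (ν := μ)).aestronglyMeasurable

/-- An unbiased estimate with bounded variance, computed with a fresh sample, has mean zero noise
against everything known before. -/
theorem noise_moments {α Ξ E : Type*} [MeasurableSpace α] [MeasurableSpace Ξ]
    [NormedAddCommGroup E] [NormedSpace ℝ E] [FiniteDimensional ℝ E] [MeasurableSpace E]
    [BorelSpace E] {μ : Measure Ξ} [IsProbabilityMeasure μ] {s : Ω → Ξ} (hs : Measurable s)
    (hμ : ν.map s = μ) {G : α → Ξ → StrongDual ℝ E} (hG : Measurable (Function.uncurry G))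
    {m : α → StrongDual ℝ E} {A : Set α} {σ : ℝ} (hint : ∀ z ∈ A, Integrable (G z) μ)
    (hmean : ∀ z ∈ A, ∫ t, G z t ∂μ = m z)
    (hvar : ∀ z ∈ A, Integrable (fun t => ‖G z t - m z‖ ^ 2) μ ∧
      ∫ t, ‖G z t - m z‖ ^ 2 ∂μ ≤ σ ^ 2)
    {Z : Ω → α} {c : Ω → E} (hZ : Measurable Z) (hc : Measurable c) (hZA : ∀ o, Z o ∈ A) {C : ℝ}
    (hC : ∀ o, ‖c o‖ ≤ C) (hind : IndepFun (fun o => (Z o, c o)) s ν) :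
    (Integrable (fun o => (G (Z o) (s o) - m (Z o)) (c o)) ν ∧
      ∫ o, (G (Z o) (s o) - m (Z o)) (c o) ∂ν = 0) ∧
    Integrable (fun o => ‖G (Z o) (s o) - m (Z o)‖ ^ 2) ν ∧
      ∫ o, ‖G (Z o) (s o) - m (Z o)‖ ^ 2 ∂ν ≤ σ ^ 2 := by
  -- The mean `m` need not be measurable, but it agrees on `A` with the parametric integral `M`,
  -- which is.
  set M : α → StrongDual ℝ E := fun z => ∫ t, G z t ∂μ
  have hM : Measurable M := hG.stronglyMeasurable.integral_prod_right.measurable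
  have hMm : ∀ o, m (Z o) = M (Z o) := fun o => (hmean _ (hZA o)).symm
  have hdiff : Measurable fun p : (α × E) × Ξ => G p.1.1 p.2 - M p.1.1 :=
    (hG.comp ((measurable_fst.comp measurable_fst).prodMk measurable_snd)).sub
      (hM.comp (measurable_fst.comp measurable_fst))
  have hintd : ∀ o, Integrable (fun t => G (Z o) t - M (Z o)) μ := fun o =>
    (hint _ (hZA o)).sub (integrable_const _)
  have hvard : ∀ o, Integrable (fun t => ‖G (Z o) t - M (Z o)‖ ^ 2) μ ∧
      ∫ t, ‖G (Z o) t - M (Z o)‖ ^ 2 ∂μ ≤ σ ^ 2 := fun o => by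
    rw [← hMm o]; exact hvar _ (hZA o)
  simp only [hMm]
  refine ⟨?_, ?_⟩
  · have h1 : Measurable (Function.uncurry fun (p : α × E) t => (G p.1 t - M p.1) p.2) := by
      have : Continuous fun q : StrongDual ℝ E × E => q.1 q.2 :=
        isBoundedBilinearMap_apply.continuous
      exact this.measurable.comp (hdiff.prodMk (measurable_snd.comp measurable_fst))
    obtain ⟨k1, k2⟩ := integral_of_indepFun (C := C * (σ ^ 2 + 1)) (hZ.prodMk hc) hs hind hμ h1
      (fun o => (hintd o).apply_continuousLinearMap (c o)) (fun o => by
        have hb : ∀ t, |(G (Z o) t - M (Z o)) (c o)| ≤ C * (‖G (Z o) t - M (Z o)‖ ^ 2 + 1) := by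
          intro t
          have a1 := (G (Z o) t - M (Z o)).le_opNorm (c o)
          rw [Real.norm_eq_abs] at a1
          have a2 := mul_le_mul_of_nonneg_left (hC o) (norm_nonneg (G (Z o) t - M (Z o)))
          have a3 : ‖G (Z o) t - M (Z o)‖ ≤ ‖G (Z o) t - M (Z o)‖ ^ 2 + 1 := by
            nlinarith [sq_nonneg (‖G (Z o) t - M (Z o)‖ - 1)]
          have a4 := mul_le_mul_of_nonneg_right a3 ((norm_nonneg _).trans (hC o))
          linarith
        have a5 : Integrable (fun t => C * (‖G (Z o) t - M (Z o)‖ ^ 2 + 1)) μ :=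
          ((hvard o).1.add (integrable_const _)).const_mul _
        refine (integral_mono ((hintd o).apply_continuousLinearMap (c o)).abs a5 hb).trans ?_
        rw [integral_const_mul, integral_add (hvard o).1 (integrable_const _)]
        refine mul_le_mul_of_nonneg_left ?_ ((norm_nonneg _).trans (hC o))
        simpa using (hvard o).2)
    refine ⟨k1, k2.trans ?_⟩
    have : ∀ o, ∫ t, (G (Z o) t - M (Z o)) (c o) ∂μ = 0 := fun o => by
      refine (ContinuousLinearMap.integral_apply (hintd o) (c o)).symm.trans ?_
      rw [integral_sub (hint _ (hZA o)) (integrable_const _)]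
      simp [M]
    dsimp only
    simp_rw [this]
    exact integral_zero _ _
  · have h1 : Measurable (Function.uncurry fun (p : α × E) t => ‖G p.1 t - M p.1‖ ^ 2) :=
      hdiff.norm.pow_const 2
    have habs : ∀ o, ∫ t, |‖G (Z o) t - M (Z o)‖ ^ 2| ∂μ ≤ σ ^ 2 := fun o => by
      simp only [abs_pow, abs_norm]; exact (hvard o).2
    obtain ⟨k1, k2⟩ := integral_of_indepFun (hZ.prodMk hc) hs hind hμ h1
      (fun o => (hvard o).1) habs
    refine ⟨k1, ?_⟩
    dsimp only at k2
    rw [k2]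
    refine (integral_mono_of_nonneg (Eventually.of_forall fun o => integral_nonneg fun t =>
      sq_nonneg _) (integrable_const (σ ^ 2)) (Eventually.of_forall fun o => (hvard o).2)).trans ?_
    simp

/-- Expected contraction. -/
theorem integral_contraction {W n : ℕ → Ω → ℝ} {q b c W₀ : ℝ} (hq0 : 0 ≤ q) (hq1 : q < 1) {T : ℕ}
    (hW : ∀ t, Integrable (W t) ν) (hn : ∀ t, Integrable (n t) ν) (hbc : 0 ≤ b + c)
    (hstep : ∀ t < T, ∀ o, W (t + 1) o ≤ q * W t o + b + n t o) (hnc : ∀ t, ∫ o, n t o ∂ν ≤ c)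
    (h0 : ∫ o, W 0 o ∂ν ≤ W₀) : ∫ o, W T o ∂ν ≤ q ^ T * W₀ + (b + c) / (1 - q) := by
  have hq : 0 < 1 - q := by linarith
  have key : ∀ t ≤ T, ∫ o, W t o ∂ν ≤ q ^ t * W₀ + (b + c) / (1 - q) := by
    intro t
    induction t with
    | zero => intro _; have : 0 ≤ (b + c) / (1 - q) := by positivity
              simp; linarith
    | succ t ih =>
      intro ht
      have h1 := ih (by omega)
      have h2 : ∫ o, W (t + 1) o ∂ν ≤ ∫ o, (q * W t o + b + n t o) ∂ν :=
        integral_mono (hW _) ((((hW t).const_mul q).add (integrable_const b)).add (hn t))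
          (hstep t (by omega))
      rw [integral_add (f := fun o => q * W t o + b)
        (((hW t).const_mul q).add (integrable_const b)) (hn t),
        integral_add ((hW t).const_mul q) (integrable_const b), integral_const_mul] at h2
      simp only [integral_const, probReal_univ, smul_eq_mul, one_mul] at h2
      have h3 := mul_le_mul_of_nonneg_left h1 hq0
      have h4 : q * ((b + c) / (1 - q)) + (b + c) = (b + c) / (1 - q) := by
        field_simp; ring
      have h5 := hnc t
      rw [pow_succ]
      linarith
  exact key T le_rfl

end Probability

/-- A function that is continuous on a compact set has measurable, bounded, integrable composites
with random points of the set. -/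
theorem _root_.ContinuousOn.integrable_comp_of_isCompact {Ω E : Type*} [MeasurableSpace Ω]
    {ν : Measure Ω} [IsFiniteMeasure ν] [TopologicalSpace E] [MeasurableSpace E] [BorelSpace E]
    {K : Set E} {h : E → ℝ} (hh : ContinuousOn h K) (hK : IsCompact K) {z : Ω → E}
    (hz : Measurable z) (hzK : ∀ o, z o ∈ K) : Integrable (fun o => h (z o)) ν := by
  obtain ⟨C, hC⟩ := hK.exists_bound_of_continuousOn hh
  have hm : Measurable (fun o => h (z o)) :=
    (continuousOn_iff_continuous_domRestrict.1 hh).measurable.comp (hz.subtype_mk (h := hzK))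
  exact Integrable.of_bound hm.aestronglyMeasurable C (Eventually.of_forall fun o => hC _ (hzK o))

/-- Nothing is known about `h` off `K`, so the composition is factored through the subtype `K`. -/
theorem _root_.ContinuousOn.measurable_comp {Ω E F : Type*} [MeasurableSpace Ω]
    [TopologicalSpace E] [MeasurableSpace E] [BorelSpace E] [TopologicalSpace F]
    [MeasurableSpace F] [BorelSpace F] {K : Set E} {h : E → F} (hh : ContinuousOn h K) {z : Ω → E}
    (hz : Measurable z) (hzK : ∀ o, z o ∈ K) : Measurable (fun o => h (z o)) :=
  (continuousOn_iff_continuous_domRestrict.1 hh).measurable.comp (hz.subtype_mk (h := hzK))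

/-! ### Measurability of methods -/

section Method

variable {𝕏 : Type u} [NormedAddCommGroup 𝕏] [NormedSpace ℝ 𝕏] [MeasurableSpace 𝕏]
variable {𝕐 : Type v} [NormedAddCommGroup 𝕐] [NormedSpace ℝ 𝕐] [MeasurableSpace 𝕐]
variable {P : Problem 𝕏 𝕐} {Ξ : Type w} [MeasurableSpace Ξ]

instance (A : Method P) : MeasurableSpace A.State := A.measState

theorem Oracle.measurable_answer {O : Oracle 𝕏 𝕐 Ξ}
    (hp : Measurable fun p : (𝕏 × 𝕐) × Ξ => O.primal p.1 p.2)
    (hd : Measurable fun p : (𝕏 × 𝕐) × Ξ => O.dual p.1 p.2) :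
    Measurable fun p : Query 𝕏 𝕐 × Ξ => O.answer p.1 p.2 := by
  have h : Measurable fun p : ((𝕏 × 𝕐) × Ξ) ⊕ ((𝕏 × 𝕐) × Ξ) =>
      (Sum.elim (fun q => Sum.inl (O.primal q.1 q.2)) (fun q => Sum.inr (O.dual q.1 q.2)) p :
        Answer 𝕏 𝕐) :=
    measurable_fun_sum (measurable_inl.comp hp) (measurable_inr.comp hd)
  have h2 := h.comp (MeasurableEquiv.sumProdDistrib (𝕏 × 𝕐) (𝕏 × 𝕐) Ξ).measurable
  convert h2 using 2 with p
  obtain ⟨q, s⟩ := p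
  cases q <;> rfl

variable {O : Oracle 𝕏 𝕐 Ξ}

theorem Method.measurable_state {Ω : Type*} {mΩ : MeasurableSpace Ω} (A : Method P)
    (hp : Measurable fun p : (𝕏 × 𝕐) × Ξ => O.primal p.1 p.2)
    (hd : Measurable fun p : (𝕏 × 𝕐) × Ξ => O.dual p.1 p.2) {x : Ω → 𝕏} (hx : Measurable x)
    {s : ℕ → Ω → Ξ} {t : ℕ} (hs : ∀ i < t, Measurable (s i)) :
    Measurable fun o => A.state O (x o) (fun i => s i o) t := by
  induction t with
  | zero => exact A.measurable_init.comp hx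
  | succ t ih =>
    have h1 := ih fun i hi => hs i (by omega)
    have h2 := (Oracle.measurable_answer hp hd).comp
      (((A.measurable_query t).comp h1).prodMk (hs t (by omega)))
    exact (A.measurable_update t).comp (h1.prodMk h2)

theorem Method.measurable_result {Ω : Type*} {mΩ : MeasurableSpace Ω} (A : Method P)
    (hp : Measurable fun p : (𝕏 × 𝕐) × Ξ => O.primal p.1 p.2)
    (hd : Measurable fun p : (𝕏 × 𝕐) × Ξ => O.dual p.1 p.2) {x : Ω → 𝕏} (hx : Measurable x)
    {s : ℕ → Ω → Ξ} (hs : ∀ i, Measurable (s i)) :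
    Measurable fun o => A.result O (x o) fun i => s i o :=
  A.measurable_output.comp (A.measurable_state hp hd hx fun i _ => hs i)

theorem measurable_iterate {Ω : Type*} {mΩ : MeasurableSpace Ω} {A : ℕ → Method P}
    (hp : Measurable fun p : (𝕏 × 𝕐) × Ξ => O.primal p.1 p.2)
    (hd : Measurable fun p : (𝕏 × 𝕐) × Ξ => O.dual p.1 p.2) (x₁ : 𝕏)
    {ξ : ℕ × ℕ → Ω → Ξ} {k : ℕ} (hξ : ∀ i, i.1 < k → Measurable (ξ i)) :
    Measurable fun o => iterate A O x₁ (fun i => ξ i o) k := by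
  induction k with
  | zero => exact measurable_const
  | succ k ih =>
    exact (A k).measurable_result hp hd (ih fun i hi => hξ i (by omega)) fun i => hξ (k, i) (by simp)

theorem iterate_mem {A : ℕ → Method P} {x₁ : 𝕏} (hx₁ : x₁ ∈ P.Xo) (s : ℕ × ℕ → Ξ) (k : ℕ) :
    iterate A O x₁ s k ∈ P.Xo := by
  cases k with
  | zero => exact hx₁
  | succ k => exact (A k).output_mem _

/-! ### The stochastic proximal descent-ascent method -/

open Classical in
/-- Replace points outside `S` by `c`. -/
def clamp {E : Type*} (S : Set E) (c x : E) : E := if x ∈ S then x else c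

theorem clamp_mem {E : Type*} {S : Set E} {c : E} (hc : c ∈ S) (x : E) : clamp S c x ∈ S := by
  unfold clamp; split_ifs with h
  exacts [h, hc]

theorem clamp_of_mem {E : Type*} {S : Set E} {c x : E} (hx : x ∈ S) : clamp S c x = x := if_pos hx

theorem measurable_clamp {E : Type*} [MeasurableSpace E] {S : Set E} (hS : MeasurableSet S)
    (c : E) : Measurable (clamp S c) := Measurable.ite hS measurable_id measurable_const

/-- Parameters of the method: base points, proximal maps, step sizes, averaging weights, and the
number of calls. -/
structure ProxParams (P : Problem 𝕏 𝕐) where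
  x₁ : 𝕏
  y₀ : 𝕐
  pX : ℕ → 𝕏 × StrongDual ℝ 𝕏 → 𝕏
  pY : ℕ → 𝕐 × StrongDual ℝ 𝕐 → 𝕐
  τ : ℕ → ℝ
  w : ℕ → ℝ
  calls : ℕ
  x₁_mem : x₁ ∈ P.X
  y₀_mem : y₀ ∈ P.Y
  pX_continuous : ∀ j, Continuous (pX j)
  pY_continuous : ∀ j, Continuous (pY j)

namespace ProxParams

variable (a : ProxParams P)

/-- The dual step of round `j`. -/
def dualStep (j : ℕ) (s : 𝕏 × 𝕏 × 𝕐 × 𝕏) (l : StrongDual ℝ 𝕐) : 𝕏 × 𝕏 × 𝕐 × 𝕏 :=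
  (s.1, s.2.1, a.pY j (s.2.2.1, -(a.τ j • l)), s.2.2.2)

/-- The primal point after the primal step of round `j`. -/
def primalPoint (j : ℕ) (s : 𝕏 × 𝕏 × 𝕐 × 𝕏) (l : StrongDual ℝ 𝕏) : 𝕏 :=
  -- As a function of `u`, `D(u, x)` is `ωX(u) - ⟨∇ωX(x), u⟩` plus a constant. The start point thus
  -- enters only through a linear term, and one proximal map `pX j` serves all start points.
  a.pX j (s.2.1, a.τ j • (l - (2 * P.γ) • fderiv ℝ (re P.ωX) s.1))

/-- The primal step of round `j`. -/
def primalStep (j : ℕ) (s : 𝕏 × 𝕏 × 𝕐 × 𝕏) (l : StrongDual ℝ 𝕏) : 𝕏 × 𝕏 × 𝕐 × 𝕏 :=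
  (s.1, a.primalPoint j s l, s.2.2.1, s.2.2.2 + a.w j • a.primalPoint j s l)

/-- The point at which the oracles are called. -/
def point (s : 𝕏 × 𝕏 × 𝕐 × 𝕏) : 𝕏 × 𝕐 := (clamp P.X a.x₁ s.2.1, clamp P.Y a.y₀ s.2.2.1)

variable [FiniteDimensional ℝ 𝕏] [BorelSpace 𝕏] [FiniteDimensional ℝ 𝕐] [BorelSpace 𝕐]

theorem measurable_point (hP : P.Admissible) : Measurable a.point :=
  ((measurable_clamp hP.X_closed.measurableSet _).comp (by fun_prop)).prodMk
    ((measurable_clamp hP.Y_closed.measurableSet _).comp (by fun_prop))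

theorem measurable_dualStep (j : ℕ) :
    Measurable fun p : (𝕏 × 𝕏 × 𝕐 × 𝕏) × StrongDual ℝ 𝕐 => a.dualStep j p.1 p.2 := by
  have h : Measurable fun p : (𝕏 × 𝕏 × 𝕐 × 𝕏) × StrongDual ℝ 𝕐 =>
      a.pY j (p.1.2.2.1, -(a.τ j • p.2)) :=
    (a.pY_continuous j).measurable.comp (by fun_prop)
  unfold dualStep
  fun_prop

theorem measurable_primalPoint (j : ℕ) :
    Measurable fun p : (𝕏 × 𝕏 × 𝕐 × 𝕏) × StrongDual ℝ 𝕏 => a.primalPoint j p.1 p.2 := by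
  have h1 : Measurable fun p : (𝕏 × 𝕏 × 𝕐 × 𝕏) × StrongDual ℝ 𝕏 => fderiv ℝ (re P.ωX) p.1.1 :=
    (measurable_fderiv ℝ (re P.ωX)).comp (by fun_prop)
  refine (a.pX_continuous j).measurable.comp (Measurable.prodMk (by fun_prop) ?_)
  exact (measurable_snd.sub (h1.const_smul (2 * P.γ))).const_smul (a.τ j)

theorem measurable_primalStep (j : ℕ) :
    Measurable fun p : (𝕏 × 𝕏 × 𝕐 × 𝕏) × StrongDual ℝ 𝕏 => a.primalStep j p.1 p.2 := by
  have h := a.measurable_primalPoint j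
  unfold primalStep
  fun_prop

/-- Stochastic proximal descent-ascent: even calls are dual, odd calls are primal. The state
consists of the start point, the current pair, and a weighted sum of the primal points. -/
def method (hP : P.Admissible) : Method P where
  State := 𝕏 × 𝕏 × 𝕐 × 𝕏
  calls := a.calls
  init x := (x, x, a.y₀, 0)
  query t s := if t % 2 = 0 then Sum.inr (a.point s) else Sum.inl (a.point s)
  -- The value `0` for an answer of the wrong kind is a default: in a run the parity of `t` fixes
  -- which oracle answers.
  update t s l := if t % 2 = 0 then a.dualStep (t / 2) s (Sum.elim (fun _ => 0) id l)
    else a.primalStep (t / 2) s (Sum.elim id (fun _ => 0) l)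
  -- Membership is required for every conceivable state; on the states reached from a start point in
  -- `S` the clamp is the identity.
  output s := clamp P.X a.x₁ s.2.2.2
  measurable_init := by fun_prop
  measurable_query t := by
    split_ifs
    · exact measurable_inr.comp (a.measurable_point hP)
    · exact measurable_inl.comp (a.measurable_point hP)
  measurable_update t := by
    split_ifs
    · exact (a.measurable_dualStep _).comp (measurable_fst.prodMk
        ((measurable_const.sumElim measurable_id).comp measurable_snd))
    · exact (a.measurable_primalStep _).comp (measurable_fst.prodMk
        ((measurable_id.sumElim measurable_const).comp measurable_snd))
  measurable_output := (measurable_clamp hP.X_closed.measurableSet _).comp (by fun_prop)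
  query_mem t s := by
    have h : a.point s ∈ P.X ×ˢ P.Y := ⟨clamp_mem a.x₁_mem _, clamp_mem a.y₀_mem _⟩
    split_ifs <;> exact h
  output_mem s := by
    rw [hP.Xo_eq]
    exact clamp_mem a.x₁_mem _

variable (hP : P.Admissible) (O) (x : 𝕏) (s : ℕ → Ξ)

/-- The state after `j` rounds. -/
def round (j : ℕ) : 𝕏 × 𝕏 × 𝕐 × 𝕏 := (a.method hP).state O x s (2 * j)

/-- The state in the middle of round `j`. -/
def midRound (j : ℕ) : 𝕏 × 𝕏 × 𝕐 × 𝕏 := (a.method hP).state O x s (2 * j + 1)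

theorem midRound_eq (j : ℕ) : a.midRound O hP x s j = a.dualStep j (a.round O hP x s j)
    (O.dual (a.point (a.round O hP x s j)) (s (2 * j))) := by
  have h1 : 2 * j % 2 = 0 := by omega
  have h2 : 2 * j / 2 = j := by omega
  simp only [midRound, Method.state, round, method, h1, h2, if_true]
  rfl

theorem round_succ (j : ℕ) : a.round O hP x s (j + 1) = a.primalStep j (a.midRound O hP x s j)
    (O.primal (a.point (a.midRound O hP x s j)) (s (2 * j + 1))) := by
  have h1 : ¬ (2 * j + 1) % 2 = 0 := by omega
  have h2 : (2 * j + 1) / 2 = j := by omega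
  have h3 : a.round O hP x s (j + 1) = (a.method hP).update (2 * j + 1) (a.midRound O hP x s j)
      (O.answer ((a.method hP).query (2 * j + 1) (a.midRound O hP x s j)) (s (2 * j + 1))) := rfl
  rw [h3]
  simp only [method, h1, h2, if_false]
  rfl

end ProxParams

/-- The method that makes no calls and returns its start point. -/
def idleMethod [BorelSpace 𝕏] (hP : P.Admissible) (x₁ : 𝕏) (hx₁ : x₁ ∈ P.X) : Method P where
  -- The factor `𝕐` only puts the state into the required universe.
  State := 𝕏 × 𝕐
  calls := 0
  init x := (x, 0)
  query _ _ := Sum.inl (x₁, hP.Y_nonempty.some)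
  update _ s _ := s
  output s := clamp P.X x₁ s.1
  measurable_init := by fun_prop
  measurable_query _ := measurable_const
  measurable_update _ := measurable_fst
  measurable_output := (measurable_clamp hP.X_closed.measurableSet _).comp measurable_fst
  query_mem _ _ := ⟨hx₁, hP.Y_nonempty.some_mem⟩
  output_mem s := by
    rw [hP.Xo_eq]
    exact clamp_mem hx₁ _

end Method

/-! ### Expected accuracy of one run of the method -/

/-- Independent samples with law `μ`. -/
structure IIDSamples {Ω Ξ : Type*} [MeasurableSpace Ω] [MeasurableSpace Ξ] (s : ℕ → Ω → Ξ)
    (μ : Measure Ξ) (ν : Measure Ω) : Prop where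
  measurable : ∀ i, Measurable (s i)
  map_eq : ∀ i, ν.map (s i) = μ
  indep : iIndepFun s ν

/-- The hypothesis on `f`, measurability for every σ-algebra that makes the first `t` samples
measurable, says that `f` is determined by the past. It is used for the σ-algebra generated by those
samples. -/
theorem IIDSamples.indepFun_past {Ω Ξ : Type*} [MeasurableSpace Ω] [MeasurableSpace Ξ]
    {s : ℕ → Ω → Ξ} {μ : Measure Ξ} {ν : Measure Ω} (h : IIDSamples s μ ν) {α : Type*}
    [MeasurableSpace α] {f : Ω → α} (t : ℕ)
    (hf : ∀ _ : MeasurableSpace Ω, (∀ i < t, Measurable (s i)) → Measurable f) :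
    IndepFun f (s t) ν := by
  refine indepFun_of_measurable_iSup h.measurable h.indep (S := Iio t) (T := {t}) (by simp)
    (hf _ fun i hi => measurable_iSup_comap (S := Iio t) hi) ?_
  exact measurable_iSup_comap (S := {t}) rfl

section Run

variable {𝕏 : Type u} [NormedAddCommGroup 𝕏] [NormedSpace ℝ 𝕏] [MeasurableSpace 𝕏]
variable {𝕐 : Type v} [NormedAddCommGroup 𝕐] [NormedSpace ℝ 𝕐] [MeasurableSpace 𝕐]
variable {P : Problem 𝕏 𝕐} {Φ : 𝕏 → 𝕐 → ℝ} {θ : 𝕐 → ℝ}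
variable {H : Type*} [NormedAddCommGroup H] [InnerProductSpace ℝ H]
variable {H' : Type*} [NormedAddCommGroup H'] [InnerProductSpace ℝ H']

namespace ProxParams

/-- The maps of `a` are the proximal maps of the subproblem on `S × Y`, with short steps. -/
structure Valid (a : ProxParams P) (S : Set 𝕏) (θ : 𝕐 → ℝ) (e : 𝕏 →L[ℝ] H) (e' : 𝕐 →L[ℝ] H') :
    Prop where
  subset : S ⊆ P.X
  norm_le : ∀ d, ‖d‖ ≤ ‖e d‖
  norm_le' : ∀ d, ‖d‖ ≤ ‖e' d‖
  pX_mem : ∀ j x l, a.pX j (x, l) ∈ S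
  pX_le : ∀ j x l, ∀ u ∈ S,
    a.τ j * (re P.r (a.pX j (x, l)) + 2 * P.γ * re P.ωX (a.pX j (x, l))) + l (a.pX j (x, l)) +
      1 / 2 * ‖e (a.pX j (x, l) - x)‖ ^ 2 + a.τ j * (P.γ * ‖u - a.pX j (x, l)‖ ^ 2) +
      1 / 2 * ‖e (u - a.pX j (x, l))‖ ^ 2 ≤
    a.τ j * (re P.r u + 2 * P.γ * re P.ωX u) + l u + 1 / 2 * ‖e (u - x)‖ ^ 2
  pY_mem : ∀ j y l, a.pY j (y, l) ∈ P.Y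
  pY_le : ∀ j y l, ∀ v ∈ P.Y,
    a.τ j * θ (a.pY j (y, l)) + l (a.pY j (y, l)) + 1 / 2 * ‖e' (a.pY j (y, l) - y)‖ ^ 2 +
      1 / 2 * ‖e' (v - a.pY j (y, l))‖ ^ 2 ≤ a.τ j * θ v + l v + 1 / 2 * ‖e' (v - y)‖ ^ 2
  τ_pos : ∀ j, 0 < a.τ j
  τ_xx : ∀ j, a.τ j * P.Lxx ≤ 1 / 4
  τ_yy : ∀ j, a.τ j * P.Lyy ≤ 1 / 4

variable {a : ProxParams P} {S : Set 𝕏} {e : 𝕏 →L[ℝ] H} {e' : 𝕐 →L[ℝ] H'}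
variable [FiniteDimensional ℝ 𝕏] [BorelSpace 𝕏] [FiniteDimensional ℝ 𝕐] [BorelSpace 𝕐]
variable {Ξ : Type w} [MeasurableSpace Ξ] {O : Oracle 𝕏 𝕐 Ξ} {hP : P.Admissible} {x : 𝕏}

section Deterministic

variable (a O hP x) (s : ℕ → Ξ)

/-- The primal iterate after `j` rounds. -/
def xs (j : ℕ) : 𝕏 := (a.round O hP x s j).2.1

/-- The dual iterate after `j` rounds. -/
def ys (j : ℕ) : 𝕐 := (a.round O hP x s j).2.2.1

variable (Φ)

/-- The noise of the dual oracle in round `j`. -/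
def dualNoise (j : ℕ) : StrongDual ℝ 𝕐 :=
  O.dual (a.xs O hP x s j, a.ys O hP x s j) (s (2 * j)) -
    gradY Φ (a.xs O hP x s j) (a.ys O hP x s j)

/-- The noise of the primal oracle in round `j`. -/
def primalNoise (j : ℕ) : StrongDual ℝ 𝕏 :=
  O.primal (a.xs O hP x s j, a.ys O hP x s (j + 1)) (s (2 * j + 1)) -
    gradX Φ (a.xs O hP x s j) (a.ys O hP x s (j + 1))

variable {Φ a O hP x s}

theorem round_fst (j : ℕ) : (a.round O hP x s j).1 = x := by
  induction j with
  | zero => rfl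
  | succ j ih =>
    rw [round_succ, midRound_eq]
    exact ih

theorem xs_mem (ha : a.Valid S θ e e') (hx : x ∈ S) (j : ℕ) : a.xs O hP x s j ∈ S := by
  cases j with
  | zero => exact hx
  | succ j =>
    unfold xs
    rw [round_succ]
    exact ha.pX_mem _ _ _

theorem ys_mem (ha : a.Valid S θ e e') (j : ℕ) : a.ys O hP x s j ∈ P.Y := by
  cases j with
  | zero => exact a.y₀_mem
  | succ j =>
    unfold ys
    rw [round_succ, midRound_eq]
    exact ha.pY_mem _ _ _

theorem midRound_xs (j : ℕ) : (a.midRound O hP x s j).2.1 = a.xs O hP x s j := by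
  rw [midRound_eq]; rfl

theorem midRound_ys (j : ℕ) : (a.midRound O hP x s j).2.2.1 = a.ys O hP x s (j + 1) := by
  unfold ys; rw [round_succ]; rfl

theorem midRound_fst (j : ℕ) : (a.midRound O hP x s j).1 = x := by
  rw [midRound_eq]; exact round_fst j

theorem point_round (ha : a.Valid S θ e e') (hx : x ∈ S) (j : ℕ) :
    a.point (a.round O hP x s j) = (a.xs O hP x s j, a.ys O hP x s j) :=
  Prod.ext (clamp_of_mem (ha.subset (xs_mem ha hx j))) (clamp_of_mem (ys_mem ha j))

theorem point_midRound (ha : a.Valid S θ e e') (hx : x ∈ S) (j : ℕ) :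
    a.point (a.midRound O hP x s j) = (a.xs O hP x s j, a.ys O hP x s (j + 1)) := by
  unfold point
  rw [midRound_xs, midRound_ys]
  exact Prod.ext (clamp_of_mem (ha.subset (xs_mem ha hx j))) (clamp_of_mem (ys_mem ha _))

theorem ys_succ (ha : a.Valid S θ e e') (hx : x ∈ S) (j : ℕ) :
    a.ys O hP x s (j + 1) = a.pY j (a.ys O hP x s j,
      -(a.τ j • O.dual (a.xs O hP x s j, a.ys O hP x s j) (s (2 * j)))) := by
  rw [← midRound_ys, midRound_eq, point_round ha hx]
  rfl

theorem xs_succ (ha : a.Valid S θ e e') (hx : x ∈ S) (j : ℕ) :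
    a.xs O hP x s (j + 1) = a.pX j (a.xs O hP x s j,
      a.τ j • (O.primal (a.xs O hP x s j, a.ys O hP x s (j + 1)) (s (2 * j + 1)) -
        (2 * P.γ) • fderiv ℝ (re P.ωX) x)) := by
  conv_lhs => unfold xs
  rw [round_succ, point_midRound ha hx]
  unfold primalStep primalPoint
  dsimp only
  rw [midRound_xs, midRound_fst]

theorem acc_eq (j : ℕ) : (a.round O hP x s j).2.2.2 =
    ∑ i ∈ Finset.range j, a.w i • a.xs O hP x s (i + 1) := by
  induction j with
  | zero => rfl
  | succ j ih =>
    rw [Finset.sum_range_succ, ← ih]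
    conv_rhs => unfold xs
    rw [round_succ]
    unfold primalStep
    dsimp only
    rw [midRound_eq]
    rfl

theorem dual_prox (ha : a.Valid S θ e e') (hx : x ∈ S) (j : ℕ) {v : 𝕐} (hv : v ∈ P.Y) :
    a.τ j * θ (a.ys O hP x s (j + 1)) - a.τ j *
        O.dual (a.xs O hP x s j, a.ys O hP x s j) (s (2 * j)) (a.ys O hP x s (j + 1)) +
        1 / 2 * ‖e' (a.ys O hP x s (j + 1) - a.ys O hP x s j)‖ ^ 2 +
        1 / 2 * ‖e' (v - a.ys O hP x s (j + 1))‖ ^ 2 ≤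
      a.τ j * θ v - a.τ j * O.dual (a.xs O hP x s j, a.ys O hP x s j) (s (2 * j)) v +
        1 / 2 * ‖e' (v - a.ys O hP x s j)‖ ^ 2 := by
  have h := ha.pY_le j (a.ys O hP x s j)
    (-(a.τ j • O.dual (a.xs O hP x s j, a.ys O hP x s j) (s (2 * j)))) v hv
  rw [← ys_succ ha hx j] at h
  simp only [neg_apply, smul_apply, smul_eq_mul] at h
  linarith

theorem primal_prox (ha : a.Valid S θ e e') (hx : x ∈ S) (j : ℕ) {u : 𝕏} (hu : u ∈ S) :
    a.τ j * P.composite x (a.xs O hP x s (j + 1)) + a.τ j *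
        O.primal (a.xs O hP x s j, a.ys O hP x s (j + 1)) (s (2 * j + 1)) (a.xs O hP x s (j + 1)) +
        1 / 2 * ‖e (a.xs O hP x s (j + 1) - a.xs O hP x s j)‖ ^ 2 +
        a.τ j * (P.γ * ‖u - a.xs O hP x s (j + 1)‖ ^ 2) +
        1 / 2 * ‖e (u - a.xs O hP x s (j + 1))‖ ^ 2 ≤
      a.τ j * P.composite x u + a.τ j *
        O.primal (a.xs O hP x s j, a.ys O hP x s (j + 1)) (s (2 * j + 1)) u +
        1 / 2 * ‖e (u - a.xs O hP x s j)‖ ^ 2 := by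
  have h := ha.pX_le j (a.xs O hP x s j)
    (a.τ j • (O.primal (a.xs O hP x s j, a.ys O hP x s (j + 1)) (s (2 * j + 1)) -
        (2 * P.γ) • fderiv ℝ (re P.ωX) x)) u hu
  rw [← xs_succ ha hx j] at h
  simp only [sub_apply, smul_apply, smul_eq_mul] at h
  unfold Problem.composite bregman
  simp only [map_sub (fderiv ℝ (re P.ωX) x)]
  linarith

end Deterministic

/-! ### Moments of the oracle noise and the contraction phase -/

section Random

variable {Ω : Type*} [mΩ₀ : MeasurableSpace Ω] {μ : Measure Ξ} [IsProbabilityMeasure μ]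
  {ν : Measure Ω} [IsProbabilityMeasure ν] {s : ℕ → Ω → Ξ}

/-- The σ-algebra is left free: the ambient one gives integrability, the one generated by past
samples gives independence from the next sample. -/
theorem measurable_xs_ys (hO : O.Valid P Φ μ) {mΩ : MeasurableSpace Ω} {t j : ℕ} (hj : 2 * j ≤ t)
    (hs : ∀ i < t, Measurable (s i)) :
    Measurable (fun o => a.xs O hP x (fun i => s i o) j) ∧
      Measurable (fun o => a.ys O hP x (fun i => s i o) j) := by
  have h : Measurable fun o => a.round O hP x (fun i => s i o) j :=
    (a.method hP).measurable_state hO.measurable_primal hO.measurable_dual measurable_const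
      fun i hi => hs i (by omega)
  exact ⟨measurable_fst.comp (measurable_snd.comp h),
    measurable_fst.comp (measurable_snd.comp (measurable_snd.comp h))⟩

/-- The new dual point is ready in the middle of round `j`, before sample `2j + 1` is drawn. So the
primal oracle may be called at it with noise that is still fresh. -/
theorem measurable_ys_succ (hO : O.Valid P Φ μ) {mΩ : MeasurableSpace Ω} {t j : ℕ}
    (hj : 2 * j + 1 ≤ t) (hs : ∀ i < t, Measurable (s i)) :
    Measurable (fun o => a.ys O hP x (fun i => s i o) (j + 1)) := by
  have h : Measurable fun o => a.midRound O hP x (fun i => s i o) j :=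
    (a.method hP).measurable_state hO.measurable_primal hO.measurable_dual measurable_const
      fun i hi => hs i (by omega)
  simp only [← midRound_ys]
  exact measurable_fst.comp (measurable_snd.comp (measurable_snd.comp h))

/-- The moments of the noise of the primal oracle. -/
theorem primalNoise_moments (hO : O.Valid P Φ μ) (hs : IIDSamples s μ ν) (ha : a.Valid S θ e e')
    (hSb : Bornology.IsBounded S) (hx : x ∈ S) {u : 𝕏} (hu : u ∈ S) (j : ℕ) :
    (Integrable (fun o => a.primalNoise Φ O hP x (fun i => s i o) j
        (u - a.xs O hP x (fun i => s i o) j)) ν ∧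
      ∫ o, a.primalNoise Φ O hP x (fun i => s i o) j (u - a.xs O hP x (fun i => s i o) j) ∂ν = 0) ∧
    Integrable (fun o => ‖a.primalNoise Φ O hP x (fun i => s i o) j‖ ^ 2) ν ∧
      ∫ o, ‖a.primalNoise Φ O hP x (fun i => s i o) j‖ ^ 2 ∂ν ≤ P.σx ^ 2 := by
  obtain ⟨D, -, hD⟩ := exists_bound_norm_sub hSb
  have hmeas : ∀ mΩ : MeasurableSpace Ω, (∀ i < 2 * j + 1, Measurable (s i)) →
      Measurable fun o => ((a.xs O hP x (fun i => s i o) j, a.ys O hP x (fun i => s i o) (j + 1)),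
        u - a.xs O hP x (fun i => s i o) j) := fun _ h =>
    ((measurable_xs_ys hO (t := 2 * j + 1) (by omega) h).1.prodMk
      (measurable_ys_succ hO le_rfl h)).prodMk
      (measurable_const.sub (measurable_xs_ys hO (t := 2 * j + 1) (by omega) h).1)
  have hm := hmeas mΩ₀ fun i _ => hs.measurable i
  exact noise_moments (hs.measurable (2 * j + 1)) (hs.map_eq _) (G := O.primal)
    (m := fun z => gradX Φ z.1 z.2) (A := P.X ×ˢ P.Y) hO.measurable_primal
    (fun z hz => hO.integrable_primal z.1 hz.1 z.2 hz.2)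
    (fun z hz => hO.mean_primal z.1 hz.1 z.2 hz.2)
    (fun z hz => hO.variance_primal z.1 hz.1 z.2 hz.2) (measurable_fst.comp hm)
    (measurable_snd.comp hm) (fun o => ⟨ha.subset (xs_mem ha hx j), ys_mem ha (j + 1)⟩)
    (C := D) (fun o => hD _ hu _ (xs_mem ha hx j)) (hs.indepFun_past _ hmeas)

/-- The moments of the noise of the dual oracle, against a past dual point `g`. -/
theorem dualNoise_moments (hO : O.Valid P Φ μ) (hs : IIDSamples s μ ν) (ha : a.Valid S θ e e')
    (hPY : Bornology.IsBounded P.Y) (hx : x ∈ S) (j : ℕ) {g : Ω → 𝕐} (hgY : ∀ o, g o ∈ P.Y)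
    (hg : ∀ _ : MeasurableSpace Ω, (∀ i < 2 * j, Measurable (s i)) → Measurable g) :
    (Integrable (fun o => a.dualNoise Φ O hP x (fun i => s i o) j
        (a.ys O hP x (fun i => s i o) j - g o)) ν ∧
      ∫ o, a.dualNoise Φ O hP x (fun i => s i o) j (a.ys O hP x (fun i => s i o) j - g o) ∂ν = 0) ∧
    Integrable (fun o => ‖a.dualNoise Φ O hP x (fun i => s i o) j‖ ^ 2) ν ∧
      ∫ o, ‖a.dualNoise Φ O hP x (fun i => s i o) j‖ ^ 2 ∂ν ≤ P.σy ^ 2 := by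
  obtain ⟨D, -, hD⟩ := exists_bound_norm_sub hPY
  have hmeas : ∀ mΩ : MeasurableSpace Ω, (∀ i < 2 * j, Measurable (s i)) →
      Measurable fun o => ((a.xs O hP x (fun i => s i o) j, a.ys O hP x (fun i => s i o) j),
        a.ys O hP x (fun i => s i o) j - g o) := fun _ h =>
    ((measurable_xs_ys hO le_rfl h).1.prodMk (measurable_xs_ys hO le_rfl h).2).prodMk
      ((measurable_xs_ys hO le_rfl h).2.sub (hg _ h))
  have hm := hmeas mΩ₀ fun i _ => hs.measurable i
  exact noise_moments (hs.measurable (2 * j)) (hs.map_eq _) (G := O.dual)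
    (m := fun z => gradY Φ z.1 z.2) (A := P.X ×ˢ P.Y) hO.measurable_dual
    (fun z hz => hO.integrable_dual z.1 hz.1 z.2 hz.2)
    (fun z hz => hO.mean_dual z.1 hz.1 z.2 hz.2)
    (fun z hz => hO.variance_dual z.1 hz.1 z.2 hz.2) (measurable_fst.comp hm)
    (measurable_snd.comp hm) (fun o => ⟨ha.subset (xs_mem ha hx j), ys_mem ha j⟩)
    (C := D) (fun o => hD _ (ys_mem ha j) _ (hgY o)) (hs.indepFun_past _ hmeas)

/-- Expected squared distance after the contraction phase. -/
theorem expected_contraction (hΦ : P.Coupling Φ) (hO : O.Valid P Φ μ) (hs : IIDSamples s μ ν)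
    (ha : a.Valid S θ e e') (hθ : ContinuousOn θ P.Y) (hSc : IsCompact S) (hx : x ∈ S) {u : 𝕏}
    (hu : u ∈ S) (hprox : P.IsProx (P.obj Φ θ) P.lam x u) {D : ℝ}
    (hD : ∀ y ∈ P.Y, ∀ y' ∈ P.Y, ‖y - y'‖ ≤ D) {κ : ℝ} (hκ : ∀ d, ‖e d‖ ≤ κ * ‖d‖) (hκ0 : 0 < κ)
    {T : ℕ} {τ : ℝ} (hτ0 : 0 < τ) (hτ : ∀ j < T, a.τ j = τ) :
    ∫ o, (1 / 2 * ‖e (u - a.xs O hP x (fun i => s i o) T)‖ ^ 2 +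
        τ * P.γ * ‖u - a.xs O hP x (fun i => s i o) T‖ ^ 2) ∂ν ≤
      (1 - τ * P.γ / (κ ^ 2 + 2 * τ * P.γ)) ^ T * ((κ ^ 2 / 2 + τ * P.γ) * ‖u - x‖ ^ 2) +
        (τ * ((P.Lxy * D) ^ 2 / (2 * P.γ)) + 2 * τ ^ 2 * P.σx ^ 2) /
          (τ * P.γ / (κ ^ 2 + 2 * τ * P.γ)) := by
  have hγ := hP.γ_pos
  have hτγ : 0 < τ * P.γ := mul_pos hτ0 hγ
  set ϑ := τ * P.γ / (κ ^ 2 + 2 * τ * P.γ) with hϑ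
  have hden : 0 < κ ^ 2 + 2 * τ * P.γ := by positivity
  have hϑ0 : 0 < ϑ := by positivity
  have hϑ1 : ϑ ≤ 1 := by
    rw [hϑ, div_le_one hden]; nlinarith [sq_nonneg κ]
  have hup : ∀ d : 𝕏, 1 / 2 * ‖e d‖ ^ 2 + τ * P.γ * ‖d‖ ^ 2 ≤ (κ ^ 2 / 2 + τ * P.γ) * ‖d‖ ^ 2 := by
    intro d
    have h1 := pow_le_pow_left₀ (norm_nonneg _) (hκ d) 2
    rw [mul_pow] at h1
    linarith
  -- The two potentials differ by `τγ/2 ‖d‖²`, exactly the fraction `ϑ` of the upper bound `(κ²/2 +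
  -- τγ)‖d‖²` from `hup`; this determines `ϑ`.
  have hcontr : ∀ d : 𝕏, 1 / 2 * ‖e d‖ ^ 2 + τ * P.γ / 2 * ‖d‖ ^ 2 ≤
      (1 - ϑ) * (1 / 2 * ‖e d‖ ^ 2 + τ * P.γ * ‖d‖ ^ 2) := by
    intro d
    have h1 := mul_le_mul_of_nonneg_left (hup d) hϑ0.le
    have h2 : ϑ * ((κ ^ 2 / 2 + τ * P.γ) * ‖d‖ ^ 2) = τ * P.γ / 2 * ‖d‖ ^ 2 := by
      rw [hϑ]; field_simp
    linarith
  have hmom := fun j => primalNoise_moments (hP := hP) hO hs ha hSc.isBounded hx hu j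
  have hxm : ∀ j, Measurable fun o => a.xs O hP x (fun i => s i o) j := fun j =>
    (measurable_xs_ys hO le_rfl fun i _ => hs.measurable i).1
  have hstep : ∀ t < T, ∀ o, 1 / 2 * ‖e (u - a.xs O hP x (fun i => s i o) (t + 1))‖ ^ 2 +
        τ * P.γ * ‖u - a.xs O hP x (fun i => s i o) (t + 1)‖ ^ 2 ≤
      (1 - ϑ) * (1 / 2 * ‖e (u - a.xs O hP x (fun i => s i o) t)‖ ^ 2 +
        τ * P.γ * ‖u - a.xs O hP x (fun i => s i o) t‖ ^ 2) +
      τ * ((P.Lxy * D) ^ 2 / (2 * P.γ)) + (τ * a.primalNoise Φ O hP x (fun i => s i o) t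
        (u - a.xs O hP x (fun i => s i o) t) + 2 * τ ^ 2 *
        ‖a.primalNoise Φ O hP x (fun i => s i o) t‖ ^ 2) := by
    intro t ht o
    have hxt := fun t => ha.subset (xs_mem (O := O) (hP := hP) (s := fun i => s i o) ha hx t)
    have hyt := ys_mem (O := O) (hP := hP) (x := x) (s := fun i => s i o) ha (t + 1)
    have h1 := contraction_step hP hΦ hθ ha.norm_le hD (hxt t) (hxt (t + 1)) hprox hyt (ha.τ_pos t).le (ha.τ_xx t)
      (primal_prox (O := O) (hP := hP) (s := fun i => s i o) ha hx t hu)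
    rw [hτ t ht] at h1
    have h2 := hcontr (u - a.xs O hP x (fun i => s i o) t)
    unfold primalNoise
    linarith
  have key := integral_contraction (ν := ν) (T := T) (q := 1 - ϑ)
    (W := fun t o => 1 / 2 * ‖e (u - a.xs O hP x (fun i => s i o) t)‖ ^ 2 +
        τ * P.γ * ‖u - a.xs O hP x (fun i => s i o) t‖ ^ 2)
    (n := fun t o => τ * a.primalNoise Φ O hP x (fun i => s i o) t
      (u - a.xs O hP x (fun i => s i o) t) + 2 * τ ^ 2 *
        ‖a.primalNoise Φ O hP x (fun i => s i o) t‖ ^ 2)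
    (b := τ * ((P.Lxy * D) ^ 2 / (2 * P.γ))) (c := 2 * τ ^ 2 * P.σx ^ 2)
    (W₀ := (κ ^ 2 / 2 + τ * P.γ) * ‖u - x‖ ^ 2) (by linarith) (by linarith)
    (fun t => ContinuousOn.integrable_comp_of_isCompact (K := S)
      (h := fun z => 1 / 2 * ‖e (u - z)‖ ^ 2 + τ * P.γ * ‖u - z‖ ^ 2) (by fun_prop) hSc (hxm t)
      fun o => xs_mem ha hx t)
    (fun t => ((hmom t).1.1.const_mul _).add ((hmom t).2.1.const_mul _)) (by positivity)
    hstep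
    (fun t => by
      rw [integral_add ((hmom t).1.1.const_mul _) ((hmom t).2.1.const_mul _), integral_const_mul,
        integral_const_mul, (hmom t).1.2, mul_zero, zero_add]
      exact mul_le_mul_of_nonneg_left (hmom t).2.2 (by positivity))
    (by
      have h0 : ∀ o, a.xs O hP x (fun i => s i o) 0 = x := fun o => rfl
      simp only [h0, integral_const, probReal_univ, smul_eq_mul, one_mul]
      exact hup _)
  rw [sub_sub_cancel] at key
  exact key

/-- Dual points that follow the dual noise of the rounds. -/
def ghost (a : ProxParams P) (O : Oracle 𝕏 𝕐 Ξ) (hP : P.Admissible) (x : 𝕏) (s : ℕ → Ξ)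
    (m : 𝕏 × 𝕐 → StrongDual ℝ 𝕐) (pG : 𝕐 × StrongDual ℝ 𝕐 → 𝕐) : ℕ → 𝕐
  | 0 => a.y₀
  | j + 1 => pG (ghost a O hP x s m pG j, a.τ j •
      (O.dual (a.xs O hP x s j, a.ys O hP x s j) (s (2 * j)) - m (a.xs O hP x s j, a.ys O hP x s j)))

theorem measurable_ghost (hO : O.Valid P Φ μ) {m : 𝕏 × 𝕐 → StrongDual ℝ 𝕐} (hm : Measurable m)
    {pG : 𝕐 × StrongDual ℝ 𝕐 → 𝕐} (hpG : Measurable pG) {mΩ : MeasurableSpace Ω} {j : ℕ}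
    (hs : ∀ i < 2 * j, Measurable (s i)) :
    Measurable fun o => a.ghost O hP x (fun i => s i o) m pG j := by
  induction j with
  | zero => exact measurable_const
  | succ j ih =>
    have h1 := ih fun i hi => hs i (by omega)
    have h2 := measurable_xs_ys (a := a) (hP := hP) (x := x) hO (le_refl (2 * j))
      fun i hi => hs i (by omega)
    have h3 := h2.1.prodMk h2.2
    exact hpG.comp (h1.prodMk (((hO.measurable_dual.comp (h3.prodMk (hs (2 * j) (by omega)))).sub
      (hm.comp h3)).const_smul (a.τ j)))

end Random

end ProxParams

end Run

/-! ### The averaging phase -/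

section Run

variable {𝕏 : Type u} [NormedAddCommGroup 𝕏] [NormedSpace ℝ 𝕏] [MeasurableSpace 𝕏]
variable {𝕐 : Type v} [NormedAddCommGroup 𝕐] [NormedSpace ℝ 𝕐] [MeasurableSpace 𝕐]
variable {P : Problem 𝕏 𝕐} {Φ : 𝕏 → 𝕐 → ℝ} {θ : 𝕐 → ℝ}
variable {H : Type*} [NormedAddCommGroup H] [InnerProductSpace ℝ H]
variable {H' : Type*} [NormedAddCommGroup H'] [InnerProductSpace ℝ H']

namespace ProxParams

variable {a : ProxParams P} {S : Set 𝕏} {e : 𝕏 →L[ℝ] H} {e' : 𝕐 →L[ℝ] H'}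
variable [FiniteDimensional ℝ 𝕏] [BorelSpace 𝕏] [FiniteDimensional ℝ 𝕐] [BorelSpace 𝕐]
variable {Ξ : Type w} [MeasurableSpace Ξ] {O : Oracle 𝕏 𝕐 Ξ} {hP : P.Admissible} {x : 𝕏}

/-- The weights vanish during the `T` contraction rounds, so the accumulator holds the mean of the
last `N` primal points, and convexity keeps it in `S`. -/
theorem result_eq {T N : ℕ} (hN : 0 < N) (ha : a.Valid S θ e e') (hx : x ∈ S)
    (hS : Convex ℝ S) (hw : ∀ j, a.w j = if j < T then 0 else (N : ℝ)⁻¹)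
    (hcalls : a.calls = 2 * (T + N)) (s : ℕ → Ξ) :
    (a.method hP).result O x s =
      ∑ t ∈ Finset.range N, (N : ℝ)⁻¹ • a.xs O hP x s (T + t + 1) ∧
    (a.method hP).result O x s ∈ S := by
  have h1 : (a.method hP).result O x s = clamp P.X a.x₁ (a.round O hP x s (T + N)).2.2.2 := by
    have h2 : (a.method hP).calls = 2 * (T + N) := hcalls
    unfold Method.result
    rw [h2]
    rfl
  have h3 : (a.round O hP x s (T + N)).2.2.2 =
      ∑ t ∈ Finset.range N, (N : ℝ)⁻¹ • a.xs O hP x s (T + t + 1) := by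
    rw [acc_eq, Finset.sum_range_add, Finset.sum_eq_zero, zero_add]
    · refine Finset.sum_congr rfl fun t _ => ?_
      rw [hw, if_neg (by omega)]
    · intro j hj
      rw [hw, if_pos (Finset.mem_range.1 hj), zero_smul]
  have hN' : (N : ℝ) ≠ 0 := by exact_mod_cast hN.ne'
  have h4 : (a.round O hP x s (T + N)).2.2.2 ∈ S := by
    rw [h3]
    exact hS.sum_mem (fun _ _ => by positivity) (by simp [hN']) fun t _ => xs_mem ha hx _
  rw [h1, clamp_of_mem (ha.subset h4)]
  exact ⟨h3, h4⟩

/-- The expected gap after the averaging phase. -/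
theorem expected_gap {Ω : Type*} [mΩ₀ : MeasurableSpace Ω] {μ : Measure Ξ} [IsProbabilityMeasure μ]
    {ν : Measure Ω} [IsProbabilityMeasure ν] {s : ℕ → Ω → Ξ}
    (hΦ : P.Coupling Φ) (hO : O.Valid P Φ μ) (hs : IIDSamples s μ ν)
    (ha : a.Valid S θ e e') (hθ : ContinuousOn θ P.Y) (hθc : ConvexOn ℝ P.Y θ)
    (hSc : IsCompact S) (hS : Convex ℝ S) (hx : x ∈ S) {u : 𝕏}
    (hu : u ∈ S) {D : ℝ}
    (hD : ∀ y ∈ P.Y, ∀ y' ∈ P.Y, ‖y - y'‖ ≤ D) {κ : ℝ} (hκ : ∀ d, ‖e' d‖ ≤ κ * ‖d‖)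
    {T N : ℕ} (hN : 0 < N) (hw : ∀ j, a.w j = if j < T then 0 else (N : ℝ)⁻¹)
    (hcalls : a.calls = 2 * (T + N)) {τ : ℝ} (hτ0 : 0 < τ) (hτ : ∀ j, T ≤ j → a.τ j = τ) :
    Integrable (fun o => P.proxObj (P.obj Φ θ) P.lam ((a.method hP).result O x fun i => s i o) x) ν ∧
    τ * N * (∫ o, P.proxObj (P.obj Φ θ) P.lam ((a.method hP).result O x fun i => s i o) x ∂ν -
        P.proxObj (P.obj Φ θ) P.lam u x) ≤
      ∫ o, (1 / 2 * ‖e (u - a.xs O hP x (fun i => s i o) T)‖ ^ 2 +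
        τ * P.γ / 2 * ‖u - a.xs O hP x (fun i => s i o) T‖ ^ 2) ∂ν + (κ * D) ^ 2 +
        N * (τ ^ 2 * (3 / 2 * P.σy ^ 2 + 2 * P.σx ^ 2 + 2 * (P.Lxy * D) ^ 2)) := by
  have hγ := hP.γ_pos
  -- The ghost update is a proximal step with zero penalty, that is, a projected step along the
  -- noise.
  obtain ⟨pG, hpGc, hpG⟩ := (ModulusConvexOn.of_convexOn
    (convexOn_const (0 : ℝ) hP.Y_convex)).exists_prox hP.isCompact_Y hP.Y_nonempty
    continuousOn_const (fun _ => le_rfl) e' ha.norm_le'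
  -- The ghost sequence uses the mean of the dual oracle, which is measurable everywhere and equals
  -- `∇_y Φ` on `X × Y`.
  set m : 𝕏 × 𝕐 → StrongDual ℝ 𝕐 := fun z => ∫ t, O.dual z t ∂μ with hm
  have hmm : Measurable m := hO.measurable_dual.stronglyMeasurable.integral_prod_right.measurable
  set g : ℕ → Ω → 𝕐 := fun j o => a.ghost O hP x (fun i => s i o) m pG j with hg
  have hgY : ∀ j o, g j o ∈ P.Y := by
    intro j o
    cases j with
    | zero => exact a.y₀_mem
    | succ j => exact (hpG _ _).1
  have hxX : ∀ j o, a.xs O hP x (fun i => s i o) j ∈ P.X := fun j o => ha.subset (xs_mem ha hx j)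
  have hyY : ∀ j o, a.ys O hP x (fun i => s i o) j ∈ P.Y := fun j o => ys_mem ha j
  have hgs : ∀ j o, g (j + 1) o = pG (g j o, a.τ j • a.dualNoise Φ O hP x (fun i => s i o) j) := by
    intro j o
    have : m (a.xs O hP x (fun i => s i o) j, a.ys O hP x (fun i => s i o) j) =
        gradY Φ (a.xs O hP x (fun i => s i o) j) (a.ys O hP x (fun i => s i o) j) :=
      hO.mean_dual _ (hxX j o) _ (hyY j o)
    simp only [hg, ghost, this]
    rfl
  have hmx := fun j => primalNoise_moments (hP := hP) hO hs ha hSc.isBounded hx hu j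
  have hmy := fun j => dualNoise_moments (hP := hP) hO hs ha hP.Y_bounded hx j (g := g j)
    (hgY j) fun _ h => measurable_ghost hO hmm hpGc.measurable h
  have hxm : ∀ j, Measurable fun o => a.xs O hP x (fun i => s i o) j := fun j =>
    (measurable_xs_ys hO le_rfl fun i _ => hs.measurable i).1
  set n : ℕ → Ω → ℝ := fun j o => τ * a.primalNoise Φ O hP x (fun i => s i o) j
      (u - a.xs O hP x (fun i => s i o) j) + τ * a.dualNoise Φ O hP x (fun i => s i o) j
      (a.ys O hP x (fun i => s i o) j - g j o) + τ ^ 2 *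
        (3 / 2 * ‖a.dualNoise Φ O hP x (fun i => s i o) j‖ ^ 2 +
          2 * ‖a.primalNoise Φ O hP x (fun i => s i o) j‖ ^ 2 + 2 * (P.Lxy * D) ^ 2) with hn
  have hn1 : ∀ j, Integrable (fun o => τ * a.primalNoise Φ O hP x (fun i => s i o) j
      (u - a.xs O hP x (fun i => s i o) j)) ν := fun j => (hmx j).1.1.const_mul _
  have hn2 : ∀ j, Integrable (fun o => τ * a.dualNoise Φ O hP x (fun i => s i o) j
      (a.ys O hP x (fun i => s i o) j - g j o)) ν := fun j => (hmy j).1.1.const_mul _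
  have hn12 : ∀ j, Integrable (fun o => τ * a.primalNoise Φ O hP x (fun i => s i o) j
      (u - a.xs O hP x (fun i => s i o) j) + τ * a.dualNoise Φ O hP x (fun i => s i o) j
      (a.ys O hP x (fun i => s i o) j - g j o)) ν := fun j => (hn1 j).add (hn2 j)
  have hn3 : ∀ j, Integrable (fun o =>
      3 / 2 * ‖a.dualNoise Φ O hP x (fun i => s i o) j‖ ^ 2 +
          2 * ‖a.primalNoise Φ O hP x (fun i => s i o) j‖ ^ 2) ν := fun j =>
    ((hmy j).2.1.const_mul _).add ((hmx j).2.1.const_mul _)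
  have hn4 : ∀ j, Integrable (fun o =>
      3 / 2 * ‖a.dualNoise Φ O hP x (fun i => s i o) j‖ ^ 2 +
          2 * ‖a.primalNoise Φ O hP x (fun i => s i o) j‖ ^ 2 + 2 * (P.Lxy * D) ^ 2) ν := fun j =>
    (hn3 j).add (integrable_const _)
  have hnint : ∀ j, Integrable (n j) ν := fun j =>
    (hn12 j).add ((hn4 j).const_mul _)
  have hnle : ∀ j, ∫ o, n j o ∂ν ≤
      τ ^ 2 * (3 / 2 * P.σy ^ 2 + 2 * P.σx ^ 2 + 2 * (P.Lxy * D) ^ 2) := by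
    intro j
    rw [hn]
    dsimp only
    rw [integral_add (hn12 j) ((hn4 j).const_mul _), integral_add (hn1 j) (hn2 j),
      integral_const_mul, integral_const_mul, integral_const_mul, (hmx j).1.2, (hmy j).1.2,
      integral_add (hn3 j) (integrable_const _),
      integral_add ((hmy j).2.1.const_mul _) ((hmx j).2.1.const_mul _), integral_const_mul,
      integral_const_mul, integral_const, probReal_univ, mul_zero, zero_add, zero_add, one_smul]
    refine mul_le_mul_of_nonneg_left ?_ (sq_nonneg τ)
    linarith [(hmx j).2.2, (hmy j).2.2]
  have hres := fun o => result_eq (O := O) (hP := hP) hN ha hx hS hw hcalls fun i => s i o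
  have hRm : Measurable fun o => (a.method hP).result O x fun i => s i o :=
    (a.method hP).measurable_result hO.measurable_primal hO.measurable_dual measurable_const
      hs.measurable
  have hcont : ContinuousOn (fun z => P.proxObj (P.obj Φ θ) P.lam z x) S :=
    (hΦ.continuousOn_proxObj hP hθ).comp (f := fun z => (z, x)) (by fun_prop) fun z hz =>
      ⟨ha.subset hz, ha.subset hx⟩
  have hRint := hcont.integrable_comp_of_isCompact (ν := ν) hSc hRm fun o => (hres o).2
  refine ⟨hRint, ?_⟩
  have hWint : Integrable (fun o => 1 / 2 * ‖e (u - a.xs O hP x (fun i => s i o) T)‖ ^ 2 +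
        τ * P.γ / 2 * ‖u - a.xs O hP x (fun i => s i o) T‖ ^ 2) ν :=
    ContinuousOn.integrable_comp_of_isCompact (K := S)
      (h := fun z => 1 / 2 * ‖e (u - z)‖ ^ 2 + τ * P.γ / 2 * ‖u - z‖ ^ 2) (by fun_prop) hSc (hxm T)
      fun o => xs_mem ha hx T
  -- The sign of `κ` is not assumed; two distinct points force `κ ≥ 0`.
  have hdist : ∀ v ∈ P.Y, ∀ w ∈ P.Y, ‖e' (v - w)‖ ^ 2 ≤ (κ * D) ^ 2 := by
    intro v hv w hw'
    have hκ0 : 0 ≤ κ * ‖v - w‖ := (norm_nonneg _).trans (hκ (v - w))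
    rcases (norm_nonneg (v - w)).eq_or_lt with h0 | h0
    · have : v - w = 0 := norm_eq_zero.1 h0.symm
      rw [this]; simp; positivity
    · have hκ1 : 0 ≤ κ := nonneg_of_mul_nonneg_left hκ0 h0
      exact pow_le_pow_left₀ (norm_nonneg _)
        ((hκ _).trans (mul_le_mul_of_nonneg_left (hD v hv w hw') hκ1)) 2
  have hpath : ∀ o, τ * N * (P.proxObj (P.obj Φ θ) P.lam
      ((a.method hP).result O x fun i => s i o) x - P.proxObj (P.obj Φ θ) P.lam u x) ≤
      (1 / 2 * ‖e (u - a.xs O hP x (fun i => s i o) T)‖ ^ 2 +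
        τ * P.γ / 2 * ‖u - a.xs O hP x (fun i => s i o) T‖ ^ 2 + (κ * D) ^ 2) +
      ∑ t ∈ Finset.range N, n (T + t) o := by
    intro o
    rw [(hres o).1]
    refine average_gap hP hΦ hθ hθc hN (ha.subset hu) (fun t => hxX (T + t + 1) o)
      (y := fun t => a.ys O hP x (fun i => s i o) (T + t + 1)) (fun t => hyY _ o) hτ0
      (V := fun v t => 1 / 2 * ‖e (u - a.xs O hP x (fun i => s i o) (T + t))‖ ^ 2 +
        τ * P.γ / 2 * ‖u - a.xs O hP x (fun i => s i o) (T + t)‖ ^ 2 +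
        1 / 2 * ‖e' (v - a.ys O hP x (fun i => s i o) (T + t))‖ ^ 2 +
        1 / 2 * ‖e' (v - g (T + t) o)‖ ^ 2) (fun v _ t => by positivity) (fun v hv => ?_)
      fun v hv t _ => ?_
    · have h1 := hdist v hv _ (hyY T o)
      have h2 := hdist v hv _ (hgY T o)
      simp only [add_zero]
      linarith
    · have hτt := hτ (T + t) (by omega)
      have k1 := dual_prox (O := O) (hP := hP) (s := fun i => s i o) ha hx (T + t) hv
      have k2 := primal_prox (O := O) (hP := hP) (s := fun i => s i o) ha hx (T + t) hu
      have k3 := (hpG (g (T + t) o)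
        (a.τ (T + t) • a.dualNoise Φ O hP x (fun i => s i o) (T + t))).2 v hv
      rw [← hgs, hτt] at k3
      rw [hτt] at k1 k2
      simp only [smul_apply, smul_eq_mul, zero_add, add_zero] at k3
      have hxx := ha.τ_xx (T + t)
      have hyy := ha.τ_yy (T + t)
      rw [hτt] at hxx hyy
      exact gap_step hP hΦ ha.norm_le ha.norm_le' hD (hxX _ o) (hxX (T + t + 1) o) (ha.subset hu)
        (hyY _ o) (hyY (T + t + 1) o) hv hτ0.le hxx hyy k1 k2 k3
  have hI := integral_mono ((hRint.sub (integrable_const _)).const_mul (τ * N))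
    ((hWint.add (integrable_const ((κ * D) ^ 2))).add
      (integrable_finsetSum (Finset.range N) fun t _ => hnint (T + t))) hpath
  simp only [Pi.add_apply, Pi.sub_apply] at hI
  rw [integral_const_mul, integral_sub hRint (integrable_const _), integral_const, probReal_univ,
    one_smul, integral_add (f := fun o => 1 / 2 * ‖e (u - a.xs O hP x (fun i => s i o) T)‖ ^ 2 +
        τ * P.γ / 2 * ‖u - a.xs O hP x (fun i => s i o) T‖ ^ 2 + (κ * D) ^ 2)
      (hWint.add (integrable_const ((κ * D) ^ 2)))
      (integrable_finsetSum (Finset.range N) fun t _ => hnint (T + t)),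
    integral_add hWint (integrable_const _), integral_const, probReal_univ, one_smul,
    integral_finsetSum _ fun t _ => hnint (T + t)] at hI
  refine hI.trans (add_le_add le_rfl ?_)
  refine (Finset.sum_le_sum fun t _ => hnle (T + t)).trans (le_of_eq ?_)
  rw [Finset.sum_const, Finset.card_range, nsmul_eq_mul]

end ProxParams

end Run

/-! ### Choice of the parameters -/

section Parameters

variable {𝕏 : Type u} [NormedAddCommGroup 𝕏] [NormedSpace ℝ 𝕏]
variable {𝕐 : Type v} [NormedAddCommGroup 𝕐] [NormedSpace ℝ 𝕐]
variable {P : Problem 𝕏 𝕐} {Φ : 𝕏 → 𝕐 → ℝ} {θ : 𝕐 → ℝ}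

/-- A bound for the distance of the `k`-th iterate to the starting point. -/
def Problem.radius (P : Problem 𝕏 𝕐) (Δ : ℝ) (k : ℕ) : ℝ := (8 * P.β) ^ k * (2 * √(Δ / P.γ))

namespace Problem.Admissible

theorem radius_nonneg (hP : P.Admissible) (Δ : ℝ) (k : ℕ) : 0 ≤ P.radius Δ k := by
  have := hP.β_pos
  unfold Problem.radius
  positivity

theorem radius_le_succ (hP : P.Admissible) (Δ : ℝ) (k : ℕ) :
    P.radius Δ k ≤ P.radius Δ (k + 1) := by
  have h1 := hP.one_le_β
  have h2 := hP.radius_nonneg Δ k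
  have h3 : P.radius Δ (k + 1) = 8 * P.β * P.radius Δ k := by
    unfold Problem.radius; rw [pow_succ]; ring
  rw [h3]
  nlinarith

theorem eta_pos (hP : P.Admissible) {ε : ℝ} (hε : 0 < ε) : 0 < P.eta ε := by
  have h1 := hP.lam_pos
  have h2 := hP.β_pos
  unfold Problem.eta
  positivity

end Problem.Admissible

variable [FiniteDimensional ℝ 𝕐]

theorem Problem.Coupling.bddBelow_obj_penalty (hP : P.Admissible) (hΦ : P.Coupling Φ) {η : ℝ}
    (hη : 0 ≤ η) (hbdd : BddBelow (P.q Φ '' P.X)) :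
    BddBelow (P.obj Φ (P.penalty (P.rho η)) '' P.X) := by
  obtain ⟨c, hc⟩ := hbdd
  refine ⟨c - η / 4, ?_⟩
  rintro _ ⟨x, hx, rfl⟩
  have h1 := neg_le_of_abs_le (hΦ.abs_qSm_sub_q_le hP hη hx)
  have h2 : c ≤ P.q Φ x := hc (mem_image_of_mem _ hx)
  have h3 : P.q Φ x = P.obj Φ (re P.g) x := rfl
  linarith

/-- The smoothed proximal point stays in the next ball. -/
theorem Problem.Coupling.isProx_mem_ball (hP : P.Admissible) (hΦ : P.Coupling Φ) {η Δ : ℝ}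
    (hη : 0 ≤ η) (hΔ : 0 < Δ) (hηΔ : η ≤ 2 * Δ) {x₁ x u : 𝕏} (hx₁ : x₁ ∈ P.X) (hx : x ∈ P.X)
    (hbdd : BddBelow (P.q Φ '' P.X)) (hgap : P.q Φ x₁ - sInf (P.q Φ '' P.X) ≤ Δ) {k : ℕ}
    (hxk : ‖x - x₁‖ ≤ P.radius Δ k)
    (hu : P.IsProx (P.obj Φ (P.penalty (P.rho η))) P.lam x u) :
    ‖u - x₁‖ ≤ P.radius Δ (k + 1) := by
  have hγ := hP.γ_pos
  have hβ := hP.one_le_β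
  have h1 := hΦ.isProx_growth hP (hP.continuousOn_penalty _) hu hx₁
  simp only [Problem.proxObj, P.inv_lam] at h1
  have h2 := le_of_abs_le (hΦ.abs_qSm_sub_q_le hP hη hx₁)
  have h3 := neg_le_of_abs_le (hΦ.abs_qSm_sub_q_le hP hη hu.1)
  have h4 : sInf (P.q Φ '' P.X) ≤ P.obj Φ (re P.g) u := csInf_le hbdd (mem_image_of_mem _ hu.1)
  have h5 : P.q Φ x₁ = P.obj Φ (re P.g) x₁ := rfl
  have h6 := hP.bregman_le hx hx₁
  have h7 := hP.le_bregman hx hu.1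
  have h8 : 0 ≤ 2 * P.γ * bregman P.ωX u x :=
    mul_nonneg (by linarith) ((by positivity : (0 : ℝ) ≤ 1 / 2 * ‖u - x‖ ^ 2).trans h7)
  rw [norm_sub_rev x₁ x] at h6
  rw [norm_sub_rev x₁ u] at h1
  set R := P.radius Δ k with hR
  have hR0 : 0 ≤ R := hP.radius_nonneg Δ k
  have h9 : ‖x - x₁‖ ^ 2 ≤ R ^ 2 := pow_le_pow_left₀ (norm_nonneg _) hxk 2
  have h10 : 2 * P.γ * bregman P.ωX x₁ x ≤ 2 * P.γ * (P.β * R ^ 2) :=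
    mul_le_mul_of_nonneg_left (h6.trans (mul_le_mul_of_nonneg_left h9 hP.β_pos.le)) (by linarith)
  -- Growth at `u`, tested at `x₁`: the initial gap gives `Δ`, the two smoothing errors give `η/2 ≤
  -- Δ`, and the divergence from `x` to `x₁` is at most `βR²`.
  have h11 : P.γ / 2 * ‖u - x₁‖ ^ 2 ≤ 2 * Δ + 2 * P.γ * (P.β * R ^ 2) := by linarith
  have h12 : 4 * (Δ / P.γ) ≤ R ^ 2 := by
    have : R ^ 2 = ((8 * P.β) ^ k) ^ 2 * (4 * (Δ / P.γ)) := by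
      rw [hR, Problem.radius, mul_pow, mul_pow 2, Real.sq_sqrt (by positivity)]; ring
    rw [this]
    have h13 : (1 : ℝ) ≤ (8 * P.β) ^ k := one_le_pow₀ (by linarith)
    exact le_mul_of_one_le_left (by positivity) (by nlinarith)
  have h14 : ‖u - x₁‖ ^ 2 ≤ (8 * P.β * R) ^ 2 := by
    have h15 : ‖u - x₁‖ ^ 2 ≤ 4 * (Δ / P.γ) + 4 * P.β * R ^ 2 := by
      have h16 : P.γ / 2 * (4 * (Δ / P.γ) + 4 * P.β * R ^ 2) =
          2 * Δ + 2 * P.γ * (P.β * R ^ 2) := by field_simp; ring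
      exact le_of_mul_le_mul_left (h11.trans h16.ge) (by positivity)
    nlinarith [mul_nonneg (sub_nonneg.2 hβ) (sq_nonneg R), sq_nonneg (P.β * R),
      mul_nonneg (mul_nonneg hP.β_pos.le (sub_nonneg.2 hβ)) (sq_nonneg R)]
  have h17 : P.radius Δ (k + 1) = 8 * P.β * R := by
    rw [hR, Problem.radius, Problem.radius, pow_succ]; ring
  rw [h17]
  exact le_of_sq_le_sq h14 (by positivity)

end Parameters

/-! ### Methods for one subproblem, with constants independent of the coupling -/

section Existence

variable {𝕏 : Type u} [NormedAddCommGroup 𝕏] [NormedSpace ℝ 𝕏] [FiniteDimensional ℝ 𝕏]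
  [MeasurableSpace 𝕏] [BorelSpace 𝕏]
variable {𝕐 : Type v} [NormedAddCommGroup 𝕐] [NormedSpace ℝ 𝕐] [FiniteDimensional ℝ 𝕐]
  [MeasurableSpace 𝕐] [BorelSpace 𝕐]
variable {P : Problem 𝕏 𝕐}

/-- The proximal problems involve known data only. Restricting the primal one to the compact set `S`
provides minimizers and keeps all iterates in `S`. -/
theorem ProxParams.exists_valid {H : Type*} [NormedAddCommGroup H] [InnerProductSpace ℝ H]
    {H' : Type*} [NormedAddCommGroup H'] [InnerProductSpace ℝ H'] (hP : P.Admissible)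
    {S : Set 𝕏} (hSX : S ⊆ P.X) (hSc : IsCompact S) (hS : Convex ℝ S) {x₁ : 𝕏} (hx₁ : x₁ ∈ S)
    {θ : 𝕐 → ℝ} (hθ : ContinuousOn θ P.Y) (hθc : ConvexOn ℝ P.Y θ)
    {e : 𝕏 →L[ℝ] H} (he : ∀ d, ‖d‖ ≤ ‖e d‖) {e' : 𝕐 →L[ℝ] H'} (he' : ∀ d, ‖d‖ ≤ ‖e' d‖)
    {τ : ℕ → ℝ} (hτ : ∀ j, 0 < τ j) (hxx : ∀ j, τ j * P.Lxx ≤ 1 / 4)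
    (hyy : ∀ j, τ j * P.Lyy ≤ 1 / 4) (w : ℕ → ℝ) (n : ℕ) :
    ∃ a : ProxParams P, a.Valid S θ e e' ∧ a.τ = τ ∧ a.w = w ∧ a.calls = n := by
  have hγ := hP.γ_pos
  have hX : ∀ j, ∃ p : 𝕏 × StrongDual ℝ 𝕏 → 𝕏, Continuous p ∧ ∀ x l, p (x, l) ∈ S ∧ ∀ u ∈ S,
      τ j * (re P.r (p (x, l)) + 2 * P.γ * re P.ωX (p (x, l))) + l (p (x, l)) +
        1 / 2 * ‖e (p (x, l) - x)‖ ^ 2 + τ j * (P.γ * ‖u - p (x, l)‖ ^ 2) +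
        1 / 2 * ‖e (u - p (x, l))‖ ^ 2 ≤
      τ j * (re P.r u + 2 * P.γ * re P.ωX u) + l u + 1 / 2 * ‖e (u - x)‖ ^ 2 := by
    intro j
    have h1 := ((ModulusConvexOn.of_convexOn hP.convexOn_r).add
      ((ModulusConvexOn.of_strongConvexOn hP.dgf_X.strongConvexOn).const_mul
        (by linarith : 0 ≤ 2 * P.γ))).const_mul (hτ j).le
    have h2 : ModulusConvexOn S (fun d => τ j * (P.γ * ‖d‖ ^ 2))
        (fun u => τ j * (re P.r u + 2 * P.γ * re P.ωX u)) :=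
      (h1.mono fun d => le_of_eq (by ring)).mono_set hS hSX
    have hc : ContinuousOn (fun u => τ j * (re P.r u + 2 * P.γ * re P.ωX u)) P.X :=
      continuousOn_const.mul (hP.continuousOn_r.add
        (continuousOn_const.mul hP.dgf_X.continuousOn))
    exact h2.exists_prox hSc ⟨x₁, hx₁⟩ (hc.mono hSX)
      (fun d => mul_nonneg (hτ j).le (by positivity)) e he
  have hY : ∀ j, ∃ p : 𝕐 × StrongDual ℝ 𝕐 → 𝕐, Continuous p ∧ ∀ y l, p (y, l) ∈ P.Y ∧ ∀ v ∈ P.Y,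
      τ j * θ (p (y, l)) + l (p (y, l)) + 1 / 2 * ‖e' (p (y, l) - y)‖ ^ 2 +
        1 / 2 * ‖e' (v - p (y, l))‖ ^ 2 ≤ τ j * θ v + l v + 1 / 2 * ‖e' (v - y)‖ ^ 2 := by
    intro j
    have h1 := (ModulusConvexOn.of_convexOn hθc).const_mul (hτ j).le
    obtain ⟨p, hp1, hp2⟩ := h1.exists_prox hP.isCompact_Y hP.Y_nonempty
      (continuousOn_const.mul hθ) (fun d => by simp) e' he'
    refine ⟨p, hp1, fun y l => ⟨(hp2 y l).1, fun v hv => ?_⟩⟩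
    have := (hp2 y l).2 v hv
    simpa only [mul_zero, add_zero] using this
  choose pX hpXc hpX using hX
  choose pY hpYc hpY using hY
  exact ⟨⟨x₁, hP.Y_nonempty.some, pX, pY, τ, w, n, hSX hx₁, hP.Y_nonempty.some_mem, hpXc, hpYc⟩,
    ⟨hSX, he, he', fun j x l => (hpX j x l).1, fun j x l => (hpX j x l).2,
      fun j y l => (hpY j y l).1, fun j y l => (hpY j y l).2, hτ, hxx, hyy⟩, rfl, rfl, rfl⟩

/-- The accuracy of a run in terms of the step sizes and the numbers of rounds. -/
theorem ProxParams.accuracy {H : Type*} [NormedAddCommGroup H] [InnerProductSpace ℝ H]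
    {H' : Type*} [NormedAddCommGroup H'] [InnerProductSpace ℝ H'] (hP : P.Admissible)
    {x₁ : 𝕏} (hx₁ : x₁ ∈ P.X) {Δ : ℝ} (hΔ : 0 < Δ) {η : ℝ} (hη : 0 < η) (hηΔ : η ≤ 2 * Δ) {k : ℕ}
    {a : ProxParams P} {e : 𝕏 →L[ℝ] H} {e' : 𝕐 →L[ℝ] H'}
    (ha : a.Valid (P.X ∩ Metric.closedBall x₁ (P.radius Δ (k + 1))) (P.penalty (P.rho η)) e e')
    {D : ℝ} (hD : ∀ y ∈ P.Y, ∀ y' ∈ P.Y, ‖y - y'‖ ≤ D) {κ κ' : ℝ} (hκ0 : 0 < κ)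
    (heκ : ∀ d, ‖e d‖ ≤ κ * ‖d‖) (heκ' : ∀ d, ‖e' d‖ ≤ κ' * ‖d‖) {T N : ℕ} (hN : 0 < N)
    (hw : ∀ j, a.w j = if j < T then 0 else (N : ℝ)⁻¹) (hcalls : a.calls = 2 * (T + N))
    {τ₁ τ₂ : ℝ} (hτ₁0 : 0 < τ₁) (hτ₂0 : 0 < τ₂) (hτ₂1 : τ₂ ≤ τ₁)
    (hτ : ∀ j, a.τ j = if j < T then τ₁ else τ₂)
    {Φ : 𝕏 → 𝕐 → ℝ} (hΦ : P.Coupling Φ) (hbdd : BddBelow (P.q Φ '' P.X))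
    (hgap : P.q Φ x₁ - sInf (P.q Φ '' P.X) ≤ Δ) {Ξ : Type w} [MeasurableSpace Ξ] {μ : Measure Ξ}
    [IsProbabilityMeasure μ] {O : Oracle 𝕏 𝕐 Ξ} (hO : O.Valid P Φ μ) {x : 𝕏} (hx : x ∈ P.X)
    (hxk : ‖x - x₁‖ ≤ P.radius Δ k) {Ω : Type w'} [MeasurableSpace Ω] {ν : Measure Ω}
    [IsProbabilityMeasure ν] {s : ℕ → Ω → Ξ} (hs : IIDSamples s μ ν) :
    τ₂ * N * (∫ o, P.proxObj (P.qSm Φ (P.rho η)) P.lam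
        ((a.method hP).result O x fun i => s i o) x ∂ν -
          P.envelope (P.qSm Φ (P.rho η)) P.lam x) ≤
      (1 - τ₁ * P.γ / (κ ^ 2 + 2 * τ₁ * P.γ)) ^ T *
          ((κ ^ 2 / 2 + τ₁ * P.γ) * (2 * P.radius Δ (k + 1)) ^ 2) +
        (τ₁ * ((P.Lxy * D) ^ 2 / (2 * P.γ)) + 2 * τ₁ ^ 2 * P.σx ^ 2) /
          (τ₁ * P.γ / (κ ^ 2 + 2 * τ₁ * P.γ)) + (κ' * D) ^ 2 +
        N * (τ₂ ^ 2 * (3 / 2 * P.σy ^ 2 + 2 * P.σx ^ 2 + 2 * (P.Lxy * D) ^ 2)) := by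
  have hγ := hP.γ_pos
  set S : Set 𝕏 := P.X ∩ Metric.closedBall x₁ (P.radius Δ (k + 1)) with hS
  have hSc : IsCompact S := (isCompact_closedBall _ _).inter_left hP.X_closed
  have hSconv : Convex ℝ S := hP.X_convex.inter (convex_closedBall _ _)
  have hθ := hP.continuousOn_penalty (P.rho η)
  have hθc := hP.convexOn_penalty (hP.rho_nonneg hη.le)
  have hmemS : ∀ z ∈ P.X, ‖z - x₁‖ ≤ P.radius Δ (k + 1) → z ∈ S := fun z hz h =>
    ⟨hz, by rwa [Metric.mem_closedBall, dist_eq_norm]⟩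
  have hxS : x ∈ S := hmemS x hx (hxk.trans (hP.radius_le_succ Δ k))
  obtain ⟨u, hu⟩ := hΦ.exists_isProx hP hθ (hΦ.bddBelow_obj_penalty hP hη.le hbdd) hx
  have huS : u ∈ S := hmemS u hu.1 (hΦ.isProx_mem_ball hP hη.le hΔ hηΔ hx₁ hx hbdd hgap hxk hu)
  have hux : ‖u - x‖ ≤ 2 * P.radius Δ (k + 1) := by
    have h1 := norm_sub_le_norm_sub_add_norm_sub u x₁ x
    rw [norm_sub_rev x₁ x] at h1
    have h2 := hΦ.isProx_mem_ball hP hη.le hΔ hηΔ hx₁ hx hbdd hgap hxk hu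
    linarith [hP.radius_le_succ Δ k]
  have h1 := ProxParams.expected_contraction (hP := hP) hΦ hO hs ha hθ hSc hxS huS hu hD heκ hκ0
    (T := T) hτ₁0 fun j hj => by rw [hτ, if_pos hj]
  obtain ⟨-, h2⟩ := ProxParams.expected_gap (hP := hP) hΦ hO hs ha hθ hθc hSc hSconv hxS huS hD heκ'
    hN hw hcalls hτ₂0 fun j hj => by rw [hτ, if_neg (by omega)]
  have hxT : Measurable fun o => a.xs O hP x (fun i => s i o) T :=
    (ProxParams.measurable_xs_ys hO le_rfl fun i _ => hs.measurable i).1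
  -- The averaging phase starts from a potential that is dominated by the one the contraction phase
  -- controls, because `τ₂ ≤ τ₁`.
  have h6 : ∫ o, (1 / 2 * ‖e (u - a.xs O hP x (fun i => s i o) T)‖ ^ 2 +
        τ₂ * P.γ / 2 * ‖u - a.xs O hP x (fun i => s i o) T‖ ^ 2) ∂ν ≤
      ∫ o, (1 / 2 * ‖e (u - a.xs O hP x (fun i => s i o) T)‖ ^ 2 +
        τ₁ * P.γ * ‖u - a.xs O hP x (fun i => s i o) T‖ ^ 2) ∂ν := by
    refine integral_mono (ContinuousOn.integrable_comp_of_isCompact (K := S)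
      (h := fun z => 1 / 2 * ‖e (u - z)‖ ^ 2 + τ₂ * P.γ / 2 * ‖u - z‖ ^ 2) (by fun_prop) hSc hxT
      fun o => ProxParams.xs_mem ha hxS T) (ContinuousOn.integrable_comp_of_isCompact (K := S)
      (h := fun z => 1 / 2 * ‖e (u - z)‖ ^ 2 + τ₁ * P.γ * ‖u - z‖ ^ 2) (by fun_prop) hSc hxT
      fun o => ProxParams.xs_mem ha hxS T) fun o => ?_
    have h7 : τ₂ * P.γ / 2 ≤ τ₁ * P.γ := by
      have := mul_le_mul_of_nonneg_right hτ₂1 hγ.le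
      have := mul_pos hτ₂0 hγ
      linarith
    have := mul_le_mul_of_nonneg_right h7
      (sq_nonneg ‖u - a.xs O hP x (fun i => s i o) T‖)
    dsimp only
    linarith
  rw [Problem.qSm_eq_obj]
  set G := ∫ o, P.proxObj (P.obj Φ (P.penalty (P.rho η))) P.lam
    ((a.method hP).result O x fun i => s i o) x ∂ν
  have henv : P.proxObj (P.obj Φ (P.penalty (P.rho η))) P.lam u x ≤
      P.envelope (P.obj Φ (P.penalty (P.rho η))) P.lam x := by
    refine le_csInf (hP.X_nonempty.image _) ?_
    rintro _ ⟨z, hz, rfl⟩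
    exact hu.2 hz
  have h7 : τ₂ * N * (G - P.envelope (P.obj Φ (P.penalty (P.rho η))) P.lam x) ≤
      τ₂ * N * (G - P.proxObj (P.obj Φ (P.penalty (P.rho η))) P.lam u x) :=
    mul_le_mul_of_nonneg_left (by linarith) (by positivity)
  have hϑ : τ₁ * P.γ / (κ ^ 2 + 2 * τ₁ * P.γ) ≤ 1 := by
    have := mul_pos hτ₁0 hγ
    rw [div_le_one (by positivity)]; nlinarith [sq_nonneg κ]
  have h8 : (1 - τ₁ * P.γ / (κ ^ 2 + 2 * τ₁ * P.γ)) ^ T *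
      ((κ ^ 2 / 2 + τ₁ * P.γ) * ‖u - x‖ ^ 2) ≤ (1 - τ₁ * P.γ / (κ ^ 2 + 2 * τ₁ * P.γ)) ^ T *
      ((κ ^ 2 / 2 + τ₁ * P.γ) * (2 * P.radius Δ (k + 1)) ^ 2) :=
    mul_le_mul_of_nonneg_left (mul_le_mul_of_nonneg_left
      (pow_le_pow_left₀ (norm_nonneg _) hux 2) (by positivity)) (pow_nonneg (by linarith) _)
  linarith

/-- Methods that solve the subproblems with start points in a given ball to a given accuracy. -/
theorem exists_method (hP : P.Admissible) {x₁ : 𝕏} (hx₁ : x₁ ∈ P.X) {Δ : ℝ} (hΔ : 0 < Δ) :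
    ∃ (m : ℕ) (C : ℝ), 0 ≤ C ∧ ∀ η : ℝ, 0 < η → η ≤ 2 * Δ → ∀ k : ℕ, ∃ A : Method P,
      (A.calls : ℝ) ≤ 2 * (m * (k + 1) + C / η ^ 2) ∧
      ∀ (Φ : 𝕏 → 𝕐 → ℝ), P.Coupling Φ → BddBelow (P.q Φ '' P.X) →
        P.q Φ x₁ - sInf (P.q Φ '' P.X) ≤ Δ →
      ∀ (Ξ : Type w) [MeasurableSpace Ξ] (μ : Measure Ξ) [IsProbabilityMeasure μ]
        (O : Oracle 𝕏 𝕐 Ξ), O.Valid P Φ μ →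
      ∀ x ∈ P.X, ‖x - x₁‖ ≤ P.radius Δ k →
        (∀ s : ℕ → Ξ, ‖A.result O x s - x₁‖ ≤ P.radius Δ (k + 1)) ∧
        ∀ (Ω : Type w') [MeasurableSpace Ω] (ν : Measure Ω) [IsProbabilityMeasure ν]
          (s : ℕ → Ω → Ξ), IIDSamples s μ ν →
          ∫ o, P.proxObj (P.qSm Φ (P.rho η)) P.lam (A.result O x fun i => s i o) x ∂ν ≤
            P.envelope (P.qSm Φ (P.rho η)) P.lam x + η := by
  have hγ := hP.γ_pos
  have hβ := hP.one_le_β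
  have hLxx := hγ.le.trans hP.γ_le
  have hLyy := hP.Lyy_nonneg
  obtain ⟨e, κ, hκ0, he, heκ⟩ := exists_euclidean (E := 𝕏)
  obtain ⟨e', κ', hκ0', he', heκ'⟩ := exists_euclidean (E := 𝕐)
  obtain ⟨D, hD0, hD⟩ := exists_bound_norm_sub hP.Y_bounded
  set τ₁ : ℝ := 1 / (4 * (P.Lxx + P.Lyy + 1)) with hτ₁
  have hτ₁0 : 0 < τ₁ := by positivity
  have hτ₁xx : τ₁ * P.Lxx ≤ 1 / 4 := by
    rw [hτ₁, one_div_mul_eq_div, div_le_div_iff₀ (by positivity) (by norm_num)]; linarith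
  have hτ₁yy : τ₁ * P.Lyy ≤ 1 / 4 := by
    rw [hτ₁, one_div_mul_eq_div, div_le_div_iff₀ (by positivity) (by norm_num)]; linarith
  set ϑ : ℝ := τ₁ * P.γ / (κ ^ 2 + 2 * τ₁ * P.γ) with hϑ
  have hτγ : 0 < τ₁ * P.γ := mul_pos hτ₁0 hγ
  have hϑ0 : 0 < ϑ := by positivity
  have hϑ1 : ϑ ≤ 1 := by
    rw [hϑ, div_le_one (by positivity)]; nlinarith [sq_nonneg κ]
  -- The radius grows by `8β` per outer step, its square by `64β²`; `m` contraction rounds undo one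
  -- such factor.
  obtain ⟨m, hm⟩ := exists_pow_lt_of_lt_one (by positivity : 0 < (64 * P.β ^ 2)⁻¹)
    (by linarith : 1 - ϑ < 1)
  set R₀ : ℝ := 2 * √(Δ / P.γ) with hR₀
  set b : ℝ := τ₁ * ((P.Lxy * D) ^ 2 / (2 * P.γ)) + 2 * τ₁ ^ 2 * P.σx ^ 2 with hb
  -- `B₁` bounds the potential at the start of averaging for all `k`, and `B₂` below bounds the
  -- noise per round. The added `1`s ensure positivity.
  set B₁ : ℝ := (κ ^ 2 / 2 + τ₁ * P.γ) * (4 * R₀ ^ 2) + b / ϑ + (κ' * D) ^ 2 + 1 with hB₁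
  have hB₁0 : 0 < B₁ := by positivity
  set B₂ : ℝ := 3 / 2 * P.σy ^ 2 + 2 * P.σx ^ 2 + 2 * (P.Lxy * D) ^ 2 + 1 with hB₂
  have hB₂0 : 0 < B₂ := by positivity
  -- The first entry gives `τ₂ = cη ≤ τ₁` for `η ≤ 2Δ`, the second `τ₂ B₂ ≤ η/2`.
  set c : ℝ := min (τ₁ / (2 * Δ)) (1 / (2 * B₂)) with hc
  have hc0 : 0 < c := lt_min (by positivity) (by positivity)
  clear_value τ₁ ϑ R₀ b B₁ B₂ c
  refine ⟨m, 2 * B₁ / c + 4 * Δ ^ 2, by positivity, fun η hη hηΔ k => ?_⟩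
  set τ₂ : ℝ := c * η with hτ₂
  have hτ₂0 : 0 < τ₂ := by positivity
  have hτ₂1 : τ₂ ≤ τ₁ := by
    have h1 : c * η ≤ τ₁ / (2 * Δ) * (2 * Δ) :=
      mul_le_mul (hc.trans_le (min_le_left _ _)) hηΔ hη.le (by positivity)
    rwa [div_mul_cancel₀ _ (by positivity)] at h1
  have hτ₂B : τ₂ * B₂ ≤ η / 2 := by
    have h1 : c * (η * B₂) ≤ 1 / (2 * B₂) * (η * B₂) :=
      mul_le_mul_of_nonneg_right (hc.trans_le (min_le_right _ _)) (by positivity)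
    have h2 : 1 / (2 * B₂) * (η * B₂) = η / 2 := by field_simp
    linarith [mul_assoc c η B₂]
  set N : ℕ := ⌈2 * B₁ / (c * η ^ 2)⌉₊ with hN
  have hN0 : 0 < N := Nat.ceil_pos.2 (by positivity)
  have hNR : (0 : ℝ) < N := by exact_mod_cast hN0
  have hNle : (N : ℝ) ≤ (2 * B₁ / c + 4 * Δ ^ 2) / η ^ 2 := by
    have h1 : (N : ℝ) ≤ 2 * B₁ / (c * η ^ 2) + 1 := (Nat.ceil_lt_add_one (by positivity)).le
    -- The unit lost in the ceiling is absorbed using `η ≤ 2Δ`.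
    have h2 : 1 ≤ 4 * Δ ^ 2 / η ^ 2 := by
      rw [one_le_div (by positivity)]
      nlinarith
    have h3 : (2 * B₁ / c + 4 * Δ ^ 2) / η ^ 2 = 2 * B₁ / (c * η ^ 2) + 4 * Δ ^ 2 / η ^ 2 := by
      rw [add_div, div_div]
    linarith
  have hNge : B₁ / (τ₂ * N) ≤ η / 2 := by
    have h1 : 2 * B₁ / (c * η ^ 2) ≤ N := Nat.le_ceil _
    rw [div_le_iff₀ (by positivity)] at h1 ⊢
    have h2 : η / 2 * (τ₂ * N) = N * (c * η ^ 2) / 2 := by rw [hτ₂]; ring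
    rw [h2]
    linarith only [h1]
  set T : ℕ := m * (k + 1) with hT
  set S : Set 𝕏 := P.X ∩ Metric.closedBall x₁ (P.radius Δ (k + 1)) with hS
  have hSX : S ⊆ P.X := inter_subset_left
  have hSc : IsCompact S := (isCompact_closedBall _ _).inter_left hP.X_closed
  have hSconv : Convex ℝ S := hP.X_convex.inter (convex_closedBall _ _)
  have hx₁S : x₁ ∈ S := ⟨hx₁, Metric.mem_closedBall_self (hP.radius_nonneg _ _)⟩
  have hθ := hP.continuousOn_penalty (P.rho η)
  have hθc := hP.convexOn_penalty (hP.rho_nonneg hη.le)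
  obtain ⟨a, ha, haτ, haw, hac⟩ := ProxParams.exists_valid hP hSX hSc hSconv hx₁S hθ hθc he he'
    (τ := fun j => if j < T then τ₁ else τ₂) (fun j => by split_ifs <;> assumption)
    (fun j => by
      split_ifs
      exacts [hτ₁xx, (mul_le_mul_of_nonneg_right hτ₂1 hLxx).trans hτ₁xx])
    (fun j => by
      split_ifs
      exacts [hτ₁yy, (mul_le_mul_of_nonneg_right hτ₂1 hLyy).trans hτ₁yy])
    (fun j => if j < T then 0 else (N : ℝ)⁻¹) (2 * (T + N))
  refine ⟨a.method hP, ?_, ?_⟩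
  · have h1 : (a.method hP).calls = 2 * (T + N) := hac
    rw [h1, hT]
    push_cast
    linarith only [hNle]
  intro Φ hΦ hbdd hgap Ξ _ μ _ O hO x hx hxk
  have hw : ∀ j, a.w j = if j < T then 0 else (N : ℝ)⁻¹ := fun j => by rw [haw]
  constructor
  · intro s
    have hxS : x ∈ S := ⟨hx, by
      rw [Metric.mem_closedBall, dist_eq_norm]; exact hxk.trans (hP.radius_le_succ Δ k)⟩
    have h1 := (ProxParams.result_eq (O := O) (hP := hP) hN0 ha hxS hSconv hw hac s).2.2
    rwa [Metric.mem_closedBall, dist_eq_norm] at h1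
  intro Ω _ ν _ s hs
  have h1 := ProxParams.accuracy hP hx₁ hΔ hη hηΔ ha hD hκ0 heκ heκ' hN0 hw hac hτ₁0 hτ₂0 hτ₂1
    (fun j => by rw [haτ]) hΦ hbdd hgap hO hx hxk hs
  rw [← hϑ, ← hb] at h1
  have h3 : (1 - ϑ) ^ T * ((κ ^ 2 / 2 + τ₁ * P.γ) * (2 * P.radius Δ (k + 1)) ^ 2) ≤
      (κ ^ 2 / 2 + τ₁ * P.γ) * (4 * R₀ ^ 2) := by
    have h4 : (2 * P.radius Δ (k + 1)) ^ 2 = (64 * P.β ^ 2) ^ (k + 1) * (4 * R₀ ^ 2) := by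
      rw [Problem.radius, ← hR₀, show 64 * P.β ^ 2 = (8 * P.β) ^ 2 by ring, ← pow_mul, mul_pow,
        mul_pow, ← pow_mul, mul_comm 2 (k + 1)]
      ring
    -- The contraction over `T = m(k+1)` rounds cancels the growth of the squared radius exactly
    -- where `k` enters.
    have h5 : (1 - ϑ) ^ T * (64 * P.β ^ 2) ^ (k + 1) ≤ 1 := by
      rw [hT, pow_mul, ← mul_pow]
      refine pow_le_one₀ (mul_nonneg (pow_nonneg (by linarith) _) (by positivity)) ?_
      have := mul_le_mul_of_nonneg_right hm.le (by positivity : 0 ≤ 64 * P.β ^ 2)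
      rwa [inv_mul_cancel₀ (by positivity)] at this
    calc (1 - ϑ) ^ T * ((κ ^ 2 / 2 + τ₁ * P.γ) * (2 * P.radius Δ (k + 1)) ^ 2)
        = ((1 - ϑ) ^ T * (64 * P.β ^ 2) ^ (k + 1)) *
            ((κ ^ 2 / 2 + τ₁ * P.γ) * (4 * R₀ ^ 2)) := by rw [h4]; ring
      _ ≤ 1 * ((κ ^ 2 / 2 + τ₁ * P.γ) * (4 * R₀ ^ 2)) :=
          mul_le_mul_of_nonneg_right h5 (by positivity)
      _ = _ := one_mul _
  set G := ∫ o, P.proxObj (P.qSm Φ (P.rho η)) P.lam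
    ((a.method hP).result O x fun i => s i o) x ∂ν
  have h8 : τ₂ * N * (G - P.envelope (P.qSm Φ (P.rho η)) P.lam x) ≤
      τ₂ * N * (B₁ / (τ₂ * N) + τ₂ * B₂) := by
    have h9 : τ₂ * N * (B₁ / (τ₂ * N) + τ₂ * B₂) = B₁ + N * (τ₂ ^ 2 * B₂) := by
      field_simp
    rw [h9]
    have h10 : (N : ℝ) * (τ₂ ^ 2 * B₂) = N * (τ₂ ^ 2 * (3 / 2 * P.σy ^ 2 + 2 * P.σx ^ 2 +
        2 * (P.Lxy * D) ^ 2)) + N * τ₂ ^ 2 := by rw [hB₂]; ring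
    have h11 : (0 : ℝ) ≤ N * τ₂ ^ 2 := by positivity
    rw [h10]
    linarith only [h1, h3, h11, hB₁]
  have h12 := le_of_mul_le_mul_left h8 (by positivity)
  linarith only [h12, hNge, hτ₂B]

end Existence

/-! ### Analysis of the outer iteration -/

section Outer

variable {𝕏 : Type u} [NormedAddCommGroup 𝕏] [NormedSpace ℝ 𝕏] [FiniteDimensional ℝ 𝕏]
variable {𝕐 : Type v} [NormedAddCommGroup 𝕐] [NormedSpace ℝ 𝕐] [FiniteDimensional ℝ 𝕐]
variable {P : Problem 𝕏 𝕐} {Φ : 𝕏 → 𝕐 → ℝ}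

theorem bregman_self {E : Type*} [NormedAddCommGroup E] [NormedSpace ℝ E] (ω : E → EReal) (x : E) :
    bregman ω x x = 0 := by simp [bregman]

namespace Problem.Coupling

theorem isProx_prox (hP : P.Admissible) (hΦ : P.Coupling Φ) (hbdd : BddBelow (P.q Φ '' P.X))
    {x : 𝕏} (hx : x ∈ P.X) : P.IsProx (P.q Φ) P.lam x (P.prox (P.q Φ) x P.lam) :=
  Classical.epsilon_spec (hΦ.exists_isProx hP hP.continuousOn_g hbdd hx)

/-- Adding the growth inequalities at two prox points gives `‖p - p'‖² ≤ 2 (∇ωX(x) - ∇ωX(x'))(p -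
p')`, so the prox map is `2β`-Lipschitz. Continuity makes the displacement measurable and bounded on
compact sets. -/
theorem continuousOn_prox (hP : P.Admissible) (hΦ : P.Coupling Φ)
    (hbdd : BddBelow (P.q Φ '' P.X)) : ContinuousOn (fun x => P.prox (P.q Φ) x P.lam) P.X := by
  have hγ := hP.γ_pos
  have hβ := hP.β_pos
  refine LipschitzOnWith.continuousOn (K := ⟨2 * P.β, by linarith⟩)
    (LipschitzOnWith.of_dist_le_mul fun x hx x' hx' => ?_)
  rw [dist_eq_norm, dist_eq_norm]
  change _ ≤ 2 * P.β * _
  set p := P.prox (P.q Φ) x P.lam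
  set p' := P.prox (P.q Φ) x' P.lam
  have hp : P.IsProx (P.q Φ) P.lam x p := hΦ.isProx_prox hP hbdd hx
  have hp' : P.IsProx (P.q Φ) P.lam x' p' := hΦ.isProx_prox hP hbdd hx'
  have h1 := hΦ.isProx_growth hP hP.continuousOn_g hp hp'.1
  have h2 := hΦ.isProx_growth hP hP.continuousOn_g hp' hp.1
  simp only [Problem.proxObj, P.inv_lam, bregman, map_sub] at h1 h2
  rw [norm_sub_rev p' p] at h1
  have h3 := apply_le_norm_mul (fderiv ℝ (re P.ωX) x - fderiv ℝ (re P.ωX) x') (p - p')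
  have h4 := mul_le_mul_of_nonneg_right (hP.ωX_lipschitz x hx x' hx') (norm_nonneg (p - p'))
  simp only [sub_apply, map_sub] at h3
  have h5 : P.γ * (‖p - p'‖ * ‖p - p'‖) ≤ P.γ * (2 * P.β * ‖x - x'‖ * ‖p - p'‖) := by
    nlinarith
  have h6 := le_of_mul_le_mul_left h5 hγ
  rcases (norm_nonneg (p - p')).eq_or_lt with h0 | h0
  · rw [← h0]; positivity
  · exact le_of_mul_le_mul_right h6 h0

/-- The smoothed envelope, in terms of the displacement of the proximal point of `q`. -/
theorem envelope_le (hP : P.Admissible) (hΦ : P.Coupling Φ) {η : ℝ} (hη : 0 ≤ η)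
    (hbdd : BddBelow (P.q Φ '' P.X)) {x : 𝕏} (hx : x ∈ P.X) :
    P.envelope (P.qSm Φ (P.rho η)) P.lam x ≤
      P.q Φ x - P.γ / 2 * ‖x - P.prox (P.q Φ) x P.lam‖ ^ 2 + η / 4 := by
  have hp := hΦ.isProx_prox hP hbdd hx
  obtain ⟨u, hu⟩ := hΦ.exists_isProx hP (hP.continuousOn_penalty (P.rho η))
    (hΦ.bddBelow_obj_penalty hP hη hbdd) hx
  have h1 := hΦ.isProx_growth hP hP.continuousOn_g hp hx
  have h2 := le_of_abs_le (hΦ.abs_qSm_sub_q_le hP hη hp.1)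
  have h3 : P.envelope (P.qSm Φ (P.rho η)) P.lam x ≤
      P.proxObj (P.qSm Φ (P.rho η)) P.lam (P.prox (P.q Φ) x P.lam) x := by
    rw [Problem.qSm_eq_obj]
    refine csInf_le ⟨P.proxObj (P.obj Φ (P.penalty (P.rho η))) P.lam u x, ?_⟩
      (mem_image_of_mem _ hp.1)
    rintro _ ⟨z, hz, rfl⟩
    exact hu.2 hz
  rw [Problem.qSm_eq_obj] at h3
  rw [Problem.qSm_eq_obj]
  simp only [Problem.proxObj, bregman_self, mul_zero, add_zero] at h1 h3
  have h4 : P.obj Φ (re P.g) = P.q Φ := rfl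
  rw [h4] at h1 h2
  linarith

end Problem.Coupling

variable [MeasurableSpace 𝕏] [BorelSpace 𝕏] [MeasurableSpace 𝕐] [BorelSpace 𝕐]
variable {Ξ : Type w} [MeasurableSpace Ξ] {μ : Measure Ξ} {O : Oracle 𝕏 𝕐 Ξ}
variable {Ω : Type w'} [MeasurableSpace Ω] {ν : Measure Ω} [IsProbabilityMeasure ν]

/-- Conditional expectation given `X` of a bounded function of `X` and an independent `Y`. -/
theorem condExp_comap_of_indepFun {α β : Type*} [MeasurableSpace α] [MeasurableSpace β] {X : Ω → α}
    {Y : Ω → β} (hX : Measurable X) (hY : Measurable Y) (hind : IndepFun X Y ν) {J : α → β → ℝ}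
    (hJ : Measurable (Function.uncurry J)) {M : ℝ} (hM : 0 ≤ M) (hJM : ∀ x t, |J x t| ≤ M) :
    (fun o => ∫ t, J (X o) t ∂ν.map Y) =ᵐ[ν]
      ν[fun o => J (X o) (Y o) | MeasurableSpace.comap X inferInstance] := by
  set π := ν.map Y with hπ
  have hπp : IsProbabilityMeasure π := Measure.isProbabilityMeasure_map hY.aemeasurable
  have hφm : Measurable fun x => ∫ t, J x t ∂π :=
    (hJ.stronglyMeasurable.integral_prod_right (ν := π)).measurable
  have hφb : ∀ x, ‖∫ t, J x t ∂π‖ ≤ M := fun x => by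
    have := norm_integral_le_of_norm_le_const (μ := π) (f := J x) (Eventually.of_forall (hJM x))
    simpa using this
  have hφi : Integrable (fun o => ∫ t, J (X o) t ∂π) ν :=
    Integrable.of_bound (hφm.comp hX).aestronglyMeasurable M (Eventually.of_forall fun o => hφb _)
  have hint : Integrable (fun o => J (X o) (Y o)) ν :=
    Integrable.of_bound (hJ.comp (hX.prodMk hY)).aestronglyMeasurable M
      (Eventually.of_forall fun o => hJM _ _)
  refine ae_eq_condExp_of_forall_setIntegral_eq hX.comap_le hint
    (fun _ _ _ => hφi.integrableOn) ?_ (hφm.comp (comap_measurable X)).aestronglyMeasurable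
  -- Events known from `X` are preimages of sets `B`; the indicator of `B` is moved into the
  -- integrand and the product formula applied.
  rintro _ ⟨B, hB, rfl⟩ -
  have h1 : Measurable (Function.uncurry fun x t => B.indicator (fun _ => (1 : ℝ)) x * J x t) :=
    ((measurable_const.indicator hB).comp measurable_fst).mul hJ
  have hb : ∀ x t, |B.indicator (fun _ => (1 : ℝ)) x * J x t| ≤ M := fun x t => by
    by_cases hx : x ∈ B
    · simpa [hx] using hJM x t
    · simpa [hx] using hM
  obtain ⟨-, k2⟩ := integral_of_indepFun (C := M) hX hY hind hπ.symm h1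
    (fun o => Integrable.of_bound (h1.comp measurable_prodMk_left).aestronglyMeasurable M
      (Eventually.of_forall (hb _))) (fun o => by
      have h2 := norm_integral_le_of_norm_le_const (μ := π)
        (f := fun t => |B.indicator (fun _ => (1 : ℝ)) (X o) * J (X o) t|) (C := M)
        (Eventually.of_forall fun t => by simpa using hb (X o) t)
      simp only [probReal_univ, mul_one] at h2
      exact (le_abs_self _).trans h2)
  rw [← integral_indicator (hX hB), ← integral_indicator (hX hB)]
  have h3 : ∀ o, (X ⁻¹' B).indicator (fun o => ∫ t, J (X o) t ∂π) o =
      ∫ t, B.indicator (fun _ => (1 : ℝ)) (X o) * J (X o) t ∂π := fun o => by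
    rw [integral_const_mul]
    by_cases hx : X o ∈ B <;> simp [hx]
  have h4 : ∀ o, (X ⁻¹' B).indicator (fun o => J (X o) (Y o)) o =
      B.indicator (fun _ => (1 : ℝ)) (X o) * J (X o) (Y o) := fun o => by
    by_cases hx : X o ∈ B <;> simp [hx]
  simp only [h3]
  rw [← k2]
  exact (integral_congr_ae (Eventually.of_forall h4)).symm

/-- Accuracy for every fixed start point gives the conditional criterion for an independent random
start point. -/
theorem stepCriterion_of_accuracy (hP : P.Admissible) (hΦ : P.Coupling Φ) (hO : O.Valid P Φ μ)
    (A : Method P) {η : ℝ} {S S' : Set 𝕏} (hSX : S ⊆ P.X) (hS'X : S' ⊆ P.X) (hS : IsCompact S)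
    (hS' : IsCompact S') {s : ℕ → Ω → Ξ} (hs : ∀ i, Measurable (s i))
    (hres : ∀ x ∈ S, ∀ t : ℕ → Ξ, A.result O x t ∈ S')
    (hacc : ∀ x ∈ S, ∫ o, P.proxObj (P.qSm Φ (P.rho η)) P.lam (A.result O x fun i => s i o) x ∂ν ≤
      P.envelope (P.qSm Φ (P.rho η)) P.lam x + η)
    {xk : Ω → 𝕏} (hxk : Measurable xk) (hxkS : ∀ o, xk o ∈ S)
    (hind : IndepFun xk (fun o i => s i o) ν) :
    StepCriterion P Φ η ν xk fun o => A.result O (xk o) fun i => s i o := by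
  set h : 𝕏 × 𝕏 → ℝ := fun z => P.proxObj (P.qSm Φ (P.rho η)) P.lam z.1 z.2 with hh
  have hcont : ContinuousOn h (S' ×ˢ S) := by
    have := hΦ.continuousOn_proxObj hP (hP.continuousOn_penalty (P.rho η))
    rw [← Problem.qSm_eq_obj] at this
    exact this.mono (prod_mono hS'X hSX)
  have hR : Measurable fun o => A.result O (xk o) fun i => s i o :=
    A.measurable_result hO.measurable_primal hO.measurable_dual hxk hs
  have hint : Integrable (fun o => h (A.result O (xk o) (fun i => s i o), xk o)) ν :=
    hcont.integrable_comp_of_isCompact (hS'.prod hS) (hR.prodMk hxk) fun o =>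
      ⟨hres _ (hxkS o) _, hxkS o⟩
  obtain ⟨o₀⟩ := ν.nonempty_of_neZero
  -- Clamping the start point makes the integrand measurable and bounded on the whole space without
  -- changing it along `xk`.
  have hclS : ∀ x, clamp S (xk o₀) x ∈ S := clamp_mem (hxkS o₀)
  have hclm : Measurable (clamp S (xk o₀)) := measurable_clamp hS.isClosed.measurableSet _
  have hclk : ∀ o, clamp S (xk o₀) (xk o) = xk o := fun o => clamp_of_mem (hxkS o)
  have hpair : Measurable fun p : 𝕏 × (ℕ → Ξ) =>
      (A.result O (clamp S (xk o₀) p.1) p.2, clamp S (xk o₀) p.1) :=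
    (A.measurable_result hO.measurable_primal hO.measurable_dual (hclm.comp measurable_fst)
      (s := fun i (p : 𝕏 × (ℕ → Ξ)) => p.2 i)
      fun i => (measurable_pi_apply i).comp measurable_snd).prodMk (hclm.comp measurable_fst)
  have hJm : Measurable (Function.uncurry fun (x : 𝕏) (t : ℕ → Ξ) =>
      h (A.result O (clamp S (xk o₀) x) t, clamp S (xk o₀) x)) :=
    hcont.measurable_comp hpair fun p => ⟨hres _ (hclS _) _, hclS _⟩
  obtain ⟨M, hM⟩ := (hS'.prod hS).exists_bound_of_continuousOn hcont
  have hJb : ∀ (x : 𝕏) (t : ℕ → Ξ),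
      |h (A.result O (clamp S (xk o₀) x) t, clamp S (xk o₀) x)| ≤ M :=
    fun x t => hM _ ⟨hres _ (hclS _) _, hclS _⟩
  have hM0 : 0 ≤ M := (abs_nonneg _).trans (hJb (xk o₀) fun i => s i o₀)
  have hsm : Measurable fun o i => s i o := measurable_pi_iff.2 hs
  have hcond := condExp_comap_of_indepFun hxk hsm hind hJm hM0 hJb
  simp only [hclk] at hcond
  refine ⟨hxk, hR, hint, ?_⟩
  filter_upwards [hcond] with o ho
  refine ho.symm.le.trans ?_
  have hJx : Measurable fun t : ℕ → Ξ => h (A.result O (xk o) t, xk o) := by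
    have h1 := hJm.comp (measurable_prodMk_left (x := xk o))
    simpa only [Function.comp_def, Function.uncurry, hclk] using h1
  rw [integral_map hsm.aemeasurable hJx.aestronglyMeasurable]
  exact hacc _ (hxkS o)

/-- Sum of the squared displacements along inexact proximal iterates. -/
theorem sum_sq_dist_le (hP : P.Admissible) (hΦ : P.Coupling Φ) {η : ℝ} (hη : 0 ≤ η)
    (hbdd : BddBelow (P.q Φ '' P.X)) {K : ℕ} {x : ℕ → Ω → 𝕏} {S : ℕ → Set 𝕏}
    (hS : ∀ k ≤ K, IsCompact (S k)) (hSX : ∀ k ≤ K, S k ⊆ P.X) (hxm : ∀ k, Measurable (x k))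
    (hxS : ∀ k ≤ K, ∀ o, x k o ∈ S k)
    (hcrit : ∀ k < K, StepCriterion P Φ η ν (x k) (x (k + 1))) :
    (∀ k ≤ K, Integrable (fun o => ‖x k o - P.prox (P.q Φ) (x k o) P.lam‖ ^ 2) ν) ∧
    P.γ / 2 * ∑ k ∈ Finset.range K, ∫ o, ‖x k o - P.prox (P.q Φ) (x k o) P.lam‖ ^ 2 ∂ν ≤
      ∫ o, P.q Φ (x 0 o) ∂ν - sInf (P.q Φ '' P.X) + K * (3 / 2 * η) := by
  have hprox := hΦ.continuousOn_prox hP hbdd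
  have hqc : ContinuousOn (P.q Φ) P.X := hΦ.continuousOn_obj hP hP.continuousOn_g
  have hZ : ∀ k ≤ K, Integrable (fun o => ‖x k o - P.prox (P.q Φ) (x k o) P.lam‖ ^ 2) ν :=
    fun k hk => ContinuousOn.integrable_comp_of_isCompact (K := S k)
      (h := fun z => ‖z - P.prox (P.q Φ) z P.lam‖ ^ 2)
      (((continuousOn_id.sub (hprox.mono (hSX k hk))).norm).pow 2) (hS k hk) (hxm k) (hxS k hk)
  have hq : ∀ k ≤ K, Integrable (fun o => P.q Φ (x k o)) ν := fun k hk =>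
    (hqc.mono (hSX k hk)).integrable_comp_of_isCompact (hS k hk) (hxm k) (hxS k hk)
  refine ⟨hZ, ?_⟩
  have hstep : ∀ k < K, ∫ o, P.q Φ (x (k + 1) o) ∂ν ≤ ∫ o, P.q Φ (x k o) ∂ν -
      P.γ / 2 * ∫ o, ‖x k o - P.prox (P.q Φ) (x k o) P.lam‖ ^ 2 ∂ν + 3 / 2 * η := by
    intro k hk
    obtain ⟨hm1, hm2, hint, hle⟩ := hcrit k hk
    have hqk := hq k hk.le
    have hZk := (hZ k hk.le).const_mul (P.γ / 2)
    have h1 := integral_condExp (μ := ν) hm1.comap_le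
      (f := fun o => P.proxObj (P.qSm Φ (P.rho η)) P.lam (x (k + 1) o) (x k o))
    have hU : Integrable (fun o => P.q Φ (x k o) - P.γ / 2 *
        ‖x k o - P.prox (P.q Φ) (x k o) P.lam‖ ^ 2 + 5 / 4 * η) ν :=
      (hqk.sub hZk).add (integrable_const _)
    -- Here `5/4 η` is the inexactness `η` plus the smoothing error `η/4` of the envelope; returning
    -- from `q_ρ` to `q` in `h3` costs another `η/4`.
    have h2 : ∫ o, P.proxObj (P.qSm Φ (P.rho η)) P.lam (x (k + 1) o) (x k o) ∂ν ≤
        ∫ o, (P.q Φ (x k o) - P.γ / 2 *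
          ‖x k o - P.prox (P.q Φ) (x k o) P.lam‖ ^ 2 + 5 / 4 * η) ∂ν := by
      rw [← h1]
      refine integral_mono_ae integrable_condExp hU ?_
      filter_upwards [hle] with o ho
      refine ho.trans ?_
      have := hΦ.envelope_le hP hη hbdd (hSX k hk.le (hxS k hk.le o))
      linarith
    have h3 : ∫ o, (P.q Φ (x (k + 1) o) - η / 4) ∂ν ≤
        ∫ o, P.proxObj (P.qSm Φ (P.rho η)) P.lam (x (k + 1) o) (x k o) ∂ν := by
      refine integral_mono ((hq (k + 1) hk).sub (integrable_const _)) hint fun o => ?_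
      have hxX := hSX k hk.le (hxS k hk.le o)
      have hxX' := hSX (k + 1) hk (hxS (k + 1) hk o)
      have h4 := neg_le_of_abs_le (hΦ.abs_qSm_sub_q_le hP hη hxX')
      have h5 := hP.le_bregman hxX hxX'
      have h6 : 0 ≤ 2 * P.γ * bregman P.ωX (x (k + 1) o) (x k o) :=
        mul_nonneg (by linarith [hP.γ_pos])
          ((by positivity : (0 : ℝ) ≤ 1 / 2 * ‖x (k + 1) o - x k o‖ ^ 2).trans h5)
      rw [← Problem.qSm_eq_obj, ← Problem.q_eq_obj] at h4
      simp only [Problem.proxObj, P.inv_lam]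
      linarith
    rw [integral_sub (hq (k + 1) hk) (integrable_const _)] at h3
    rw [integral_add (f := fun o => P.q Φ (x k o) - P.γ / 2 *
      ‖x k o - P.prox (P.q Φ) (x k o) P.lam‖ ^ 2) (hqk.sub hZk) (integrable_const _),
      integral_sub hqk hZk, integral_const_mul] at h2
    simp only [integral_const, probReal_univ, one_smul] at h2 h3
    linarith
  have htel : ∀ k ≤ K, ∫ o, P.q Φ (x k o) ∂ν + P.γ / 2 * ∑ i ∈ Finset.range k,
      ∫ o, ‖x i o - P.prox (P.q Φ) (x i o) P.lam‖ ^ 2 ∂ν ≤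
        ∫ o, P.q Φ (x 0 o) ∂ν + k * (3 / 2 * η) := by
    intro k
    induction k with
    | zero => intro _; simp
    | succ k ih =>
      intro hk
      have h1 := ih (by omega)
      have h2 := hstep k (by omega)
      rw [Finset.sum_range_succ]
      push_cast
      linarith
  have h1 := htel K le_rfl
  have h2 : sInf (P.q Φ '' P.X) ≤ ∫ o, P.q Φ (x K o) ∂ν := by
    have h3 : ∫ _, sInf (P.q Φ '' P.X) ∂ν ≤ ∫ o, P.q Φ (x K o) ∂ν :=
      integral_mono (integrable_const _) (hq K le_rfl) fun o =>
        csInf_le hbdd (mem_image_of_mem _ (hSX K le_rfl (hxS K le_rfl o)))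
    simpa using h3
  linarith

end Outer

/-- Expectation at an independent uniformly distributed index. -/
theorem integral_uniform_index {Ω : Type*} [MeasurableSpace Ω] {ν : Measure Ω}
    [IsProbabilityMeasure ν] {K : ℕ} (hK : 0 < K) {I : Ω → ℕ} (hI : Measurable I)
    (hunif : ∀ k < K, ν (I ⁻¹' {k}) = 1 / (K : ENNReal)) {Z : ℕ → Ω → ℝ}
    (hZ : ∀ k < K, Integrable (Z k) ν) (hind : ∀ k < K, IndepFun I (Z k) ν) :
    Integrable (fun o => Z (I o) o) ν ∧
      ∫ o, Z (I o) o ∂ν = (K : ℝ)⁻¹ * ∑ k ∈ Finset.range K, ∫ o, Z k o ∂ν := by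
  -- The prescribed masses already add up to one, so other values of `I` have probability zero.
  have hlt : ∀ᵐ o ∂ν, I o < K := by
    have h1 : ν (⋃ k ∈ Finset.range K, I ⁻¹' {k}) = 1 := by
      rw [measure_biUnion_finset (fun i _ j _ hij => by
        refine Disjoint.preimage _ (by simpa using hij)) fun k _ => hI (measurableSet_singleton k)]
      rw [Finset.sum_congr rfl fun k hk => hunif k (Finset.mem_range.1 hk), Finset.sum_const,
        Finset.card_range, nsmul_eq_mul, ENNReal.mul_div_cancel] <;> simp [hK.ne']
    have h2 : ∀ᵐ o ∂ν, o ∈ ⋃ k ∈ Finset.range K, I ⁻¹' {k} :=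
      (mem_ae_iff_prob_eq_one (Finset.measurableSet_biUnion _
        fun k _ => hI (measurableSet_singleton k))).2 h1
    filter_upwards [h2] with o ho
    simpa using ho
  have hae : (fun o => Z (I o) o) =ᵐ[ν]
      fun o => ∑ k ∈ Finset.range K, (I ⁻¹' {k}).indicator (Z k) o := by
    filter_upwards [hlt] with o ho
    rw [Finset.sum_eq_single_of_mem (I o) (Finset.mem_range.2 ho)]
    · simp
    · intro k _ hk
      simp [Ne.symm hk]
  have hint : ∀ k ∈ Finset.range K, Integrable ((I ⁻¹' {k}).indicator (Z k)) ν := fun k hk =>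
    (hZ k (Finset.mem_range.1 hk)).indicator (hI (measurableSet_singleton k))
  have hval : ∀ k ∈ Finset.range K, ∫ o, (I ⁻¹' {k}).indicator (Z k) o ∂ν =
      (K : ℝ)⁻¹ * ∫ o, Z k o ∂ν := by
    intro k hk
    have hk' := Finset.mem_range.1 hk
    have hm : Measurable fun i : ℕ => ({k} : Set ℕ).indicator (fun _ => (1 : ℝ)) i :=
      measurable_from_top
    have h1 := ((hind k hk').comp hm measurable_id).integral_fun_mul_eq_mul_integral
      (hm.comp hI).aestronglyMeasurable (hZ k hk').aestronglyMeasurable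
    have h2 : ∀ o, (I ⁻¹' {k}).indicator (Z k) o =
        ((fun i : ℕ => ({k} : Set ℕ).indicator (fun _ => (1 : ℝ)) i) ∘ I) o * (id ∘ Z k) o := by
      intro o
      by_cases h : I o = k <;> simp [h]
    simp only [h2]
    rw [h1]
    congr 1
    have h3 : ((fun i : ℕ => ({k} : Set ℕ).indicator (fun _ => (1 : ℝ)) i) ∘ I) =
        (I ⁻¹' {k}).indicator fun _ => (1 : ℝ) := by
      funext o
      by_cases h : I o = k <;> simp [h]
    rw [h3, integral_indicator (hI (measurableSet_singleton k))]
    simp [Measure.real, hunif k hk']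
  constructor
  · exact (integrable_finsetSum _ hint).congr hae.symm
  · rw [integral_congr_ae hae, integral_finsetSum _ hint, Finset.sum_congr rfl hval,
      Finset.mul_sum]

/-! ### Methods for all steps -/

section Methods

variable {𝕏 : Type u} [NormedAddCommGroup 𝕏] [NormedSpace ℝ 𝕏] [FiniteDimensional ℝ 𝕏]
  [MeasurableSpace 𝕏] [BorelSpace 𝕏]
variable {𝕐 : Type v} [NormedAddCommGroup 𝕐] [NormedSpace ℝ 𝕐] [FiniteDimensional ℝ 𝕐]
  [MeasurableSpace 𝕐] [BorelSpace 𝕐]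
variable {P : Problem 𝕏 𝕐}

/-- If `η` exceeds the initial gap by far, then the start point is accurate enough. -/
theorem Problem.Coupling.qSm_le_envelope_add {Φ : 𝕏 → 𝕐 → ℝ} (hP : P.Admissible)
    (hΦ : P.Coupling Φ) {η Δ : ℝ} (hη : 0 ≤ η) (hηΔ : 2 * Δ ≤ η) {x₁ : 𝕏} (hx₁ : x₁ ∈ P.X)
    (hbdd : BddBelow (P.q Φ '' P.X)) (hgap : P.q Φ x₁ - sInf (P.q Φ '' P.X) ≤ Δ) :
    P.qSm Φ (P.rho η) x₁ ≤ P.envelope (P.qSm Φ (P.rho η)) P.lam x₁ + η := by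
  rw [← sub_le_iff_le_add]
  refine le_csInf (image_nonempty.2 hP.X_nonempty) ?_
  rintro _ ⟨z, hz, rfl⟩
  have h1 := le_of_abs_le (hΦ.abs_qSm_sub_q_le hP hη hx₁)
  have h2 := neg_le_of_abs_le (hΦ.abs_qSm_sub_q_le hP hη hz)
  have h3 : sInf (P.q Φ '' P.X) ≤ P.q Φ z := csInf_le hbdd (mem_image_of_mem _ hz)
  have h4 : 0 ≤ 2 * P.γ * bregman P.ωX z x₁ :=
    mul_nonneg (by linarith [hP.γ_pos])
      ((by positivity : (0 : ℝ) ≤ 1 / 2 * ‖z - x₁‖ ^ 2).trans (hP.le_bregman hx₁ hz))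
  rw [← Problem.qSm_eq_obj, ← Problem.q_eq_obj] at h1 h2
  simp only [Problem.proxObj, P.inv_lam]
  linarith

/-- The contraction phases contribute `K²`, of order `ε⁻⁴`, the averaging phases `K/η²`, of order
`ε⁻⁶`; the bound `ε² ≤ E` turns the former into the latter. -/
theorem sum_calls_le {a b m C ε : ℝ} (hm : 0 ≤ m) (hC : 0 ≤ C) (hε : 0 < ε) {K : ℕ}
    {E : ℝ} (hE : ε ^ 2 ≤ E) (hK : (K : ℝ) ≤ a * ε⁻¹ ^ 2) {η : ℝ}
    (hη : (η ^ 2)⁻¹ = b * ε⁻¹ ^ 4) {c : ℕ → ℕ}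
    (hc : ∀ k, (c k : ℝ) ≤ 2 * (m * (k + 1) + C / η ^ 2)) :
    ((∑ k ∈ Finset.range K, c k : ℕ) : ℝ) ≤ (2 * m * a ^ 2 * E + 2 * a * C * b) * ε⁻¹ ^ 6 := by
  have h1 : ((∑ k ∈ Finset.range K, c k : ℕ) : ℝ) ≤ K * (2 * (m * K + C / η ^ 2)) := by
    rw [Nat.cast_sum, ← nsmul_eq_mul]
    refine (Finset.sum_le_card_nsmul (Finset.range K) _ (2 * (m * K + C / η ^ 2))
      fun k hk => (hc k).trans ?_).trans (by simp)
    have : (k : ℝ) + 1 ≤ K := by exact_mod_cast Finset.mem_range.1 hk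
    gcongr
  have hηn : 0 ≤ b * ε⁻¹ ^ 4 := hη ▸ by positivity
  have h2 : (K : ℝ) * (2 * (m * K + C / η ^ 2)) ≤
      a * ε⁻¹ ^ 2 * (2 * (m * (a * ε⁻¹ ^ 2) + C * (b * ε⁻¹ ^ 4))) := by
    rw [div_eq_mul_inv, hη]
    have : (0 : ℝ) ≤ K := by positivity
    have : 0 ≤ a * ε⁻¹ ^ 2 := this.trans hK
    gcongr
  have h3 : ε⁻¹ ^ 4 ≤ E * ε⁻¹ ^ 6 := by
    have : ε⁻¹ ^ 4 = ε ^ 2 * ε⁻¹ ^ 6 := by field_simp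
    rw [this]
    gcongr
  have h4 := mul_le_mul_of_nonneg_left h3 (by positivity : 0 ≤ 2 * m * a ^ 2)
  refine (h1.trans h2).trans ?_
  linarith

/-- Methods for the subproblems of all steps, with their total cost. -/
theorem exists_methods (hP : P.Admissible) {x₁ : 𝕏} (hx₁ : x₁ ∈ P.X) {Δ : ℝ} (hΔ : 0 < Δ) :
    ∃ C : ℝ, ∀ ε : ℝ, 0 < ε → ∃ (A : ℕ → Method P) (R : ℕ → ℝ), 0 ≤ R 0 ∧
      ((∑ k ∈ Finset.range (P.numIter Δ ε), (A k).calls : ℕ) : ℝ) ≤ C * ε⁻¹ ^ 6 ∧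
      ∀ (Φ : 𝕏 → 𝕐 → ℝ), P.Coupling Φ → BddBelow (P.q Φ '' P.X) →
        P.q Φ x₁ - sInf (P.q Φ '' P.X) ≤ Δ →
      ∀ (Ξ : Type w) [MeasurableSpace Ξ] (μ : Measure Ξ) [IsProbabilityMeasure μ]
        (O : Oracle 𝕏 𝕐 Ξ), O.Valid P Φ μ →
      ∀ k < P.numIter Δ ε, ∀ x ∈ P.X, ‖x - x₁‖ ≤ R k →
        (∀ s : ℕ → Ξ, ‖(A k).result O x s - x₁‖ ≤ R (k + 1)) ∧
        ∀ (Ω : Type w') [MeasurableSpace Ω] (ν : Measure Ω) [IsProbabilityMeasure ν]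
          (s : ℕ → Ω → Ξ), IIDSamples s μ ν →
          ∫ o, P.proxObj (P.qSm Φ (P.rho (P.eta ε))) P.lam ((A k).result O x fun i => s i o) x ∂ν ≤
            P.envelope (P.qSm Φ (P.rho (P.eta ε))) P.lam x + P.eta ε := by
  have hβ := hP.β_pos
  have hl := hP.lam_pos
  obtain ⟨m, C, hC, hA⟩ := exists_method.{u, v, w, w'} hP hx₁ hΔ
  refine ⟨2 * m * (64 * P.β ^ 2 * Δ / P.lam) ^ 2 * (48 * P.β ^ 2 * Δ / P.lam) +
    2 * (64 * P.β ^ 2 * Δ / P.lam) * C * (24 * P.β ^ 2 / P.lam) ^ 2, fun ε hε => ?_⟩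
  have hη := hP.eta_pos hε
  -- In the opposite case `K ≤ 1`, and the start point already satisfies the criterion, so no calls
  -- are made.
  by_cases hηΔ : P.eta ε ≤ 2 * Δ
  · choose A hcalls hA using hA (P.eta ε) hη hηΔ
    refine ⟨A, P.radius Δ, hP.radius_nonneg Δ 0, ?_,
      fun Φ hΦ hb hg Ξ _ μ _ O hO k _ => hA k Φ hΦ hb hg Ξ μ O hO⟩
    have hE : ε ^ 2 ≤ 48 * P.β ^ 2 * Δ / P.lam := by
      rw [Problem.eta, div_le_iff₀ (by positivity)] at hηΔ
      rw [le_div_iff₀ hl]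
      linarith
    refine sum_calls_le (Nat.cast_nonneg m) hC hε hE ?_ ?_ hcalls
    -- The factor `64 = 16 + 48` leaves room for the ceiling, since `1 ≤ 48β²Δ/(λε²)` in this case.
    · refine (Nat.ceil_lt_add_one (by positivity)).le.trans ?_
      have h1 : 1 ≤ 48 * P.β ^ 2 * Δ / P.lam * ε⁻¹ ^ 2 := by
        rw [inv_pow, ← div_eq_mul_inv, one_le_div (by positivity)]
        exact hE
      have h2 : 16 * P.β ^ 2 * Δ / (P.lam * ε ^ 2) = 16 * P.β ^ 2 * Δ / P.lam * ε⁻¹ ^ 2 := by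
        field_simp
      have h3 : 64 * P.β ^ 2 * Δ / P.lam * ε⁻¹ ^ 2 = 16 * P.β ^ 2 * Δ / P.lam * ε⁻¹ ^ 2 +
        48 * P.β ^ 2 * Δ / P.lam * ε⁻¹ ^ 2 := by ring
      rw [h2, h3]
      linarith
    · unfold Problem.eta
      field_simp
  · push Not at hηΔ
    have hK : P.numIter Δ ε ≤ 1 := by
      unfold Problem.numIter
      rw [Nat.ceil_le, Nat.cast_one, div_le_one (by positivity)]
      rw [Problem.eta, lt_div_iff₀ (by positivity)] at hηΔ
      have : 0 < P.β ^ 2 * Δ := by positivity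
      linarith
    refine ⟨fun _ => idleMethod hP x₁ hx₁, fun _ => 0, le_rfl, ?_, ?_⟩
    · simp only [idleMethod, Finset.sum_const_zero, Nat.cast_zero]
      positivity
    · intro Φ hΦ hb hg Ξ _ μ _ O hO k hk x hx hxx
      obtain rfl : x = x₁ := by
        rw [← sub_eq_zero, ← norm_le_zero_iff]; exact hxx
      have hres : ∀ s : ℕ → Ξ, (idleMethod hP x hx₁).result O x s = x := fun s => clamp_of_mem hx₁
      refine ⟨fun s => by simp [hres], fun Ω _ ν _ s _ => ?_⟩
      simp only [hres, integral_const, probReal_univ, one_smul]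
      unfold Problem.proxObj
      rw [bregman_self, mul_zero, add_zero]
      exact hΦ.qSm_le_envelope_add hP hη.le hηΔ.le hx₁ hb hg

end Methods

/-! ### Runs of the smoothing framework -/

section Framework

variable {𝕏 : Type u} [NormedAddCommGroup 𝕏] [NormedSpace ℝ 𝕏] [FiniteDimensional ℝ 𝕏]
  [MeasurableSpace 𝕏] [BorelSpace 𝕏]
variable {𝕐 : Type v} [NormedAddCommGroup 𝕐] [NormedSpace ℝ 𝕐] [FiniteDimensional ℝ 𝕐]
  [MeasurableSpace 𝕐] [BorelSpace 𝕐]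
variable {P : Problem 𝕏 𝕐} {Φ : 𝕏 → 𝕐 → ℝ}
variable {Ξ : Type w} [MeasurableSpace Ξ] {μ : Measure Ξ} {O : Oracle 𝕏 𝕐 Ξ} {A : ℕ → Method P}
variable {Ω : Type w'} [MeasurableSpace Ω] {ν : Measure Ω} {ξ : ℕ × ℕ → Ω → Ξ}

theorem totalPrimalCalls_le (A : ℕ → Method P) (x₁ : 𝕏) (s : ℕ × ℕ → Ξ) (K : ℕ) :
    totalPrimalCalls A O x₁ s K ≤ ∑ k ∈ Finset.range K, (A k).calls :=
  Finset.sum_le_sum fun _ _ => (Finset.card_filter_le _ _).trans (Finset.card_range _).le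

theorem totalDualCalls_le (A : ℕ → Method P) (x₁ : 𝕏) (s : ℕ × ℕ → Ξ) (K : ℕ) :
    totalDualCalls A O x₁ s K ≤ ∑ k ∈ Finset.range K, (A k).calls :=
  Finset.sum_le_sum fun _ _ => (Finset.card_filter_le _ _).trans (Finset.card_range _).le

theorem iidSamples_block (hξ : ∀ i, Measurable (ξ i)) (hmap : ∀ i, ν.map (ξ i) = μ)
    (hind : iIndepFun ξ ν) (k : ℕ) : IIDSamples (fun t => ξ (k, t)) μ ν :=
  ⟨fun _ => hξ _, fun _ => hmap _, hind.precomp (Prod.mk_right_injective k)⟩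

/-- The `k`-th iterate uses samples with first index below `k` only, disjoint from block `k`. -/
theorem indepFun_iterate_block (hO : O.Valid P Φ μ) (hξ : ∀ i, Measurable (ξ i))
    (hind : iIndepFun ξ ν) (x₁ : 𝕏) (k : ℕ) :
    IndepFun (fun o => iterate A O x₁ (fun i => ξ i o) k) (fun o t => ξ (k, t) o) ν := by
  refine indepFun_of_measurable_iSup hξ hind (S := {i | i.1 < k}) (T := {i | i.1 = k})
    (Set.disjoint_left.2 fun i (hi : i.1 < k) (hi' : i.1 = k) => hi.ne hi') ?_ ?_
  · exact measurable_iterate hO.measurable_primal hO.measurable_dual x₁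
      fun i hi => measurable_iSup_comap (S := {i : ℕ × ℕ | i.1 < k}) hi
  · have h : ∀ _ : MeasurableSpace Ω, (∀ t, Measurable (ξ (k, t))) →
        Measurable fun o t => ξ (k, t) o := fun _ h => measurable_pi_iff.2 h
    exact h _ fun t => measurable_iSup_comap (S := {i : ℕ × ℕ | i.1 = k}) (i := (k, t)) rfl

theorem norm_iterate_sub_le {x₁ : 𝕏} (hx₁ : x₁ ∈ P.Xo) (hP : P.Admissible) {K : ℕ} {R : ℕ → ℝ}
    (hR : 0 ≤ R 0) (hres : ∀ k < K, ∀ x ∈ P.X, ‖x - x₁‖ ≤ R k →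
      ∀ s : ℕ → Ξ, ‖(A k).result O x s - x₁‖ ≤ R (k + 1)) (s : ℕ × ℕ → Ξ) {k : ℕ} (hk : k ≤ K) :
    ‖iterate A O x₁ s k - x₁‖ ≤ R k := by
  induction k with
  | zero => simpa [iterate] using hR
  | succ k ih => exact hres k hk _ (hP.Xo_eq ▸ iterate_mem hx₁ s k) (ih (by omega)) _

theorem stepCriterion_iterate [IsProbabilityMeasure ν] (hP : P.Admissible) (hΦ : P.Coupling Φ)
    (hO : O.Valid P Φ μ) {x₁ : 𝕏} (hx₁ : x₁ ∈ P.Xo) {K : ℕ} {R : ℕ → ℝ} (hR : 0 ≤ R 0) {η : ℝ}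
    (hres : ∀ k < K, ∀ x ∈ P.X, ‖x - x₁‖ ≤ R k →
      ∀ s : ℕ → Ξ, ‖(A k).result O x s - x₁‖ ≤ R (k + 1))
    (hacc : ∀ k < K, ∀ x ∈ P.X, ‖x - x₁‖ ≤ R k → ∀ s : ℕ → Ω → Ξ, IIDSamples s μ ν →
      ∫ o, P.proxObj (P.qSm Φ (P.rho η)) P.lam ((A k).result O x fun i => s i o) x ∂ν ≤
        P.envelope (P.qSm Φ (P.rho η)) P.lam x + η)
    (hξ : ∀ i, Measurable (ξ i)) (hmap : ∀ i, ν.map (ξ i) = μ) (hind : iIndepFun ξ ν)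
    {k : ℕ} (hk : k < K) :
    StepCriterion P Φ η ν (fun o => iterate A O x₁ (fun i => ξ i o) k)
      (fun o => iterate A O x₁ (fun i => ξ i o) (k + 1)) := by
  have hcomp : ∀ r, IsCompact (P.X ∩ Metric.closedBall x₁ r) := fun r =>
    (isCompact_closedBall x₁ r).inter_left hP.X_closed
  have hmem : ∀ {x r}, x ∈ P.X ∩ Metric.closedBall x₁ r ↔ x ∈ P.X ∧ ‖x - x₁‖ ≤ r := by
    intro x r; rw [mem_inter_iff, mem_closedBall_iff_norm]
  refine stepCriterion_of_accuracy hP hΦ hO (A k) (S := P.X ∩ Metric.closedBall x₁ (R k))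
    (S' := P.X ∩ Metric.closedBall x₁ (R (k + 1))) inter_subset_left inter_subset_left (hcomp _)
    (hcomp _) (s := fun t => ξ (k, t)) (fun _ => hξ _) ?_ ?_
    (measurable_iterate hO.measurable_primal hO.measurable_dual x₁ fun i _ => hξ i) ?_
    (indepFun_iterate_block hO hξ hind x₁ k)
  · intro x hx t
    exact hmem.2 ⟨hP.Xo_eq ▸ (A k).output_mem _, hres k hk x hx.1 (hmem.1 hx).2 t⟩
  · intro x hx
    exact hacc k hk x hx.1 (hmem.1 hx).2 _ (iidSamples_block hξ hmap hind k)
  · intro o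
    exact hmem.2 ⟨hP.Xo_eq ▸ iterate_mem hx₁ _ k, norm_iterate_sub_le hx₁ hP hR hres _ hk.le⟩

/-- The index is independent of the samples, and the displacement is a measurable function of them.
-/
theorem indepFun_dist_prox_iterate (hP : P.Admissible) (hΦ : P.Coupling Φ)
    (hbdd : BddBelow (P.q Φ '' P.X)) (hO : O.Valid P Φ μ) {x₁ : 𝕏} (hx₁ : x₁ ∈ P.Xo) {I : Ω → ℕ}
    (hind : IndepFun I (fun o i => ξ i o) ν) (k : ℕ) :
    IndepFun I (fun o => ‖iterate A O x₁ (fun i => ξ i o) k -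
      P.prox (P.q Φ) (iterate A O x₁ (fun i => ξ i o) k) P.lam‖) ν := by
  have hm : Measurable fun s : ℕ × ℕ → Ξ => ‖iterate A O x₁ s k -
      P.prox (P.q Φ) (iterate A O x₁ s k) P.lam‖ := by
    have h1 : Measurable fun s : ℕ × ℕ → Ξ => iterate A O x₁ s k :=
      measurable_iterate (ξ := fun i (s : ℕ × ℕ → Ξ) => s i) hO.measurable_primal
        hO.measurable_dual x₁ fun i _ => measurable_pi_apply i
    exact ContinuousOn.measurable_comp (h := fun z => ‖z - P.prox (P.q Φ) z P.lam‖)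
      (continuousOn_id.sub (hΦ.continuousOn_prox hP hbdd)).norm h1
      fun s => hP.Xo_eq ▸ iterate_mem hx₁ s k
  exact hind.comp measurable_id hm

/-- Put `c = ελ/β`. The choices of `K` and `η` make `Δ/K` and `3η/2` at most `ε²λ/(16β²)` each, so
the mean of `V` is at most `c²/2`, and that of `W` at most `3c/4`. -/
theorem average_dist_le (hP : P.Admissible) {Δ ε : ℝ} (hΔ : 0 < Δ) (hε : 0 < ε) {V W : ℕ → ℝ}
    (hsum : P.γ / 2 * ∑ k ∈ Finset.range (P.numIter Δ ε), V k ≤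
      Δ + P.numIter Δ ε * (3 / 2 * P.eta ε))
    (hVW : ∀ k < P.numIter Δ ε, W k ≤ (V k / (ε * P.lam / P.β) + ε * P.lam / P.β) / 2) :
    ((P.numIter Δ ε : ℕ) : ℝ)⁻¹ * ∑ k ∈ Finset.range (P.numIter Δ ε), W k ≤ ε * P.lam / P.β := by
  have hβ := hP.β_pos
  have hl := hP.lam_pos
  have hγ := hP.γ_pos
  set K := P.numIter Δ ε with hK
  set c := ε * P.lam / P.β with hc
  have hc0 : 0 < c := by positivity
  have hK1 : 16 * P.β ^ 2 * Δ / (P.lam * ε ^ 2) ≤ K := Nat.le_ceil _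
  have hK0 : (0 : ℝ) < K := lt_of_lt_of_le (by positivity) hK1
  have h1 : ∑ k ∈ Finset.range K, W k ≤ (∑ k ∈ Finset.range K, V k) / c / 2 + K * c / 2 := by
    refine (Finset.sum_le_sum fun k hk => hVW k (Finset.mem_range.1 hk)).trans (le_of_eq ?_)
    rw [← Finset.sum_div, Finset.sum_add_distrib, ← Finset.sum_div, Finset.sum_const,
      Finset.card_range, nsmul_eq_mul]
    ring
  have h2 : ∑ k ∈ Finset.range K, V k ≤ K * c ^ 2 / 2 := by
    have e1 : P.γ = 1 / (2 * P.lam) := by unfold Problem.lam; field_simp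
    rw [div_le_iff₀ (by positivity)] at hK1
    have e2 : Δ ≤ K * (P.lam * ε ^ 2) / (16 * P.β ^ 2) := by
      rw [le_div_iff₀ (by positivity)]; linarith
    have e3 : 1 / (2 * P.lam) / 2 * ∑ k ∈ Finset.range K, V k ≤
        K * (P.lam * ε ^ 2) / (16 * P.β ^ 2) + K * (3 / 2 * P.eta ε) := by
      rw [← e1]; linarith
    have e4 : K * (P.lam * ε ^ 2) / (16 * P.β ^ 2) + K * (3 / 2 * P.eta ε) =
        1 / (2 * P.lam) / 2 * (K * c ^ 2 / 2) := by
      rw [hc]; unfold Problem.eta; field_simp; ring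
    rw [e4] at e3
    exact le_of_mul_le_mul_left e3 (by positivity)
  rw [inv_mul_le_iff₀ hK0]
  have h3 : (∑ k ∈ Finset.range K, V k) / c ≤ K * c / 2 := by
    rw [div_le_iff₀ hc0]; linarith
  have : 0 < K * c := by positivity
  linarith

/-- The output of the framework is nearly stationary in expectation. -/
theorem integral_dist_prox_le [IsProbabilityMeasure ν] (hP : P.Admissible) (hΦ : P.Coupling Φ)
    (hbdd : BddBelow (P.q Φ '' P.X)) (hO : O.Valid P Φ μ) {x₁ : 𝕏} (hx₁ : x₁ ∈ P.Xo) {Δ ε : ℝ}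
    (hΔ : 0 < Δ) (hε : 0 < ε) (hgap : P.q Φ x₁ - sInf (P.q Φ '' P.X) ≤ Δ) {R : ℕ → ℝ}
    (hR : ∀ k ≤ P.numIter Δ ε, ∀ s, ‖iterate A O x₁ s k - x₁‖ ≤ R k)
    (hξ : ∀ i, Measurable (ξ i)) {I : Ω → ℕ} (hI : Measurable I)
    (hunif : ∀ k < P.numIter Δ ε, ν (I ⁻¹' {k}) = 1 / (P.numIter Δ ε : ENNReal))
    (hind : IndepFun I (fun o i => ξ i o) ν)
    (hcrit : ∀ k < P.numIter Δ ε, StepCriterion P Φ (P.eta ε) ν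
      (fun o => iterate A O x₁ (fun i => ξ i o) k)
      (fun o => iterate A O x₁ (fun i => ξ i o) (k + 1))) :
    Integrable (fun o => ‖iterate A O x₁ (fun i => ξ i o) (I o) -
        P.prox (P.q Φ) (iterate A O x₁ (fun i => ξ i o) (I o)) P.lam‖) ν ∧
      ∫ o, ‖iterate A O x₁ (fun i => ξ i o) (I o) -
        P.prox (P.q Φ) (iterate A O x₁ (fun i => ξ i o) (I o)) P.lam‖ ∂ν ≤ ε * P.lam / P.β := by
  have hβ := hP.β_pos
  have hl := hP.lam_pos
  have hxm : ∀ k, Measurable fun o => iterate A O x₁ (fun i => ξ i o) k := fun k =>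
    measurable_iterate hO.measurable_primal hO.measurable_dual x₁ fun i _ => hξ i
  have hcomp : ∀ r, IsCompact (P.X ∩ Metric.closedBall x₁ r) := fun r =>
    (isCompact_closedBall x₁ r).inter_left hP.X_closed
  have hmem : ∀ k ≤ P.numIter Δ ε, ∀ o, iterate A O x₁ (fun i => ξ i o) k ∈
      P.X ∩ Metric.closedBall x₁ (R k) := fun k hk o =>
    ⟨hP.Xo_eq ▸ iterate_mem hx₁ _ k, mem_closedBall_iff_norm.2 (hR k hk _)⟩
  obtain ⟨hV, hsum⟩ := sum_sq_dist_le hP hΦ (hP.eta_pos hε).le hbdd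
    (x := fun k o => iterate A O x₁ (fun i => ξ i o) k)
    (S := fun k => P.X ∩ Metric.closedBall x₁ (R k)) (fun _ _ => hcomp _)
    (fun _ _ => inter_subset_left) hxm hmem hcrit
  have hZ : ∀ k < P.numIter Δ ε, Integrable (fun o => ‖iterate A O x₁ (fun i => ξ i o) k -
      P.prox (P.q Φ) (iterate A O x₁ (fun i => ξ i o) k) P.lam‖) ν := fun k hk =>
    ContinuousOn.integrable_comp_of_isCompact (h := fun z => ‖z - P.prox (P.q Φ) z P.lam‖)
      ((continuousOn_id.sub (hΦ.continuousOn_prox hP hbdd)).norm.mono inter_subset_left)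
      (hcomp (R k)) (hxm k) (hmem k hk.le)
  have hK0 : 0 < P.numIter Δ ε := Nat.ceil_pos.2 (by positivity)
  obtain ⟨h1, h2⟩ := integral_uniform_index hK0 hI hunif
    (Z := fun k o => ‖iterate A O x₁ (fun i => ξ i o) k -
      P.prox (P.q Φ) (iterate A O x₁ (fun i => ξ i o) k) P.lam‖) hZ
    fun k _ => indepFun_dist_prox_iterate hP hΦ hbdd hO hx₁ hind k
  refine ⟨h1, h2.le.trans ?_⟩
  refine average_dist_le hP hΔ hε (hsum.trans ?_) fun k hk => ?_
  · have h3 : ∫ o, P.q Φ (iterate A O x₁ (fun i => ξ i o) 0) ∂ν = P.q Φ x₁ := by simp [iterate]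
    rw [h3]
    linarith
  · have hc : 0 < ε * P.lam / P.β := by positivity
    set c := ε * P.lam / P.β
    have h3 : ∫ o, (‖iterate A O x₁ (fun i => ξ i o) k -
          P.prox (P.q Φ) (iterate A O x₁ (fun i => ξ i o) k) P.lam‖ ^ 2 / c + c) / 2 ∂ν =
        ((∫ o, ‖iterate A O x₁ (fun i => ξ i o) k -
          P.prox (P.q Φ) (iterate A O x₁ (fun i => ξ i o) k) P.lam‖ ^ 2 ∂ν) / c + c) / 2 := by
      rw [integral_div, integral_add ((hV k hk.le).div_const c) (integrable_const c), integral_div]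
      simp
    rw [← h3]
    refine integral_mono (hZ k hk)
      ((((hV k hk.le).div_const c).add (integrable_const c)).div_const 2) fun o => ?_
    dsimp only
    set z := ‖iterate A O x₁ (fun i => ξ i o) k -
      P.prox (P.q Φ) (iterate A O x₁ (fun i => ξ i o) k) P.lam‖
    -- Completing the square gives `z ≤ (z²/c + c)/2`, which passes from second to first moments.
    have h4 : (z ^ 2 / c + c) / 2 - z = (z - c) ^ 2 / (2 * c) := by field_simp; ring
    have h5 : 0 ≤ (z - c) ^ 2 / (2 * c) := by positivity
    linarith

end Framework

end PDSmoothing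

end


theorem mainTheorem9
    {𝕏 : Type u} [NormedAddCommGroup 𝕏] [NormedSpace ℝ 𝕏] [FiniteDimensional ℝ 𝕏]
    [MeasurableSpace 𝕏] [BorelSpace 𝕏]
    {𝕐 : Type v} [NormedAddCommGroup 𝕐] [NormedSpace ℝ 𝕐] [FiniteDimensional ℝ 𝕐]
    [MeasurableSpace 𝕐] [BorelSpace 𝕐]
    (P : PDSmoothing.Problem 𝕏 𝕐) (hP : P.Admissible)
    (x₁ : 𝕏) (hx₁ : x₁ ∈ P.Xo) (Δ : ℝ) (hΔ : 0 < Δ) :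
    ∃ C : ℝ, ∀ ε : ℝ, 0 < ε →
      ∃ A : ℕ → PDSmoothing.Method P,
        ∀ (Φ : 𝕏 → 𝕐 → ℝ), P.Coupling Φ →
          BddBelow (P.q Φ '' P.X) → P.q Φ x₁ - sInf (P.q Φ '' P.X) ≤ Δ →
        ∀ (Ξ : Type w) [MeasurableSpace Ξ] (μ : Measure Ξ) [IsProbabilityMeasure μ]
          (O : PDSmoothing.Oracle 𝕏 𝕐 Ξ), O.Valid P Φ μ →
        ∀ (Ω : Type w') [MeasurableSpace Ω] (ν : Measure Ω) [IsProbabilityMeasure ν]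
          (ξ : ℕ × ℕ → Ω → Ξ) (I : Ω → ℕ),
          (∀ i, Measurable (ξ i)) → (∀ i, ν.map (ξ i) = μ) → iIndepFun ξ ν →
          Measurable I →
          (∀ k < P.numIter Δ ε, ν (I ⁻¹' {k}) = 1 / (P.numIter Δ ε : ENNReal)) →
          IndepFun I (fun o i => ξ i o) ν →
        -- every step satisfies the inexactness criterion of the framework
        (∀ k < P.numIter Δ ε,
          PDSmoothing.StepCriterion P Φ (P.eta ε) ν
            (fun o => PDSmoothing.iterate A O x₁ (fun i => ξ i o) k)
            (fun o => PDSmoothing.iterate A O x₁ (fun i => ξ i o) (k + 1))) ∧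
        -- the proximal point is well defined
        (∀ x ∈ P.Xo, ∃! p, P.IsProx (P.q Φ) P.lam x p) ∧
        -- the output, a uniformly chosen iterate, is near-stationary in expectation
        (∀ o, PDSmoothing.iterate A O x₁ (fun i => ξ i o) (I o) ∈ P.Xo) ∧
        Measurable (fun o => PDSmoothing.iterate A O x₁ (fun i => ξ i o) (I o)) ∧
        Integrable (fun o => ‖PDSmoothing.iterate A O x₁ (fun i => ξ i o) (I o) -
          P.prox (P.q Φ) (PDSmoothing.iterate A O x₁ (fun i => ξ i o) (I o)) P.lam‖) ν ∧
        ∫ o, ‖PDSmoothing.iterate A O x₁ (fun i => ξ i o) (I o) -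
          P.prox (P.q Φ) (PDSmoothing.iterate A O x₁ (fun i => ξ i o) (I o)) P.lam‖ ∂ν
            ≤ ε * P.lam / P.β ∧
        -- total numbers of primal and dual stochastic oracle calls
        (∀ o, (PDSmoothing.totalPrimalCalls A O x₁ (fun i => ξ i o) (P.numIter Δ ε) : ℝ)
          ≤ C * ε⁻¹ ^ 6) ∧
        (∀ o, (PDSmoothing.totalDualCalls A O x₁ (fun i => ξ i o) (P.numIter Δ ε) : ℝ)
          ≤ C * ε⁻¹ ^ 6) := by
  obtain ⟨C, hC⟩ := PDSmoothing.exists_methods.{u, v, w, w'} hP hx₁.1 hΔ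
  refine ⟨C, fun ε hε => ?_⟩
  obtain ⟨A, R, hR, hcalls, hA⟩ := hC ε hε
  refine ⟨A, fun Φ hΦ hbdd hgap Ξ _ μ _ O hO Ω _ ν _ ξ I hξ hmap hind hI hunif hIξ => ?_⟩
  have hA := hA Φ hΦ hbdd hgap Ξ μ O hO
  have hres := fun k hk x hx hxR => (hA k hk x hx hxR).1
  have hcrit := fun k hk => PDSmoothing.stepCriterion_iterate hP hΦ hO hx₁ hR hres
    (fun k hk x hx hxR => (hA k hk x hx hxR).2 Ω ν) hξ hmap hind (k := k) hk
  obtain ⟨hint, hle⟩ := PDSmoothing.integral_dist_prox_le hP hΦ hbdd hO hx₁ hΔ hε hgap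
    (fun k hk s => PDSmoothing.norm_iterate_sub_le hx₁ hP hR hres s hk) hξ hI hunif hIξ hcrit
  refine ⟨hcrit, fun x hx => ?_, fun o => PDSmoothing.iterate_mem hx₁ _ _, ?_, hint, hle,
    fun o => ?_, fun o => ?_⟩
  · obtain ⟨p, hp⟩ := hΦ.exists_isProx hP hP.continuousOn_g hbdd hx.1
    exact ⟨p, hp, fun p' hp' => hΦ.isProx_unique hP hP.continuousOn_g hp hp'⟩
  -- The index set is countable, so measurability of each iterate gives joint measurability in index
  -- and outcome.
  · have hm : Measurable fun z : ℕ × Ω => PDSmoothing.iterate A O x₁ (fun i => ξ i z.2) z.1 :=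
      measurable_from_prod_countable_right fun k =>
        PDSmoothing.measurable_iterate hO.measurable_primal hO.measurable_dual x₁ fun i _ => hξ i
    exact hm.comp (hI.prodMk measurable_id)
  · exact (Nat.cast_le.2 (PDSmoothing.totalPrimalCalls_le A x₁ _ _)).trans hcalls
  · exact (Nat.cast_le.2 (PDSmoothing.totalDualCalls_le A x₁ _ _)).trans hcalls
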